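/- \textbf{Setting.} Let $l^{(1)},l^{(2)},l^{(3)}>0$ with $l^{(1)}+l^{(2)}+l^{(3)}=1$, and let $a_1,a_3>0$, $a_2=1$. For $\varepsilon>0$ put $a_1(\varepsilon)=a_1$, $a_3(\varepsilon)=a_3$ (stiff edges) and $a_2(\varepsilon)=a_2\varepsilon=\varepsilon$ (soft edge). Let $\mathbb G$ be the metric graph with two vertices $V_1,V_2$ and edges $e^{(j)}=[0,l^{(j)}]$, $j=1,2,3$, where $e^{(2)}$ goes from $V_1$ (left endpoint) to $V_2$ (right endpoint), and $e^{(1)},e^{(3)}$ go from $V_2$ (left endpoint) to $V_1$ (right endpoint). For $\tau\in[-\pi,\pi)$ define the unimodular weights $$\{w_{V_1}(e^{(j)})\}_{j=1}^3=\{1,1,e^{i\tau(l^{(2)}+l^{(3)})}\},\qquad \{w_{V_2}(e^{(j)})\}_{j=1}^3=\{e^{i\tau l^{(3)}},1,1\},$$ and write $\partial^{(\tau)}u=\bigl(\frac{d}{dx}+i\tau\bigr)u$. In $H=\bigoplus_{j=1}^3L^2(0,l^{(j)})$ let $A_\varepsilon^{(\tau)}$ act by $-\frac{a_j(\varepsilon)^2}{\varepsilon^2}\bigl(\frac{d}{dx}+i\tau\bigr)^2$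 on $e^{(j)}$, on the domain of all $u=(u_j)$, $u_j\in W^{2,2}(0,l^{(j)})$, such that at each vertex $V$ the values $w_V(e^{(j)})u_j(V)$, $j=1,2,3$, coincide, and $$\sum_{j=1}^3\pm\, w_V(e^{(j)})\frac{a_j(\varepsilon)^2}{\varepsilon^2}\,\partial^{(\tau)}u_j(V)=0,$$ with the sign $+$ if $V$ is the left endpoint of $e^{(j)}$ and $-$ if it is the right endpoint. Let $H_{\rm soft}=L^2(0,l^{(2)})$, $H_{\rm stiff}=L^2(0,l^{(1)})\oplus L^2(0,l^{(3)})$ and $H_{\rm hom}=H_{\rm soft}\oplus\mathbb C$. Put $$\xi^{(\tau)}=-\frac{a_1^2}{l^{(1)}}e^{i\tau(l^{(1)}+l^{(3)})}-\frac{a_3^2}{l^{(3)}}e^{-i\tau l^{(2)}},\qquad w_\tau=-\frac{\xi^{(\tau)}}{|\xi^{(\tau)}|}.$$ ($\xi^{(\tau)}=0$ only if $\tau=-\pi$ and $a_1^2/l^{(1)}=a_3^2/l^{(3)}$; then $w_{-\pi}$ is defined by continuity, that is, $w_\tau=e^{i\tau(l^{(1)}+l^{(3)}-l^{(2)})/2}$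 for all $\tau\in[-\pi,\pi)$.) Let $\mathcal A_{\rm hom}^{(\tau)}$ (which depends on $\varepsilon$) be the operator in $H_{\rm hom}$ with domain $$\Bigl\{(u,\beta)^\top\in H_{\rm hom}:\ u\in W^{2,2}(0,l^{(2)}),\ u|_0=\overline{w_\tau}\,u|_{l^{(2)}}=\frac{\beta}{\sqrt{l^{(1)}+l^{(3)}}}\Bigr\}$$ and action $$\mathcal A_{\rm hom}^{(\tau)}\binom u\beta=\begin{pmatrix}\bigl(\frac1i\frac d{dx}+\tau\bigr)^2u\\[0.6em]-\dfrac{1}{\sqrt{l^{(1)}+l^{(3)}}}\Bigl(\partial^{(\tau)}u|_0-\overline{w_\tau}\,\partial^{(\tau)}u|_{l^{(2)}}\Bigr)+\bigl(l^{(1)}+l^{(3)}\bigr)^{-1}\Bigl(\dfrac{l^{(1)}}{a_1^2}+\dfrac{l^{(3)}}{a_3^2}\Bigr)^{-1}\Bigl(\dfrac\tau\varepsilon\Bigr)^2\beta\end{pmatrix}.$$ For a compact set $K\subset\mathbb C$ and $\sigma>0$ let $K_\sigma=\{z\in K:\ \mathrm{dist}(z,\mathbb R)\ge\sigma\}$.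 \textbf{Theorem.} For all $\varepsilon>0$ and $\tau\in[-\pi,\pi)$ the operators $A_\varepsilon^{(\tau)}$ and $\mathcal A_{\rm hom}^{(\tau)}$ are self-adjoint. There are partial isometries $\Psi=\Psi^{(\tau)}$ from $H$ to $H_{\rm hom}$, $\tau\in[-\pi,\pi)$, independent of $\varepsilon$ and $z$, which act as the identity on $H_{\rm soft}$ and map $H_{\rm stiff}$ into $\mathbb C$, such that for every compact $K\subset\mathbb C$ and every $\sigma>0$ there are $C$ and $\varepsilon_0>0$ with $$\bigl\|(A_\varepsilon^{(\tau)}-z)^{-1}-\Psi^*(\mathcal A_{\rm hom}^{(\tau)}-z)^{-1}\Psi\bigr\|_{H\to H}\le C\varepsilon^2\qquad\text{for all }\varepsilon\in(0,\varepsilon_0],\ \tau\in[-\pi,\pi),\ z\in K_\sigma.$$ -/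

import Mathlib

open MeasureTheory Set

noncomputable section

/-- The complex Hilbert space `L²(0, l)`. -/
abbrev L2 (l : ℝ) : Type := Lp ℂ 2 (volume.restrict (Ioo (0 : ℝ) l))

/-- `u` belongs to the Sobolev space `W^{2,2}(0, l)`: it has a `C¹` representative `U` on `[0, l]`
whose derivative `U'` is absolutely continuous, with `u'' = (U')'` in `L²(0, l)`.  On `[0, l]` the
functions `U` and `U'` are determined by `u`, and give the boundary values of `u` and of `u'`. -/
structure IsW22 (l : ℝ) (u : L2 l) (U U' : ℝ → ℂ) (u'' : L2 l) : Prop where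
  rep : u =ᵐ[volume.restrict (Ioo (0 : ℝ) l)] U
  fst : ∀ x ∈ Icc (0 : ℝ) l, U x = U 0 + ∫ t in (0 : ℝ)..x, U' t
  snd : ∀ x ∈ Icc (0 : ℝ) l, U' x = U' 0 + ∫ t in (0 : ℝ)..x, u'' t

/-- The value at `x` of `∂^{(τ)} u = (d/dx + iτ) u`. -/
def twDeriv (τ : ℝ) (U U' : ℝ → ℂ) (x : ℝ) : ℂ := U' x + Complex.I * τ * U x

/-- The value at `x` of `(d/dx + iτ)² u = u'' + 2iτ u' + (iτ)² u`. -/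
def twDeriv2 (τ : ℝ) (U U' U'' : ℝ → ℂ) (x : ℝ) : ℂ :=
  U'' x + 2 * (Complex.I * τ) * U' x + (Complex.I * τ) ^ 2 * U x

namespace IsW22

variable {l : ℝ} {u v u'' v'' : L2 l} {U U' V V' : ℝ → ℂ}

lemma intervalIntegrable_coe (u : L2 l) {x : ℝ} (hx : x ∈ Icc (0 : ℝ) l) :
    IntervalIntegrable u volume 0 x := by
  have h1 : Integrable u (volume.restrict (Ioo (0 : ℝ) l)) :=
    (Lp.memLp u).integrable (by norm_num)
  have h2 : IntegrableOn u (Ioc (0 : ℝ) l) volume := by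
    rw [integrableOn_Ioc_iff_integrableOn_Ioo]; exact h1
  rw [intervalIntegrable_iff_integrableOn_Ioc_of_le hx.1]
  exact h2.mono_set (Ioc_subset_Ioc_right hx.2)

lemma continuousOn_of_eq {F g : ℝ → ℂ} (hg : ∀ x ∈ Icc (0 : ℝ) l, IntervalIntegrable g volume 0 x)
    (h : ∀ x ∈ Icc (0 : ℝ) l, F x = F 0 + ∫ t in (0 : ℝ)..x, g t) :
    ContinuousOn F (Icc 0 l) := by
  rcases lt_or_ge l 0 with hl | hl
  · simp [Icc_eq_empty_of_lt hl]
  · have h3 : ContinuousOn (fun x => F 0 + ∫ t in (0 : ℝ)..x, g t) (Icc 0 l) := by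
      refine continuousOn_const.add ?_
      have h4 := intervalIntegral.continuousOn_primitive_interval (f := g) (μ := volume)
        (a := 0) (b := l)
        (by rw [uIcc_of_le hl, integrableOn_Icc_iff_integrableOn_Ioc]
            exact (intervalIntegrable_iff_integrableOn_Ioc_of_le hl).1 (hg l ⟨hl, le_rfl⟩))
      rwa [uIcc_of_le hl] at h4
    exact h3.congr h

lemma continuousOn_snd (h : IsW22 l u U U' u'') : ContinuousOn U' (Icc 0 l) :=
  continuousOn_of_eq (fun _ hx => intervalIntegrable_coe u'' hx) h.snd

lemma intervalIntegrable_snd (h : IsW22 l u U U' u'') {x : ℝ} (hx : x ∈ Icc (0 : ℝ) l) :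
    IntervalIntegrable U' volume 0 x := by
  refine ContinuousOn.intervalIntegrable ?_
  rw [uIcc_of_le hx.1]
  exact h.continuousOn_snd.mono (Icc_subset_Icc_right hx.2)

lemma ae_Ioc_of_ae_Ioo {p : ℝ → Prop} (h : ∀ᵐ t ∂volume.restrict (Ioo (0 : ℝ) l), p t) {x : ℝ}
    (hx : x ∈ Icc (0 : ℝ) l) : ∀ᵐ t ∂volume, t ∈ uIoc (0 : ℝ) x → p t := by
  rw [uIoc_of_le hx.1, ← ae_restrict_iff' measurableSet_Ioc]
  rw [restrict_Ioo_eq_restrict_Ioc] at h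
  exact ae_restrict_of_ae_restrict_of_subset (Ioc_subset_Ioc_right hx.2) h

lemma zero : IsW22 l 0 0 0 0 where
  rep := Lp.coeFn_zero _ _ _
  fst := by simp
  snd := fun x hx => by
    have h := intervalIntegral.integral_congr_ae (ae_Ioc_of_ae_Ioo
      (Lp.coeFn_zero ℂ 2 (volume.restrict (Ioo (0 : ℝ) l))) hx)
    rw [h]; simp

lemma add (h : IsW22 l u U U' u'') (k : IsW22 l v V V' v'') :
    IsW22 l (u + v) (U + V) (U' + V') (u'' + v'') where
  rep := (Lp.coeFn_add u v).trans (h.rep.add k.rep)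
  fst := fun x hx => by
    simp only [Pi.add_apply]
    rw [intervalIntegral.integral_add (h.intervalIntegrable_snd hx) (k.intervalIntegrable_snd hx),
      h.fst x hx, k.fst x hx]
    ring
  snd := fun x hx => by
    rw [intervalIntegral.integral_congr_ae (ae_Ioc_of_ae_Ioo (Lp.coeFn_add u'' v'') hx)]
    simp only [Pi.add_apply]
    rw [intervalIntegral.integral_add (intervalIntegrable_coe u'' hx)
      (intervalIntegrable_coe v'' hx), h.snd x hx, k.snd x hx]
    ring

lemma smul (c : ℂ) (h : IsW22 l u U U' u'') : IsW22 l (c • u) (c • U) (c • U') (c • u'') where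
  rep := (Lp.coeFn_smul c u).trans (h.rep.const_smul c)
  fst := fun x hx => by
    simp only [Pi.smul_apply, smul_eq_mul]
    rw [intervalIntegral.integral_const_mul, h.fst x hx]
    ring
  snd := fun x hx => by
    rw [intervalIntegral.integral_congr_ae (ae_Ioc_of_ae_Ioo (Lp.coeFn_smul c u'') hx)]
    simp only [Pi.smul_apply, smul_eq_mul]
    rw [intervalIntegral.integral_const_mul, h.snd x hx]
    ring

lemma ae_zero_of_primitive {F g : ℝ → ℂ}
    (hg : ∀ x ∈ Icc (0 : ℝ) l, IntervalIntegrable g volume 0 x)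
    (h : ∀ x ∈ Icc (0 : ℝ) l, F x = F 0 + ∫ t in (0 : ℝ)..x, g t)
    (h0 : ∀ᵐ x ∂volume.restrict (Ioo (0 : ℝ) l), F x = 0) :
    ∀ᵐ x ∂volume.restrict (Ioo (0 : ℝ) l), g x = 0 := by
  rcases le_or_gt l 0 with hl | hl
  · simp [Ioo_eq_empty_of_le hl]
  have hF : EqOn F 0 (Ioo 0 l) :=
    Measure.eqOn_open_of_ae_eq (μ := volume) h0 isOpen_Ioo
      ((continuousOn_of_eq hg h).mono Ioo_subset_Icc_self) continuousOn_const
  rw [ae_restrict_iff' measurableSet_Ioo]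
  filter_upwards [(hg l ⟨hl.le, le_rfl⟩).ae_hasDerivAt_integral] with x hx hxI
  have hx1 := hx (by rw [uIcc_of_le hl.le]; exact Ioo_subset_Icc_self hxI) 0 left_mem_uIcc
  have hx2 : HasDerivAt (fun y => ∫ t in (0 : ℝ)..y, g t) 0 x := by
    refine (hasDerivAt_const x (-F 0)).congr_of_eventuallyEq ?_
    filter_upwards [Ioo_mem_nhds hxI.1 hxI.2] with y hy
    have h1 := h y (Ioo_subset_Icc_self hy)
    rw [hF hy] at h1
    simp only [Pi.zero_apply] at h1
    linear_combination -h1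
  exact hx1.unique hx2

lemma ae_eq_zero (h : IsW22 l 0 U U' u'') (τ : ℝ) :
    ∀ᵐ x ∂volume.restrict (Ioo (0 : ℝ) l), twDeriv2 τ U U' u'' x = 0 := by
  have h0 : ∀ᵐ x ∂volume.restrict (Ioo (0 : ℝ) l), U x = 0 := by
    filter_upwards [h.rep, Lp.coeFn_zero ℂ 2 (volume.restrict (Ioo (0 : ℝ) l))] with x h1 h2
    rw [← h1, h2]; rfl
  have h1 := ae_zero_of_primitive (fun _ hx => h.intervalIntegrable_snd hx) h.fst h0
  have h2 := ae_zero_of_primitive (fun _ hx => intervalIntegrable_coe u'' hx) h.snd h1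
  filter_upwards [h0, h1, h2] with x a b c
  simp [twDeriv2, a, b, c]

lemma eqOn_Icc_zero {F : ℝ → ℂ} (hl : 0 < l) (hF : ContinuousOn F (Icc 0 l))
    (h0 : ∀ᵐ x ∂volume.restrict (Ioo (0 : ℝ) l), F x = 0) : EqOn F 0 (Icc 0 l) :=
  Measure.eqOn_Icc_of_ae_eq volume hl.ne (by
    rw [← restrict_Ioo_eq_restrict_Icc]; exact h0) hF continuousOn_const

lemma eq_zero (h : IsW22 l 0 U U' u'') (hl : 0 < l) :
    EqOn U 0 (Icc 0 l) ∧ EqOn U' 0 (Icc 0 l) := by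
  have h0 : ∀ᵐ x ∂volume.restrict (Ioo (0 : ℝ) l), U x = 0 := by
    filter_upwards [h.rep, Lp.coeFn_zero ℂ 2 (volume.restrict (Ioo (0 : ℝ) l))] with x h1 h2
    rw [← h1, h2]; rfl
  exact ⟨eqOn_Icc_zero hl (continuousOn_of_eq (fun _ hx => h.intervalIntegrable_snd hx) h.fst) h0,
    eqOn_Icc_zero hl h.continuousOn_snd
      (ae_zero_of_primitive (fun _ hx => h.intervalIntegrable_snd hx) h.fst h0)⟩

end IsW22

/-! ### Fibre operators on weighted metric graphs -/

/-- A finite metric graph on which every edge `e` is the segment `[0, len e]` with left endpoint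
`0` at the vertex `src e` and right endpoint `len e` at the vertex `tgt e`, together with
a coefficient `coef e` and the Datta--Das Sarma weights of the two endpoints of `e`. -/
structure WeightedGraph (V E : Type) where
  src : E → V
  tgt : E → V
  len : E → ℝ
  coef : E → ℝ
  wSrc : E → ℂ
  wTgt : E → ℂ

/-- `L²` of a metric graph: the orthogonal sum of the spaces `L²(0, len e)`. -/
abbrev GraphL2 {E : Type} (len : E → ℝ) : Type := PiLp 2 fun e => L2 (len e)

namespace WeightedGraph

variable {V E : Type} [DecidableEq V] [Fintype E]

/-- Sum over the edge endpoints at `v` of the weighted inward co-derivatives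
`± w_v(e) coef(e) (d/dx + iτ) u_e(v)`. -/
def flux (G : WeightedGraph V E) (τ : ℝ) (U U' : E → ℝ → ℂ) (v : V) : ℂ :=
  (∑ e, if G.src e = v then G.wSrc e * G.coef e * twDeriv τ (U e) (U' e) 0 else 0)
    - ∑ e, if G.tgt e = v then G.wTgt e * G.coef e * twDeriv τ (U e) (U' e) (G.len e) else 0

/-- `(u, f)` is in the graph of the fibre operator: `u ∈ W^{2,2}` on every edge, `u` satisfies
the weighted continuity condition (with common value `c v` at `v`) and the weighted Kirchhoff
condition at every vertex, and `f = -coef(e) (d/dx + iτ)² u` on every edge. -/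
def InGraph (G : WeightedGraph V E) (τ : ℝ) (u f : GraphL2 G.len) : Prop :=
  ∃ (U U' : E → ℝ → ℂ) (u'' : ∀ e, L2 (G.len e)) (c : V → ℂ),
    (∀ e, IsW22 (G.len e) (u e) (U e) (U' e) (u'' e)) ∧
    (∀ e, G.wSrc e * U e 0 = c (G.src e) ∧ G.wTgt e * U e (G.len e) = c (G.tgt e)) ∧
    (∀ v, G.flux τ U U' v = 0) ∧
    ∀ e, ∀ᵐ x ∂volume.restrict (Ioo (0 : ℝ) (G.len e)),
      f e x = -(G.coef e : ℂ) * twDeriv2 τ (U e) (U' e) (u'' e) x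

/-- The graph of the fibre operator as a subspace of `H × H`. -/
def opGraph (G : WeightedGraph V E) (τ : ℝ) : Submodule ℂ (GraphL2 G.len × GraphL2 G.len) where
  carrier := {p | G.InGraph τ p.1 p.2}
  zero_mem' := by
    refine ⟨0, 0, 0, 0, fun e => IsW22.zero, by simp, by simp [flux, twDeriv], fun e => ?_⟩
    filter_upwards [Lp.coeFn_zero ℂ 2 (volume.restrict (Ioo (0 : ℝ) (G.len e)))] with x hx
    have p : ((0 : GraphL2 G.len) e : ℝ → ℂ) x = 0 := hx
    have q : ((0 : ∀ e, L2 (G.len e)) e : ℝ → ℂ) x = 0 := hx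
    simp only [Prod.snd_zero, p, twDeriv2]
    rw [q]
    simp only [Pi.zero_apply]
    ring
  add_mem' := by
    rintro ⟨u, f⟩ ⟨v, g⟩ ⟨U, U', u'', c, h1, h2, h3, h4⟩ ⟨W, W', w'', d, k1, k2, k3, k4⟩
    refine ⟨U + W, U' + W', u'' + w'', c + d, fun e => (h1 e).add (k1 e), fun e => ⟨?_, ?_⟩,
      fun v => ?_, fun e => ?_⟩
    · simp [mul_add, (h2 e).1, (k2 e).1]
    · simp [mul_add, (h2 e).2, (k2 e).2]
    · have : G.flux τ (U + W) (U' + W') v = G.flux τ U U' v + G.flux τ W W' v := by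
        simp only [flux]
        rw [sub_add_sub_comm, ← Finset.sum_add_distrib, ← Finset.sum_add_distrib]
        congr 1 <;> refine Finset.sum_congr rfl fun e _ => ?_ <;> split_ifs <;>
          simp [twDeriv] <;> ring
      rw [this, h3, k3, add_zero]
    · filter_upwards [h4 e, k4 e, Lp.coeFn_add (f e) (g e), Lp.coeFn_add (u'' e) (w'' e)]
        with x a b p q
      have p' : ((f + g : GraphL2 G.len) e : ℝ → ℂ) x = f e x + g e x := p
      have q' : ((u'' + w'') e : ℝ → ℂ) x = u'' e x + w'' e x := q
      simp only [Prod.mk_add_mk, p', a, b, twDeriv2]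
      rw [q']
      simp only [Pi.add_apply]
      ring
  smul_mem' := by
    rintro c ⟨u, f⟩ ⟨U, U', u'', d, h1, h2, h3, h4⟩
    refine ⟨c • U, c • U', c • u'', c • d, fun e => (h1 e).smul c, fun e => ⟨?_, ?_⟩,
      fun v => ?_, fun e => ?_⟩
    · simp [← (h2 e).1, mul_left_comm]
    · simp [← (h2 e).2, mul_left_comm]
    · have : G.flux τ (c • U) (c • U') v = c * G.flux τ U U' v := by
        simp only [flux]
        rw [mul_sub, Finset.mul_sum, Finset.mul_sum]
        congr 1 <;> refine Finset.sum_congr rfl fun e _ => ?_ <;> split_ifs <;>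
          simp [twDeriv] <;> ring
      rw [this, h3, mul_zero]
    · filter_upwards [h4 e, Lp.coeFn_smul c (f e), Lp.coeFn_smul c (u'' e)] with x a p q
      have p' : ((c • f : GraphL2 G.len) e : ℝ → ℂ) x = c * f e x := p
      have q' : ((c • u'') e : ℝ → ℂ) x = c * u'' e x := q
      simp only [Prod.smul_mk, p', a, twDeriv2]
      rw [q']
      simp only [Pi.smul_apply, smul_eq_mul]
      ring

/-- The fibre operator `A^{(τ)}` of a weighted metric graph, as an unbounded operator. -/
def op (G : WeightedGraph V E) (τ : ℝ) : GraphL2 G.len →ₗ.[ℂ] GraphL2 G.len :=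
  (G.opGraph τ).toLinearPMap

/-- `opGraph` is single-valued, so it is the graph of `op`. -/
theorem graph_op (G : WeightedGraph V E) (τ : ℝ) : (G.op τ).graph = G.opGraph τ := by
  refine Submodule.toLinearPMap_graph_eq _ ?_
  rintro ⟨u, f⟩ ⟨U, U', u'', c, h1, -, -, h4⟩ (rfl : u = 0)
  ext1 e
  refine Lp.ext ?_
  filter_upwards [h4 e, (h1 e).ae_eq_zero τ,
    Lp.coeFn_zero ℂ 2 (volume.restrict (Ioo (0 : ℝ) (G.len e)))] with x a b d
  rw [a, b, mul_zero]
  exact d.symm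

end WeightedGraph

/-! ### The example: two vertices, a soft edge `e2` and two stiff edges `e1`, `e3` -/

inductive Vertex
  | V1
  | V2
  deriving DecidableEq

instance : Fintype Vertex := ⟨{.V1, .V2}, fun x => by cases x <;> simp⟩

inductive Edge
  | e1
  | e2
  | e3
  deriving DecidableEq

instance : Fintype Edge := ⟨{.e1, .e2, .e3}, fun x => by cases x <;> simp⟩

/-- The weight `a_e(ε)`: equal to `a_e` on the stiff edges and to `a_e ε` on the soft edge. -/
def edgeWeight (a : Edge → ℝ) (ε : ℝ) : Edge → ℝ
  | .e2 => a .e2 * ε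
  | e => a e

/-- The graph of the example: `e2` runs from `V1` to `V2`, and `e1`, `e3` run from `V2` to `V1`.
The weights are `w_{V1}(e1), w_{V1}(e2), w_{V1}(e3) = 1, 1, e^{iτ(l₂+l₃)}` and
`w_{V2}(e1), w_{V2}(e2), w_{V2}(e3) = e^{iτ l₃}, 1, 1`. -/
def exGraph (l a : Edge → ℝ) (ε τ : ℝ) : WeightedGraph Vertex Edge where
  src
    | .e1 => .V2
    | .e2 => .V1
    | .e3 => .V2
  tgt
    | .e1 => .V1
    | .e2 => .V2
    | .e3 => .V1
  len := l
  coef e := edgeWeight a ε e ^ 2 / ε ^ 2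
  wSrc
    | .e1 => Complex.exp (Complex.I * τ * l .e3)
    | .e2 => 1
    | .e3 => 1
  wTgt
    | .e1 => 1
    | .e2 => 1
    | .e3 => Complex.exp (Complex.I * τ * (l .e2 + l .e3))

/-- The operator `A_ε^{(τ)}` in `H = L²(0,l₁) ⊕ L²(0,l₂) ⊕ L²(0,l₃)`. -/
def fibreOp (l a : Edge → ℝ) (ε τ : ℝ) : GraphL2 l →ₗ.[ℂ] GraphL2 l :=
  (exGraph l a ε τ).op τ

/-! ### The homogenised operator -/

/-- `H_hom = L²(0, l₂) ⊕ ℂ`. -/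
abbrev HomL2 (l : Edge → ℝ) : Type := WithLp 2 (L2 (l .e2) × ℂ)

/-- `ξ^{(τ)} = -(a₁²/l₁) e^{iτ(l₁+l₃)} - (a₃²/l₃) e^{-iτ l₂}`. -/
def xi (l a : Edge → ℝ) (τ : ℝ) : ℂ :=
  -((a .e1 ^ 2 / l .e1 : ℝ) : ℂ) * Complex.exp (Complex.I * τ * (l .e1 + l .e3))
    - ((a .e3 ^ 2 / l .e3 : ℝ) : ℂ) * Complex.exp (-(Complex.I * τ * l .e2))

open Classical in
/-- The unimodular number `w_τ = -ξ^{(τ)} / |ξ^{(τ)}|`.  For `l₁ + l₂ + l₃ = 1` and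
`τ ∈ [-π, π)`, `ξ^{(τ)}` vanishes only if `a₁²/l₁ = a₃²/l₃` and `τ = -π`; in that case
`w_τ = e^{iτ(l₁+l₃-l₂)/2}` for `-π < τ < π`, and the value at `τ = -π` is given by continuity. -/
def phase (l a : Edge → ℝ) (τ : ℝ) : ℂ :=
  if xi l a τ = 0 then Complex.exp (Complex.I * τ * ((l .e1 + l .e3 - l .e2) / 2))
  else -(xi l a τ) / ‖xi l a τ‖

/-- The germ-type coefficient `(l₁+l₃)⁻¹ (l₁/a₁² + l₃/a₃²)⁻¹`. -/
def germ (l a : Edge → ℝ) : ℝ :=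
  (l .e1 + l .e3)⁻¹ * (l .e1 / a .e1 ^ 2 + l .e3 / a .e3 ^ 2)⁻¹

/-- `(p, q)`, with `p = (u, β)` and `q = (f, γ)`, is in the graph of the homogenised operator. -/
def InHomGraph (l a : Edge → ℝ) (ε τ : ℝ) (p q : HomL2 l) : Prop :=
  ∃ (U U' : ℝ → ℂ) (u'' : L2 (l .e2)),
    IsW22 (l .e2) p.fst U U' u'' ∧
    U 0 = p.snd / (√(l .e1 + l .e3) : ℝ) ∧
    starRingEnd ℂ (phase l a τ) * U (l .e2) = p.snd / (√(l .e1 + l .e3) : ℝ) ∧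
    (∀ᵐ x ∂volume.restrict (Ioo (0 : ℝ) (l .e2)), q.fst x = -twDeriv2 τ U U' u'' x) ∧
    q.snd = -(1 / (√(l .e1 + l .e3) : ℝ)) *
        (twDeriv τ U U' 0 - starRingEnd ℂ (phase l a τ) * twDeriv τ U U' (l .e2))
      + (germ l a * (τ / ε) ^ 2 : ℝ) * p.snd

/-- The graph of the homogenised operator as a subspace of `H_hom × H_hom`. -/
def homGraph (l a : Edge → ℝ) (ε τ : ℝ) : Submodule ℂ (HomL2 l × HomL2 l) where
  carrier := {p | InHomGraph l a ε τ p.1 p.2}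
  zero_mem' := by
    refine ⟨0, 0, 0, IsW22.zero, by simp, by simp, ?_, by simp [twDeriv]⟩
    filter_upwards [Lp.coeFn_zero ℂ 2 (volume.restrict (Ioo (0 : ℝ) (l .e2)))] with x hx
    have p : ((0 : HomL2 l).fst : ℝ → ℂ) x = 0 := hx
    have q : ((0 : L2 (l .e2)) : ℝ → ℂ) x = 0 := hx
    simp only [Prod.snd_zero, p, q, twDeriv2, Pi.zero_apply]
    ring
  add_mem' := by
    rintro ⟨p, q⟩ ⟨r, s⟩ ⟨U, U', u'', h1, h2, h3, h4, h5⟩ ⟨W, W', w'', k1, k2, k3, k4, k5⟩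
    refine ⟨U + W, U' + W', u'' + w'', h1.add k1, ?_, ?_, ?_, ?_⟩
    · simp only [Prod.mk_add_mk, WithLp.add_snd, Pi.add_apply] at *
      rw [h2, k2, add_div]
    · simp only [Prod.mk_add_mk, WithLp.add_snd, Pi.add_apply] at *
      rw [mul_add, h3, k3, add_div]
    · filter_upwards [h4, k4, Lp.coeFn_add q.fst s.fst, Lp.coeFn_add u'' w''] with x a b p q
      simp only [Prod.mk_add_mk, WithLp.add_fst, Pi.add_apply, twDeriv2] at *
      rw [p, q, a, b]
      ring
    · simp only [Prod.mk_add_mk, WithLp.add_snd, Pi.add_apply, twDeriv] at *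
      rw [h5, k5]
      ring
  smul_mem' := by
    rintro c ⟨p, q⟩ ⟨U, U', u'', h1, h2, h3, h4, h5⟩
    refine ⟨c • U, c • U', c • u'', h1.smul c, ?_, ?_, ?_, ?_⟩
    · simp only [Prod.smul_mk, WithLp.smul_snd, Pi.smul_apply, smul_eq_mul] at *
      rw [h2, mul_div_assoc]
    · simp only [Prod.smul_mk, WithLp.smul_snd, Pi.smul_apply, smul_eq_mul] at *
      rw [mul_left_comm, h3, mul_div_assoc]
    · filter_upwards [h4, Lp.coeFn_smul c q.fst, Lp.coeFn_smul c u''] with x a p q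
      simp only [Prod.smul_mk, WithLp.smul_fst, Pi.smul_apply, smul_eq_mul, twDeriv2] at *
      rw [p, q, a]
      ring
    · simp only [Prod.smul_mk, WithLp.smul_snd, Pi.smul_apply, smul_eq_mul, twDeriv] at *
      rw [h5]
      ring

/-- The homogenised operator `𝒜_hom^{(τ)}` (which depends on `ε`), as an unbounded operator. -/
def homOp (l a : Edge → ℝ) (ε τ : ℝ) : HomL2 l →ₗ.[ℂ] HomL2 l :=
  (homGraph l a ε τ).toLinearPMap

/-- `homGraph` is single-valued, so it is the graph of `homOp`. -/
theorem graph_homOp (l a : Edge → ℝ) (hl : 0 < l .e2) (ε τ : ℝ) :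
    (homOp l a ε τ).graph = homGraph l a ε τ := by
  refine Submodule.toLinearPMap_graph_eq _ ?_
  rintro ⟨p, q⟩ ⟨U, U', u'', h1, -, -, h4, h5⟩ (rfl : p = 0)
  have h1' : IsW22 (l .e2) 0 U U' u'' := h1
  obtain ⟨hU, hU'⟩ := h1'.eq_zero hl
  have hfst : q.fst = 0 := by
    refine Lp.ext ?_
    filter_upwards [h4, h1'.ae_eq_zero τ,
      Lp.coeFn_zero ℂ 2 (volume.restrict (Ioo (0 : ℝ) (l .e2)))] with x a b d
    rw [a, b, neg_zero]
    exact d.symm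
  have hsnd : q.snd = 0 := by
    have e1 := hU (left_mem_Icc.2 hl.le)
    have e2 := hU (right_mem_Icc.2 hl.le)
    have e3 := hU' (left_mem_Icc.2 hl.le)
    have e4 := hU' (right_mem_Icc.2 hl.le)
    simp only [Pi.zero_apply] at e1 e2 e3 e4
    simpa [twDeriv, e1, e2, e3, e4] using h5
  exact (WithLp.ofLp_injective 2) (Prod.ext hfst hsnd)

/-! ### Resolvents, partial isometries and the spectral set -/

section

variable {H K : Type*} [NormedAddCommGroup H] [InnerProductSpace ℂ H] [CompleteSpace H]
  [NormedAddCommGroup K] [InnerProductSpace ℂ K] [CompleteSpace K]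

/-- `z` is in the resolvent set of `A`, and the bounded operator `R` is `(A - z)⁻¹`. -/
def IsResolventAt (A : H →ₗ.[ℂ] H) (z : ℂ) (R : H →L[ℂ] H) : Prop :=
  (∀ f : H, ∃ h : R f ∈ A.domain, A ⟨R f, h⟩ - z • R f = f) ∧
    ∀ u : A.domain, R (A u - z • (u : H)) = u

/-- `T` is a partial isometry: `T T* T = T`. -/
def IsPartialIsometry (T : H →L[ℂ] K) : Prop :=
  T ∘L (ContinuousLinearMap.adjoint T) ∘L T = T

end

/-- `K_σ`: the points of `K` at distance at least `σ` from the real line. -/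
def specSet (K : Set ℂ) (σ : ℝ) : Set ℂ := {z | z ∈ K ∧ σ ≤ |z.im|}

end

/-!
The boundary conditions turn both resolvent equations into finite linear systems, and every
estimate is obtained by integrating by parts on single edges.

*Self-adjointness.*  On every edge the equation `-κ (d/dx + iτ)² u - z u = f` is solved with given
initial values; the vertex conditions become a square linear system, which for non-real `z` is
injective because the operators are symmetric by Green's formula.  A symmetric operator `A` with
`A - z` onto for all non-real `z` is self-adjoint and has bounded resolvents
(`LinearPMap.isSelfAdjoint_of_symmetric_of_surjective`, `LinearPMap.exists_isResolventAt`).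

*Solutions on the graph.*  Let `u` solve `A u - z u = f`, with vertex values `d₁`, `d₂`.  On the
stiff edges `(d/dx + iτ)² u = O(ε²)`, so `u` is harmonic there up to `O(ε²)`, that is, affine in
the gauge `e^{iτx}`, and the Kirchhoff conditions say that the matrix
`![![k₁ + k₃, conj ξ], ![ξ, k₁ + k₃]]`, with `k_e = a_e² / l_e`, maps `(d₁, d₂)` to `O(ε²)`.  Its
eigenvectors are `(1, w_τ)`, with eigenvalue `stiffGap = k₁ + k₃ - |ξ|`, and `(1, -w_τ)`, with an
eigenvalue bounded away from `0`.  Hence `d₂ = w_τ d₁ + O(ε²)` and `stiffGap * |d₁| = O(ε²)`, and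
on the stiff edges `u = d₁ h + O(ε²)`, where `h` is the harmonic lift of `(1, w_τ)`
(`IsFibreSolution.exists_bound_gap`, `IsFibreSolution.exists_bound_bulk`).  The partial isometry is
`Ψ u = (u₂, ⟪h / ‖h‖, u⟫)`.

*Small `τ`.*  Since `2 * stiffGap` agrees up to `O(τ⁴)` with the quadratic term
`k₁ k₃ / (k₁ + k₃) * τ²` from which the germ is built, and is of order `τ²` on `[-π, π)`, one has
`τ² d₁ = O(ε²)`, and likewise `‖h‖² = l₁ + l₃ + O(τ²)`.

*The corrector.*  Subtracting from `u₂` the multiple `d₂ - w_τ d₁ = O(ε²)` of a harmonic function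
on the soft edge, and taking `β = √(l₁ + l₃) d₁`, gives an element of the domain of the homogenised
operator (`IsFibreSolution.corrector_mem_homGraph`).  It solves the homogenised equation up to
a residual which is `O(ε²)` in `L²` and `O(τ² + ε²)` in `ℂ`
(`IsFibreSolution.exists_bound_residual`).  The residual in `ℂ` does no harm: the `ℂ`-component of
the resolvent of the homogenised operator is of order `min 1 (ε² / τ²)`, because of the term
`(τ / ε)² β`, and by duality so are the solutions with data in `ℂ`
(`exists_bound_hom_residual`).  This gives the estimate of order `ε²` uniformly in `τ`.
-/

/-! ### Absolutely continuous functions on `[0, l]` -/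

/-- `F` is absolutely continuous on `[0, l]` with almost everywhere derivative `f`. -/
structure IsPrimitive (l : ℝ) (F f : ℝ → ℂ) : Prop where
  integrable : IntervalIntegrable f volume 0 l
  eq : ∀ x ∈ Icc (0 : ℝ) l, F x = F 0 + ∫ t in (0 : ℝ)..x, f t

lemma IntervalIntegrable.absolutelyContinuous_integral_complex {f : ℝ → ℂ} {a b : ℝ}
    (h : IntervalIntegrable f volume a b) :
    AbsolutelyContinuousOnInterval (fun x => ∫ t in a..x, f t) a b := by
  have hc (c : ℂ) : AbsolutelyContinuousOnInterval (fun _ : ℝ => c) a b :=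
    (LipschitzWith.const' c (K := 0)).lipschitzOnWith.absolutelyContinuousOnInterval
  have hre : IntervalIntegrable (fun t => (f t).re) volume a b :=
    ⟨h.1.re, h.2.re⟩
  have him : IntervalIntegrable (fun t => (f t).im) volume a b :=
    ⟨h.1.im, h.2.im⟩
  have key := ((hre.absolutelyContinuousOnInterval_intervalIntegral
    (left_mem_uIcc)).fun_smul (hc 1)).fun_add
    ((him.absolutelyContinuousOnInterval_intervalIntegral (left_mem_uIcc)).fun_smul (hc Complex.I))
  rw [absolutelyContinuousOnInterval_iff] at key ⊢
  have e : ∀ x ∈ uIcc a b, (∫ t in a..x, f t) =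
      (∫ t in a..x, (f t).re) • (1 : ℂ) + (∫ t in a..x, (f t).im) • Complex.I := by
    intro x hx
    have hs : IntervalIntegrable f volume a x := h.mono_set (uIcc_subset_uIcc_left hx)
    have h1 : IntervalIntegrable (fun t => ((f t).re : ℂ)) volume a x :=
      ⟨hs.1.re.ofReal, hs.2.re.ofReal⟩
    have h2 : IntervalIntegrable (fun t => ((f t).im : ℂ) * Complex.I) volume a x :=
      IntervalIntegrable.mul_const ⟨hs.1.im.ofReal, hs.2.im.ofReal⟩ _
    calc (∫ t in a..x, f t) = ∫ t in a..x, (((f t).re : ℂ) + ((f t).im : ℂ) * Complex.I) := by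
          simp [Complex.re_add_im]
      _ = _ := by
          rw [intervalIntegral.integral_add h1 h2, intervalIntegral.integral_mul_const,
            intervalIntegral.integral_ofReal, intervalIntegral.integral_ofReal]
          simp
  intro ε hε
  obtain ⟨δ, hδ, H⟩ := key ε hε
  refine ⟨δ, hδ, fun E hE hlt => ?_⟩
  refine lt_of_eq_of_lt (Finset.sum_congr rfl fun i hi => ?_) (H E hE hlt)
  rw [e _ (hE.1 i hi).1, e _ (hE.1 i hi).2]

namespace IsPrimitive

variable {l : ℝ} {F G f g : ℝ → ℂ}

lemma intervalIntegrable (h : IsPrimitive l F f) {x : ℝ} (hx : x ∈ Icc (0 : ℝ) l) :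
    IntervalIntegrable f volume 0 x :=
  h.integrable.mono_set (uIcc_subset_uIcc_left (by rwa [uIcc_of_le (hx.1.trans hx.2)]))

lemma continuousOn (h : IsPrimitive l F f) : ContinuousOn F (Icc 0 l) :=
  IsW22.continuousOn_of_eq (fun _ hx => h.intervalIntegrable hx) h.eq

lemma eq_end (h : IsPrimitive l F f) (hl : 0 ≤ l) : F l - F 0 = ∫ t in (0 : ℝ)..l, f t := by
  rw [h.eq l ⟨hl, le_rfl⟩]; ring

lemma add (hF : IsPrimitive l F f) (hG : IsPrimitive l G g) :
    IsPrimitive l (fun x => F x + G x) (fun x => f x + g x) where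
  integrable := hF.integrable.add hG.integrable
  eq x hx := by
    rw [intervalIntegral.integral_add (hF.intervalIntegrable hx) (hG.intervalIntegrable hx),
      hF.eq x hx, hG.eq x hx]
    ring

lemma const_mul (c : ℂ) (hF : IsPrimitive l F f) :
    IsPrimitive l (fun x => c * F x) (fun x => c * f x) where
  integrable := hF.integrable.const_mul c
  eq x hx := by
    rw [intervalIntegral.integral_const_mul, hF.eq x hx]
    ring

lemma sub (hF : IsPrimitive l F f) (hG : IsPrimitive l G g) :
    IsPrimitive l (fun x => F x - G x) (fun x => f x - g x) where
  integrable := hF.integrable.sub hG.integrable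
  eq x hx := by
    rw [intervalIntegral.integral_sub (hF.intervalIntegrable hx) (hG.intervalIntegrable hx),
      hF.eq x hx, hG.eq x hx]
    ring

lemma conj (hF : IsPrimitive l F f) :
    IsPrimitive l (fun x => starRingEnd ℂ (F x)) (fun x => starRingEnd ℂ (f x)) where
  integrable := by
    have := hF.integrable
    rw [intervalIntegrable_iff] at this ⊢
    exact Complex.conjLIE.toContinuousLinearEquiv.toContinuousLinearMap.integrable_comp this
  eq x hx := by
    rw [intervalIntegral.intervalIntegral_conj, hF.eq x hx, map_add]

lemma congr {f₁ F₁ : ℝ → ℂ} (hF : IsPrimitive l F f) (hl : 0 ≤ l) (h0 : EqOn F₁ F (Icc 0 l))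
    (h : EqOn f₁ f (Icc 0 l)) : IsPrimitive l F₁ f₁ where
  integrable := hF.integrable.congr (by
    intro x hx
    rw [uIoc_of_le hl] at hx
    exact (h ⟨hx.1.le, hx.2⟩).symm)
  eq x hx := by
    rw [h0 hx, h0 ⟨le_rfl, hl⟩, hF.eq x hx]
    congr 1
    refine intervalIntegral.integral_congr fun t ht => ?_
    rw [uIcc_of_le hx.1] at ht
    exact (h ⟨ht.1, ht.2.trans hx.2⟩).symm

lemma of_hasDerivAt (h : ∀ x, HasDerivAt F (f x) x) (hf : Continuous f) :
    IsPrimitive l F f where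
  integrable := hf.intervalIntegrable _ _
  eq x _ := by
    rw [intervalIntegral.integral_eq_sub_of_hasDerivAt (fun t _ => h t)
      (hf.intervalIntegrable _ _)]
    ring

lemma of_integral (h : IntervalIntegrable f volume 0 l) (c : ℂ) :
    IsPrimitive l (fun x => c + ∫ t in (0 : ℝ)..x, f t) f where
  integrable := h
  eq x _ := by simp

/-- The product rule: the difference of the two sides of `F G = F 0 G 0 + ∫ (f G + F g)` is
absolutely continuous with almost everywhere vanishing derivative. -/
lemma mul (hF : IsPrimitive l F f) (hG : IsPrimitive l G g) (hl : 0 ≤ l) :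
    IsPrimitive l (fun x => F x * G x) (fun x => f x * G x + F x * g x) := by
  have hI : IntervalIntegrable (fun x => f x * G x + F x * g x) volume 0 l := by
    refine (hF.integrable.mul_continuousOn ?_).add (hG.integrable.continuousOn_mul ?_)
    · rw [uIcc_of_le hl]; exact hG.continuousOn
    · rw [uIcc_of_le hl]; exact hF.continuousOn
  refine ⟨hI, ?_⟩
  have hc (c : ℂ) : AbsolutelyContinuousOnInterval (fun _ : ℝ => c) 0 l :=
    (LipschitzWith.const' c (K := 0)).lipschitzOnWith.absolutelyContinuousOnInterval
  set F' : ℝ → ℂ := fun x => F 0 + ∫ t in (0 : ℝ)..x, f t with hF'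
  set G' : ℝ → ℂ := fun x => G 0 + ∫ t in (0 : ℝ)..x, g t with hG'
  have aF : AbsolutelyContinuousOnInterval F' 0 l :=
    (hc _).fun_add hF.integrable.absolutelyContinuous_integral_complex
  have aG : AbsolutelyContinuousOnInterval G' 0 l :=
    (hc _).fun_add hG.integrable.absolutelyContinuous_integral_complex
  have aP : AbsolutelyContinuousOnInterval
      (fun x => F' x • G' x - ∫ t in (0 : ℝ)..x, (f t * G t + F t * g t)) 0 l :=
    (aF.fun_smul aG).fun_sub hI.absolutelyContinuous_integral_complex
  obtain ⟨C, hC⟩ := aP.const_of_ae_hasDerivAt_zero (by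
    filter_upwards [hF.integrable.ae_hasDerivAt_integral, hG.integrable.ae_hasDerivAt_integral,
      hI.ae_hasDerivAt_integral] with x h1 h2 h3 hx
    have k1 := (h1 hx 0 left_mem_uIcc).const_add (F 0)
    have k2 := (h2 hx 0 left_mem_uIcc).const_add (G 0)
    have k3 := h3 hx 0 left_mem_uIcc
    rw [uIcc_of_le hl] at hx
    have : HasDerivAt (fun x => F' x • G' x - ∫ t in (0 : ℝ)..x, (f t * G t + F t * g t))
        (f x * G' x + F' x * g x - (f x * G x + F x * g x)) x := (k1.mul k2).sub k3
    rwa [show F' x = F x from (hF.eq x hx).symm, show G' x = G x from (hG.eq x hx).symm,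
      sub_self] at this)
  rw [uIcc_of_le hl] at hC
  intro x hx
  have e1 := hC x hx
  have e2 := hC 0 ⟨le_rfl, hl⟩
  have f1 : F' x = F x := (hF.eq x hx).symm
  have f2 : G' x = G x := (hG.eq x hx).symm
  have f3 : F' 0 = F 0 := by simp [hF']
  have f4 : G' 0 = G 0 := by simp [hG']
  simp only [f1, f2, f3, f4, smul_eq_mul, intervalIntegral.integral_same, sub_zero] at e1 e2
  linear_combination e1 - e2

end IsPrimitive

lemma isPrimitive_cexp (l : ℝ) (p : ℂ) :
    IsPrimitive l (fun x => Complex.exp (p * x)) (fun x => p * Complex.exp (p * x)) := by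
  refine .of_hasDerivAt (fun x => ?_) (by fun_prop)
  have h : HasDerivAt (fun x : ℝ => p * (x : ℂ)) (p * 1) x :=
    (Complex.ofRealCLM.hasDerivAt (x := x)).const_mul p
  have := h.cexp
  convert this using 1
  ring

/-- First order linear equations `Y' + p Y = G` are solvable with any initial value. -/
lemma exists_isPrimitive_first_order {l : ℝ} (hl : 0 ≤ l) (p c : ℂ) {G : ℝ → ℂ}
    (hG : IntervalIntegrable G volume 0 l) :
    ∃ Y : ℝ → ℂ, Y 0 = c ∧ IsPrimitive l Y (fun x => G x - p * Y x) := by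
  have h1 : IntervalIntegrable (fun t : ℝ => Complex.exp (p * t) * G t) volume 0 l :=
    hG.continuousOn_mul (by fun_prop)
  refine ⟨fun x => Complex.exp (-p * x) * (c + ∫ t in (0 : ℝ)..x, Complex.exp (p * t) * G t),
    by simp, ?_⟩
  refine ((isPrimitive_cexp l (-p)).mul (.of_integral h1 c) hl).congr hl (fun x _ => rfl)
    fun x _ => ?_
  have : Complex.exp (-p * x) * Complex.exp (p * x) = 1 := by
    rw [← Complex.exp_add]; simp
  simp only
  linear_combination -G x * this

/-! ### Boundary values and the Green formula on one edge -/

lemma ContinuousOn.memLp_two_Ioo {l : ℝ} {F : ℝ → ℂ} (h : ContinuousOn F (Icc 0 l)) :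
    MemLp F 2 (volume.restrict (Ioo (0 : ℝ) l)) := by
  obtain ⟨C, hC⟩ := isCompact_Icc.exists_bound_of_continuousOn h
  refine MemLp.of_bound ((h.mono Ioo_subset_Icc_self).aestronglyMeasurable measurableSet_Ioo) C ?_
  filter_upwards [ae_restrict_mem measurableSet_Ioo] with x hx
  exact hC x (Ioo_subset_Icc_self hx)

lemma integral_interval_eq_restrict_Ioo {l : ℝ} (hl : 0 ≤ l) {E : Type*} [NormedAddCommGroup E]
    [NormedSpace ℝ E] (f : ℝ → E) :
    ∫ t in (0 : ℝ)..l, f t = ∫ t, f t ∂volume.restrict (Ioo (0 : ℝ) l) := by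
  rw [intervalIntegral.integral_of_le hl, restrict_Ioo_eq_restrict_Ioc]

lemma L2.integral_norm_le {l : ℝ} (hl : 0 ≤ l) (F : L2 l) :
    ∫ t in (0 : ℝ)..l, ‖F t‖ ≤ √l * ‖F‖ := by
  rw [integral_interval_eq_restrict_Ioo hl]
  have h := eLpNorm_le_eLpNorm_mul_rpow_measure_univ (μ := volume.restrict (Ioo (0 : ℝ) l))
    (p := 1) (q := 2) (by norm_num) (Lp.aestronglyMeasurable F)
  have h1 : Integrable F (volume.restrict (Ioo (0 : ℝ) l)) := (Lp.memLp F).integrable (by norm_num)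
  have h2 := ENNReal.toReal_mono (ENNReal.mul_ne_top (Lp.eLpNorm_ne_top F) (by
    refine ENNReal.rpow_ne_top_of_nonneg (by norm_num) (measure_ne_top _ _))) h
  rw [eLpNorm_one_eq_lintegral_enorm, ← integral_norm_eq_lintegral_enorm h1.1, ENNReal.toReal_mul,
    ← Lp.norm_def] at h2
  refine h2.trans (le_of_eq ?_)
  rw [← ENNReal.toReal_rpow, mul_comm, Real.sqrt_eq_rpow]
  simp [hl]
  norm_num

lemma L2.norm_le_of_ae_bound {l : ℝ} (hl : 0 ≤ l) (F : L2 l) {B : ℝ} (hB : 0 ≤ B)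
    (h : ∀ᵐ x ∂volume.restrict (Ioo (0 : ℝ) l), ‖F x‖ ≤ B) : ‖F‖ ≤ √l * B := by
  have := Lp.norm_le_of_ae_bound (μ := volume.restrict (Ioo (0 : ℝ) l)) (p := 2) hB h
  refine this.trans (le_of_eq ?_)
  rw [Real.sqrt_eq_rpow, show (measureUnivNNReal (volume.restrict (Ioo (0 : ℝ) l)) : ℝ) = l by
    rw [measureUnivNNReal, Measure.restrict_apply_univ, Real.volume_Ioo, sub_zero]
    exact ENNReal.toReal_ofReal hl]
  simp

lemma L2.inner_eq_intervalIntegral {l : ℝ} (hl : 0 ≤ l) (f g : L2 l) :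
    inner ℂ f g = ∫ t in (0 : ℝ)..l, starRingEnd ℂ (f t) * g t := by
  rw [integral_interval_eq_restrict_Ioo hl, L2.inner_def]
  simp [RCLike.inner_apply, mul_comm]

namespace IsW22

variable {l : ℝ} {u v u'' v'' : L2 l} {U U' V V' : ℝ → ℂ}

lemma isPrimitive_fst (h : IsW22 l u U U' u'') (hl : 0 ≤ l) : IsPrimitive l U U' :=
  ⟨h.intervalIntegrable_snd ⟨hl, le_rfl⟩, h.fst⟩

lemma isPrimitive_snd (h : IsW22 l u U U' u'') (hl : 0 ≤ l) : IsPrimitive l U' u'' :=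
  ⟨intervalIntegrable_coe u'' ⟨hl, le_rfl⟩, h.snd⟩

lemma exists_of_isPrimitive {U'' : ℝ → ℂ} (h1 : IsPrimitive l U U') (h2 : IsPrimitive l U' U'')
    (hm : MemLp U'' 2 (volume.restrict (Ioo (0 : ℝ) l))) :
    ∃ u u'' : L2 l, IsW22 l u U U' u'' ∧ u'' =ᵐ[volume.restrict (Ioo (0 : ℝ) l)] U'' := by
  refine ⟨h1.continuousOn.memLp_two_Ioo.toLp, hm.toLp, ⟨MemLp.coeFn_toLp _, h1.eq, fun x hx => ?_⟩,
    MemLp.coeFn_toLp _⟩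
  rw [intervalIntegral.integral_congr_ae (ae_Ioc_of_ae_Ioo (MemLp.coeFn_toLp hm) hx), h2.eq x hx]

lemma isPrimitive_twDeriv (h : IsW22 l u U U' u'') (hl : 0 ≤ l) (τ : ℝ) :
    IsPrimitive l (twDeriv τ U U') (fun x => u'' x + Complex.I * τ * U' x) :=
  (h.isPrimitive_snd hl).add ((h.isPrimitive_fst hl).const_mul _)

/-- After multiplication by `e^{iτx}` the twisted derivative is the ordinary derivative. -/
lemma isPrimitive_gauge_fst (h : IsW22 l u U U' u'') (hl : 0 ≤ l) (τ : ℝ) :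
    IsPrimitive l (fun x => Complex.exp (Complex.I * τ * x) * U x)
      (fun x => Complex.exp (Complex.I * τ * x) * twDeriv τ U U' x) :=
  ((isPrimitive_cexp l (Complex.I * τ)).mul (h.isPrimitive_fst hl) hl).congr hl
    (fun _ _ => rfl) fun x _ => by simp only [twDeriv]; ring

lemma isPrimitive_gauge_snd (h : IsW22 l u U U' u'') (hl : 0 ≤ l) (τ : ℝ) :
    IsPrimitive l (fun x => Complex.exp (Complex.I * τ * x) * twDeriv τ U U' x)
      (fun x => Complex.exp (Complex.I * τ * x) * twDeriv2 τ U U' u'' x) :=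
  ((isPrimitive_cexp l (Complex.I * τ)).mul (h.isPrimitive_twDeriv hl τ) hl).congr hl
    (fun _ _ => rfl) fun x _ => by simp only [twDeriv, twDeriv2]; ring

/-- Green's formula for `-κ (d/dx + iτ)²` on `[0, l]`. -/
lemma green (h : IsW22 l u U U' u'') (k : IsW22 l v V V' v'') (hl : 0 ≤ l) (τ κ : ℝ) {f g : L2 l}
    (hf : ∀ᵐ x ∂volume.restrict (Ioo (0 : ℝ) l), f x = -(κ : ℂ) * twDeriv2 τ U U' u'' x)
    (hg : ∀ᵐ x ∂volume.restrict (Ioo (0 : ℝ) l), g x = -(κ : ℂ) * twDeriv2 τ V V' v'' x) :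
    inner ℂ u g - inner ℂ f v = -(κ : ℂ) *
      ((starRingEnd ℂ (U l) * twDeriv τ V V' l - starRingEnd ℂ (twDeriv τ U U' l) * V l)
      - (starRingEnd ℂ (U 0) * twDeriv τ V V' 0 - starRingEnd ℂ (twDeriv τ U U' 0) * V 0)) := by
  have hP := (((h.isPrimitive_fst hl).conj.mul (k.isPrimitive_twDeriv hl τ) hl).sub
    ((h.isPrimitive_twDeriv hl τ).conj.mul (k.isPrimitive_fst hl) hl)).eq_end hl
  have hi (a b : L2 l) : IntervalIntegrable (fun t => starRingEnd ℂ (a t) * b t) volume 0 l := by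
    rw [intervalIntegrable_iff_integrableOn_Ioc_of_le hl, integrableOn_Ioc_iff_integrableOn_Ioo]
    have := L2.integrable_inner (𝕜 := ℂ) a b
    simpa [RCLike.inner_apply, mul_comm, IntegrableOn] using this
  rw [hP, L2.inner_eq_intervalIntegral hl, L2.inner_eq_intervalIntegral hl,
    ← intervalIntegral.integral_sub (hi _ _) (hi _ _), ← intervalIntegral.integral_const_mul]
  refine intervalIntegral.integral_congr_ae ?_
  refine ae_Ioc_of_ae_Ioo (l := l) ?_ ⟨hl, le_rfl⟩
  filter_upwards [h.rep, k.rep, hf, hg] with x e1 e2 e3 e4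
  rw [e1, e2, e3, e4]
  simp only [twDeriv, twDeriv2, map_add, map_mul, map_pow, map_neg, Complex.conj_I,
    Complex.conj_ofReal, map_ofNat]
  ring

/-- The initial value problem for `(d/dx + iτ)² u = f + κ u` is solvable on `[0, l]`, by
factorisation into first order equations. -/
lemma exists_initial_value (hl : 0 ≤ l) (τ : ℝ) (κ : ℂ) (f : L2 l) (c d : ℂ) :
    ∃ (u : L2 l) (U U' : ℝ → ℂ) (u'' : L2 l), IsW22 l u U U' u'' ∧ U 0 = c ∧
      twDeriv τ U U' 0 = d ∧
      ∀ᵐ x ∂volume.restrict (Ioo (0 : ℝ) l), twDeriv2 τ U U' u'' x = f x + κ * U x := by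
  obtain ⟨k, hk⟩ := IsAlgClosed.exists_pow_nat_eq κ (n := 2) (by norm_num)
  obtain ⟨Y, hY0, hY⟩ := exists_isPrimitive_first_order hl (Complex.I * τ + k) (d - k * c)
    (intervalIntegrable_coe f ⟨hl, le_rfl⟩)
  obtain ⟨U, hU0, hU⟩ := exists_isPrimitive_first_order hl (Complex.I * τ - k) c
    (hY.continuousOn.intervalIntegrable_of_Icc hl)
  have hU' := hY.sub (hU.const_mul (Complex.I * τ - k))
  have hm : MemLp (fun x => f x - (Complex.I * τ + k) * Y x
      - (Complex.I * τ - k) * (Y x - (Complex.I * τ - k) * U x)) 2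
      (volume.restrict (Ioo (0 : ℝ) l)) := by
    have e1 := hY.continuousOn.memLp_two_Ioo
    have e2 := hU.continuousOn.memLp_two_Ioo
    exact ((Lp.memLp f).sub (e1.const_mul _)).sub ((e1.sub (e2.const_mul _)).const_mul _)
  obtain ⟨u, u'', hu, hu''⟩ := exists_of_isPrimitive hU hU' hm
  refine ⟨u, U, _, u'', hu, hU0, ?_, ?_⟩
  · simp only [twDeriv, hY0, hU0]; ring
  · filter_upwards [hu''] with x hx
    simp only [twDeriv2, hx]
    linear_combination U x * hk

end IsW22

/-- `u`, with representative `U` and derivatives `U'`, `u''`, is the solution of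
`(d/dx + iτ)² u = 0` on `[0, l]` with boundary values `p` at `0` and `q` at `l`; in the gauge
`e^{iτx}` it is affine. -/
structure IsHarmonicLift (l τ : ℝ) (p q : ℂ) (u : L2 l) (U U' : ℝ → ℂ) (u'' : L2 l) : Prop where
  isW22 : IsW22 l u U U' u''
  left : U 0 = p
  right : U l = q
  twDeriv2_eq_zero : ∀ᵐ x ∂volume.restrict (Ioo (0 : ℝ) l), twDeriv2 τ U U' u'' x = 0
  gauge_twDeriv : ∀ x ∈ Icc (0 : ℝ) l, Complex.exp (Complex.I * τ * x) * twDeriv τ U U' x =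
    (Complex.exp (Complex.I * τ * l) * q - p) / l
  gauge : ∀ x ∈ Icc (0 : ℝ) l, Complex.exp (Complex.I * τ * x) * U x =
    p + (Complex.exp (Complex.I * τ * l) * q - p) * (x / l)

lemma exists_isHarmonicLift {l : ℝ} (hl : 0 < l) (τ : ℝ) (p q : ℂ) :
    ∃ (u : L2 l) (U U' : ℝ → ℂ) (u'' : L2 l), IsHarmonicLift l τ p q u U U' u'' := by
  have hl' : (l : ℂ) ≠ 0 := by exact_mod_cast hl.ne'
  obtain ⟨u, U, U', u'', h, h0, h1, h2⟩ := IsW22.exists_initial_value hl.le τ 0 0 p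
    ((Complex.exp (Complex.I * τ * l) * q - p) / l)
  have h2' : ∀ᵐ x ∂volume.restrict (Ioo (0 : ℝ) l), twDeriv2 τ U U' u'' x = 0 := by
    filter_upwards [h2, Lp.coeFn_zero ℂ 2 (volume.restrict (Ioo (0 : ℝ) l))] with x a b
    rw [a, b]; simp
  have hd : ∀ x ∈ Icc (0 : ℝ) l, Complex.exp (Complex.I * τ * x) * twDeriv τ U U' x =
        (Complex.exp (Complex.I * τ * l) * q - p) / l := by
    intro x hx
    rw [(h.isPrimitive_gauge_snd hl.le τ).eq x hx]
    rw [intervalIntegral.integral_congr_ae (g := fun _ => 0) (IsW22.ae_Ioc_of_ae_Ioo (l := l) (by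
      filter_upwards [h2'] with t ht
      rw [ht, mul_zero]) hx)]
    simp [h1]
  have hv : ∀ x ∈ Icc (0 : ℝ) l, Complex.exp (Complex.I * τ * x) * U x =
        p + (Complex.exp (Complex.I * τ * l) * q - p) * (x / l) := by
    intro x hx
    rw [(h.isPrimitive_gauge_fst hl.le τ).eq x hx]
    rw [intervalIntegral.integral_congr (g := fun _ =>
      (Complex.exp (Complex.I * τ * l) * q - p) / l) (fun t ht => by
        rw [uIcc_of_le hx.1] at ht
        exact hd t ⟨ht.1, ht.2.trans hx.2⟩)]
    simp [h0]; ring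
  refine ⟨u, U, U', u'', h, h0, ?_, h2', hd, hv⟩
  have := hv l ⟨hl.le, le_rfl⟩
  rw [div_self hl'] at this
  exact mul_left_cancel₀ (Complex.exp_ne_zero (Complex.I * τ * l)) (by linear_combination this)

/-! ### Estimates on one edge -/

lemma norm_exp_I_mul_mul (τ x : ℝ) : ‖Complex.exp (Complex.I * τ * x)‖ = 1 := by
  rw [show Complex.I * (τ : ℂ) * x = ((τ * x : ℝ) : ℂ) * Complex.I by push_cast; ring]
  exact Complex.norm_exp_ofReal_mul_I _

lemma intervalIntegral_affine_mul_affine {l : ℝ} (hl : 0 < l) (c d a b : ℂ) :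
    ∫ x in (0 : ℝ)..l, (c + d * (x / l)) * (a + b * (x / l)) =
      l * (c * a + (c * b + d * a) / 2 + d * b / 3) := by
  have hl' : (l : ℂ) ≠ 0 := by exact_mod_cast hl.ne'
  have hd : ∀ x : ℝ, HasDerivAt
      (fun x : ℝ => c * a * (x : ℂ) + (c * b + d * a) / (2 * l) * (x : ℂ) ^ 2
      + d * b / (3 * l ^ 2) * (x : ℂ) ^ 3) ((c + d * (x / l)) * (a + b * (x / l))) x := by
    intro x
    have h1 : HasDerivAt (fun x : ℝ => (x : ℂ)) 1 x := Complex.ofRealCLM.hasDerivAt (x := x)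
    have := ((h1.const_mul (c * a)).add ((h1.pow 2).const_mul ((c * b + d * a) / (2 * l)))).add
      ((h1.pow 3).const_mul (d * b / (3 * l ^ 2)))
    refine this.congr_deriv ?_
    field_simp
    push_cast
    ring
  rw [intervalIntegral.integral_eq_sub_of_hasDerivAt (fun x _ => hd x)
    (Continuous.intervalIntegrable (by fun_prop) _ _)]
  field_simp
  push_cast
  ring

namespace IsW22

variable {l : ℝ} {u u'' F : L2 l} {U U' : ℝ → ℂ}

lemma norm_gauge_deriv_sub_le (h : IsW22 l u U U' u'') (hl : 0 < l) (τ : ℝ)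
    (hF : ∀ᵐ x ∂volume.restrict (Ioo (0 : ℝ) l), F x = twDeriv2 τ U U' u'' x) {x : ℝ}
    (hx : x ∈ Icc (0 : ℝ) l) :
    ‖Complex.exp (Complex.I * τ * x) * twDeriv τ U U' x - twDeriv τ U U' 0‖ ≤ √l * ‖F‖ := by
  have hP := h.isPrimitive_gauge_snd hl.le τ
  have e1 : Complex.exp (Complex.I * τ * x) * twDeriv τ U U' x - twDeriv τ U U' 0 =
      ∫ t in (0 : ℝ)..x, Complex.exp (Complex.I * τ * t) * F t := by
    rw [hP.eq x hx, intervalIntegral.integral_congr_ae (ae_Ioc_of_ae_Ioo (l := l)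
      (p := fun t => Complex.exp (Complex.I * τ * t) * F t =
        Complex.exp (Complex.I * τ * t) * twDeriv2 τ U U' u'' t)
      (hF.mono fun t ht => by rw [ht]) hx)]
    simp
  rw [e1]
  refine le_trans ?_ (L2.integral_norm_le hl.le F)
  refine (intervalIntegral.norm_integral_le_integral_norm hx.1).trans ?_
  simp only [norm_mul, norm_exp_I_mul_mul, one_mul]
  refine intervalIntegral.integral_mono_interval le_rfl hx.1 hx.2
    (Filter.Eventually.of_forall fun _ => norm_nonneg _)
    (intervalIntegrable_coe F ⟨hl.le, le_rfl⟩).norm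

lemma norm_gauge_sub_le (h : IsW22 l u U U' u'') (hl : 0 < l) (τ : ℝ)
    (hF : ∀ᵐ x ∂volume.restrict (Ioo (0 : ℝ) l), F x = twDeriv2 τ U U' u'' x) {x : ℝ}
    (hx : x ∈ Icc (0 : ℝ) l) :
    ‖Complex.exp (Complex.I * τ * x) * U x - (U 0 + x * twDeriv τ U U' 0)‖ ≤ √l * ‖F‖ * x := by
  have hP := (h.isPrimitive_gauge_fst hl.le τ).sub
    (IsPrimitive.of_hasDerivAt (l := l) (F := fun x => (x : ℂ) * twDeriv τ U U' 0)
      (f := fun _ => twDeriv τ U U' 0) (fun x => by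
        simpa using (Complex.ofRealCLM.hasDerivAt (x := x)).mul_const (twDeriv τ U U' 0))
      continuous_const)
  have := hP.eq x hx
  simp only [Complex.ofReal_zero, mul_zero, Complex.exp_zero, one_mul, zero_mul, sub_zero] at this
  rw [show Complex.exp (Complex.I * τ * x) * U x - (U 0 + x * twDeriv τ U U' 0) =
    ∫ t in (0 : ℝ)..x, (Complex.exp (Complex.I * τ * t) * twDeriv τ U U' t - twDeriv τ U U' 0) by
      linear_combination this]
  refine (intervalIntegral.norm_integral_le_of_norm_le_const (C := √l * ‖F‖) fun t ht =>
    ?_).trans ?_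
  · rw [uIoc_of_le hx.1] at ht
    exact h.norm_gauge_deriv_sub_le hl τ hF ⟨ht.1.le, ht.2.trans hx.2⟩
  · rw [sub_zero, abs_of_nonneg hx.1]

lemma norm_twDeriv_zero_sub_le (h : IsW22 l u U U' u'') (hl : 0 < l) (τ : ℝ)
    (hF : ∀ᵐ x ∂volume.restrict (Ioo (0 : ℝ) l), F x = twDeriv2 τ U U' u'' x) :
    ‖twDeriv τ U U' 0 - (Complex.exp (Complex.I * τ * l) * U l - U 0) / l‖ ≤ √l * ‖F‖ := by
  have hl' : (l : ℂ) ≠ 0 := by exact_mod_cast hl.ne'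
  have := h.norm_gauge_sub_le hl τ hF ⟨hl.le, le_rfl⟩
  rw [show twDeriv τ U U' 0 - (Complex.exp (Complex.I * τ * l) * U l - U 0) / l =
    -(Complex.exp (Complex.I * τ * l) * U l - (U 0 + l * twDeriv τ U U' 0)) / l by
      field_simp; ring, norm_div, norm_neg, Complex.norm_real, Real.norm_of_nonneg hl.le,
      div_le_iff₀ hl]
  exact this

lemma norm_twDeriv_end_sub_le (h : IsW22 l u U U' u'') (hl : 0 < l) (τ : ℝ)
    (hF : ∀ᵐ x ∂volume.restrict (Ioo (0 : ℝ) l), F x = twDeriv2 τ U U' u'' x) :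
    ‖Complex.exp (Complex.I * τ * l) * twDeriv τ U U' l
      - (Complex.exp (Complex.I * τ * l) * U l - U 0) / l‖ ≤ 2 * (√l * ‖F‖) := by
  have h1 := h.norm_gauge_deriv_sub_le hl τ hF ⟨hl.le, le_rfl⟩
  have h2 := h.norm_twDeriv_zero_sub_le hl τ hF
  have := norm_add_le _ _ |>.trans (add_le_add h1 h2)
  rw [sub_add_sub_cancel] at this
  linarith

/-- In the gauge `e^{iτx}` a function is close to the affine interpolation of its boundary values
when its second derivative is small. -/
lemma norm_gauge_sub_affine_le (h : IsW22 l u U U' u'') (hl : 0 < l) (τ : ℝ)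
    (hF : ∀ᵐ x ∂volume.restrict (Ioo (0 : ℝ) l), F x = twDeriv2 τ U U' u'' x) {x : ℝ}
    (hx : x ∈ Icc (0 : ℝ) l) :
    ‖Complex.exp (Complex.I * τ * x) * U x
      - (U 0 + (Complex.exp (Complex.I * τ * l) * U l - U 0) * (x / l))‖ ≤
      2 * l * (√l * ‖F‖) := by
  have h1 := h.norm_gauge_sub_le hl τ hF hx
  have h2 := h.norm_twDeriv_zero_sub_le hl τ hF
  have h0 : 0 ≤ √l * ‖F‖ := by positivity
  have e : Complex.exp (Complex.I * τ * x) * U x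
      - (U 0 + (Complex.exp (Complex.I * τ * l) * U l - U 0) * (x / l)) =
    (Complex.exp (Complex.I * τ * x) * U x - (U 0 + x * twDeriv τ U U' 0))
    + x * (twDeriv τ U U' 0 - (Complex.exp (Complex.I * τ * l) * U l - U 0) / l) := by ring
  rw [e]
  refine (norm_add_le _ _).trans ?_
  rw [norm_mul, Complex.norm_real, Real.norm_of_nonneg hx.1]
  nlinarith [mul_le_mul hx.2 h2 (norm_nonneg _) hl.le, mul_le_mul_of_nonneg_left hx.2 h0]

lemma norm_affine_moment_le (h : IsW22 l u U U' u'') (hl : 0 < l) (τ : ℝ)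
    (hF : ∀ᵐ x ∂volume.restrict (Ioo (0 : ℝ) l), F x = twDeriv2 τ U U' u'' x) (c d : ℝ)
    (hcd : ∀ s ∈ Icc (0 : ℝ) 1, |c + d * s| ≤ 4) :
    ‖c * U 0 + (c * (Complex.exp (Complex.I * τ * l) * U l - U 0) + d * U 0) / 2
      + d * (Complex.exp (Complex.I * τ * l) * U l - U 0) / 3‖ ≤
      4 / √l * ‖u‖ + 8 * l * (√l * ‖F‖) := by
  have hI := intervalIntegral_affine_mul_affine hl c d (U 0)
    (Complex.exp (Complex.I * τ * l) * U l - U 0)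
  have hu := intervalIntegrable_coe u (x := l) ⟨hl.le, le_rfl⟩
  have key : ‖∫ x in (0 : ℝ)..l, ((c : ℂ) + d * (x / l)) *
      (U 0 + (Complex.exp (Complex.I * τ * l) * U l - U 0) * (x / l))‖ ≤
      ∫ x in (0 : ℝ)..l, (4 * ‖u x‖ + 8 * l * (√l * ‖F‖)) := by
    refine intervalIntegral.norm_integral_le_of_norm_le hl.le ?_
      ((hu.norm.const_mul 4).add intervalIntegrable_const)
    have := ae_Ioc_of_ae_Ioo h.rep (x := l) ⟨hl.le, le_rfl⟩
    filter_upwards [this] with x e1 hx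
    rw [e1 (by rwa [uIoc_of_le hl.le])]
    have hx' : x ∈ Icc (0 : ℝ) l := ⟨hx.1.le, hx.2⟩
    have h1 := h.norm_gauge_sub_affine_le hl τ hF hx'
    have h2 : ‖((c : ℂ) + d * (x / l))‖ ≤ 4 := by
      rw [show ((c : ℂ) + d * (x / l)) = ((c + d * (x / l) : ℝ) : ℂ) by push_cast; ring,
        Complex.norm_real]
      exact hcd _ ⟨div_nonneg hx'.1 hl.le, (div_le_one hl).2 hx'.2⟩
    rw [norm_mul]
    have h3 : ‖U 0 + (Complex.exp (Complex.I * τ * l) * U l - U 0) * (x / l)‖ ≤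
        ‖U x‖ + 2 * l * (√l * ‖F‖) := by
      have e := norm_sub_norm_le
        (U 0 + (Complex.exp (Complex.I * τ * l) * U l - U 0) * (x / l))
        (Complex.exp (Complex.I * τ * x) * U x)
      rw [norm_sub_rev] at e
      rw [norm_mul, norm_exp_I_mul_mul, one_mul] at e
      linarith
    nlinarith [mul_le_mul h2 h3 (norm_nonneg _) (by norm_num)]
  rw [hI, intervalIntegral.integral_add (hu.norm.const_mul 4) intervalIntegrable_const,
    intervalIntegral.integral_const_mul, intervalIntegral.integral_const, norm_mul,
    Complex.norm_real, Real.norm_of_nonneg hl.le, sub_zero, smul_eq_mul] at key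
  have h5 := L2.integral_norm_le hl.le u
  have h6 : l * (4 / √l * ‖u‖) = 4 * (√l * ‖u‖) := by
    nth_rw 1 [← Real.mul_self_sqrt hl.le]
    have : √l ≠ 0 := (Real.sqrt_pos.2 hl).ne'
    field_simp
  refine le_of_mul_le_mul_left ?_ hl
  rw [mul_add, h6]
  linarith

/-- Trace estimate: the boundary values are controlled by `u` and `(d/dx + iτ)² u` in `L²`. -/
lemma norm_boundary_le (h : IsW22 l u U U' u'') (hl : 0 < l) (τ : ℝ)
    (hF : ∀ᵐ x ∂volume.restrict (Ioo (0 : ℝ) l), F x = twDeriv2 τ U U' u'' x) :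
    ‖U 0‖ ≤ 4 / √l * ‖u‖ + 8 * l * (√l * ‖F‖) ∧ ‖U l‖ ≤ 4 / √l * ‖u‖ + 8 * l * (√l * ‖F‖) := by
  constructor
  · have := h.norm_affine_moment_le hl τ hF 4 (-6) fun s hs => by
      rw [abs_le]; constructor <;> linarith [hs.1, hs.2]
    refine le_trans (le_of_eq ?_) this
    congr 1
    push_cast
    ring
  · have := h.norm_affine_moment_le hl τ hF (-2) 6 fun s hs => by
      rw [abs_le]; constructor <;> linarith [hs.1, hs.2]
    refine le_trans (le_of_eq ?_) this
    rw [show ‖U l‖ = ‖Complex.exp (Complex.I * τ * l) * U l‖ by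
      rw [norm_mul, norm_exp_I_mul_mul, one_mul]]
    congr 1
    push_cast
    ring

end IsW22

/-! ### Symmetric operators with surjective `A - z` -/

section Abstract

variable {H : Type*} [NormedAddCommGroup H] [InnerProductSpace ℂ H]

lemma abs_im_mul_norm_le_of_inner_eq {u g : H} (h : inner ℂ g u = inner ℂ u g) (z : ℂ) :
    |z.im| * ‖u‖ ≤ ‖g - z • u‖ := by
  have h1 : (inner ℂ u g).im = 0 := by
    have := inner_conj_symm (𝕜 := ℂ) u g
    rw [h] at this
    exact Complex.conj_eq_iff_im.1 this
  have h2 : (inner ℂ u (g - z • u)).im = -(z.im * ‖u‖ ^ 2) := by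
    rw [inner_sub_right, inner_smul_right, inner_self_eq_norm_sq_to_K, Complex.sub_im, h1]
    simp [← Complex.ofReal_pow]
  have h3 : |z.im| * ‖u‖ ^ 2 ≤ ‖u‖ * ‖g - z • u‖ := by
    have := (Complex.abs_im_le_norm (inner ℂ u (g - z • u))).trans (norm_inner_le_norm _ _)
    rwa [h2, abs_neg, abs_mul, abs_of_nonneg (sq_nonneg ‖u‖)] at this
  rcases (norm_nonneg u).eq_or_lt with h0 | h0
  · rw [← h0]; simp
  · refine le_of_mul_le_mul_left ?_ h0
    calc ‖u‖ * (|z.im| * ‖u‖) = |z.im| * ‖u‖ ^ 2 := by ring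
      _ ≤ _ := h3

namespace LinearPMap

variable {A : H →ₗ.[ℂ] H}

lemma eq_of_sub_smul_eq (hsym : ∀ x ∈ A.graph, ∀ y ∈ A.graph, inner ℂ x.2 y.1 = inner ℂ x.1 y.2)
    {z : ℂ} (hz : z.im ≠ 0) {x y : H × H} (hx : x ∈ A.graph) (hy : y ∈ A.graph)
    (h : x.2 - z • x.1 = y.2 - z • y.1) : x.1 = y.1 := by
  have hd := A.graph.sub_mem hx hy
  have := abs_im_mul_norm_le_of_inner_eq (hsym _ hd _ hd) z
  have e : (x - y).2 - z • (x - y).1 = 0 := by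
    simp only [Prod.snd_sub, Prod.fst_sub, smul_sub]
    rw [sub_sub_sub_comm, h, sub_self]
  rw [e, norm_zero] at this
  have h0 : ‖(x - y).1‖ = 0 := by
    have := abs_pos.2 hz
    by_contra hne
    have := mul_pos this ((norm_nonneg (x - y).1).lt_of_ne' hne)
    linarith
  exact sub_eq_zero.1 (norm_eq_zero.1 h0)

/-- The resolvent of a symmetric operator for which `A - z` is onto. -/
theorem exists_isResolventAt
    (hsym : ∀ x ∈ A.graph, ∀ y ∈ A.graph, inner ℂ x.2 y.1 = inner ℂ x.1 y.2)
    {z : ℂ} (hz : z.im ≠ 0) (hsol : ∀ f, ∃ x ∈ A.graph, x.2 - z • x.1 = f) :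
    ∃ R : H →L[ℂ] H, IsResolventAt A z R ∧ ∀ f, (R f, f + z • R f) ∈ A.graph := by
  choose x hx hxf using hsol
  have key (f : H) (y : H × H) (hy : y ∈ A.graph) (h : y.2 - z • y.1 = f) : (x f).1 = y.1 :=
    eq_of_sub_smul_eq hsym hz (hx f) hy ((hxf f).trans h.symm)
  let L : H →ₗ[ℂ] H :=
    { toFun := fun f => (x f).1
      map_add' := fun f g => key _ (x f + x g) (A.graph.add_mem (hx f) (hx g)) (by
        simp only [Prod.snd_add, Prod.fst_add, smul_add]
        rw [add_sub_add_comm, hxf, hxf])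
      map_smul' := fun c f => key _ (c • x f) (A.graph.smul_mem c (hx f)) (by
        simp only [Prod.smul_snd, Prod.smul_fst]
        rw [smul_comm z c, ← smul_sub, hxf]) }
  have hpos : 0 < |z.im| := abs_pos.2 hz
  let R : H →L[ℂ] H := L.mkContinuous |z.im|⁻¹ fun f => by
    have := abs_im_mul_norm_le_of_inner_eq (hsym _ (hx f) _ (hx f)) z
    rw [hxf] at this
    rw [← div_eq_inv_mul, le_div_iff₀ hpos, mul_comm]
    exact this
  have hR (f : H) : (R f, f + z • R f) ∈ A.graph := by
    have e : (R f, f + z • R f) = x f := by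
      refine Prod.ext rfl ?_
      change f + z • (x f).1 = (x f).2
      nth_rw 1 [← hxf f]
      rw [sub_add_cancel]
    rw [e]
    exact hx f
  refine ⟨R, ⟨fun f => ?_, fun u => ?_⟩, hR⟩
  · obtain ⟨y, hy1, hy2⟩ := (A.mem_graph_iff).1 (hR f)
    have hy1' : (y : H) = R f := hy1
    refine ⟨hy1' ▸ y.2, ?_⟩
    have : (⟨R f, hy1' ▸ y.2⟩ : A.domain) = y := Subtype.ext hy1'.symm
    rw [this, hy2]
    simp
  · exact key _ _ (A.mem_graph u) rfl

variable [CompleteSpace H]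

/-- A symmetric operator is self-adjoint when `A - z` is onto for all non-real `z`. -/
theorem isSelfAdjoint_of_symmetric_of_surjective
    (hsym : ∀ x ∈ A.graph, ∀ y ∈ A.graph, inner ℂ x.2 y.1 = inner ℂ x.1 y.2)
    (hsol : ∀ z : ℂ, z.im ≠ 0 → ∀ f, ∃ x ∈ A.graph, x.2 - z • x.1 = f) : IsSelfAdjoint A := by
  have hI : Complex.I.im ≠ 0 := by simp
  have hIc : (-Complex.I).im ≠ 0 := by simp
  have hdense : Dense (A.domain : Set H) := by
    rw [Submodule.dense_iff_topologicalClosure_eq_top, Submodule.topologicalClosure_eq_top_iff,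
      Submodule.eq_bot_iff]
    intro v hv
    obtain ⟨x, hx, hxv⟩ := hsol Complex.I hI v
    have hv0 : inner ℂ x.1 v = 0 :=
      (Submodule.mem_orthogonal _ _).1 hv x.1 (mem_domain_of_mem_graph hx)
    have hreal := hsym x hx x hx
    have h1 : inner ℂ v x.1 = 0 := by
      rw [← inner_conj_symm, hv0]; simp
    rw [← hxv] at hv0 h1
    rw [inner_sub_right, inner_smul_right] at hv0
    rw [inner_sub_left, inner_smul_left, hreal, Complex.conj_I] at h1
    have h2 : inner ℂ x.1 x.1 = 0 := by
      have : 2 * Complex.I * inner ℂ x.1 x.1 = 0 := by linear_combination h1 - hv0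
      simpa using this
    have h3 : x.1 = 0 := inner_self_eq_zero.1 h2
    rw [← hxv, A.graph_fst_eq_zero_snd hx h3, h3]
    simp
  have hle : A ≤ A.adjoint := by
    refine IsFormalAdjoint.le_adjoint hdense fun x y => ?_
    exact hsym _ (A.mem_graph x) _ (A.mem_graph y)
  rw [isSelfAdjoint_def]
  refine (le_antisymm hle ?_).symm
  rw [← le_graph_iff]
  rintro ⟨v, w⟩ hv
  obtain ⟨⟨u, g⟩, hu, hug⟩ := hsol Complex.I hI (w - Complex.I • v)
  have hug' : g - Complex.I • u = w - Complex.I • v := hug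
  have hu' := le_graph_iff.2 hle hu
  have hd := A.adjoint.graph.sub_mem hv hu'
  have e : (w - g) = Complex.I • (v - u) := by
    rw [smul_sub]; rw [sub_eq_sub_iff_sub_eq_sub] at hug'
    rw [← neg_sub g w, hug', neg_sub]
  obtain ⟨⟨x, y⟩, hx, hxy⟩ := hsol (-Complex.I) hIc (v - u)
  have hadj : inner ℂ (w - g) x = inner ℂ (v - u) y := by
    rw [mem_graph_iff] at hd hx
    obtain ⟨d, hd1, hd2⟩ := hd
    obtain ⟨k, hk1, hk2⟩ := hx
    have := adjoint_isFormalAdjoint hdense d k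
    rw [hd1, hd2, hk1, hk2] at this
    exact this
  have h0 : inner ℂ (v - u) (v - u) = 0 := by
    have hxy' : y - (-Complex.I) • x = v - u := hxy
    nth_rw 2 [← hxy']
    rw [inner_sub_right, ← hadj, e, inner_smul_left, inner_smul_right]
    simp
  have hvu : v = u := sub_eq_zero.1 (inner_self_eq_zero.1 h0)
  have hwg : w = g := by
    rw [hvu, sub_self, smul_zero] at e
    exact sub_eq_zero.1 e
  rw [hvu, hwg]
  exact hu

end LinearPMap

end Abstract

/-! ### Fibre operators of weighted graphs -/

namespace WeightedGraph

variable {V E : Type}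

/-- The weights are unimodular, the coefficients and lengths are positive, and no vertex is
isolated. -/
structure IsAdmissible (G : WeightedGraph V E) : Prop where
  len_pos : ∀ e, 0 < G.len e
  coef_pos : ∀ e, 0 < G.coef e
  norm_wSrc : ∀ e, ‖G.wSrc e‖ = 1
  norm_wTgt : ∀ e, ‖G.wTgt e‖ = 1
  exists_edge : ∀ v, ∃ e, G.src e = v ∨ G.tgt e = v

variable [DecidableEq V] [Fintype E]

lemma flux_add (G : WeightedGraph V E) (τ : ℝ) (U U' W W' : E → ℝ → ℂ) :
    G.flux τ (U + W) (U' + W') = G.flux τ U U' + G.flux τ W W' := by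
  ext v
  simp only [flux, Pi.add_apply]
  rw [sub_add_sub_comm, ← Finset.sum_add_distrib, ← Finset.sum_add_distrib]
  congr 1 <;> refine Finset.sum_congr rfl fun e _ => ?_ <;> split_ifs <;>
    simp [twDeriv] <;> ring

lemma flux_smul (G : WeightedGraph V E) (τ : ℝ) (c : ℂ) (U U' : E → ℝ → ℂ) :
    G.flux τ (c • U) (c • U') = c • G.flux τ U U' := by
  ext v
  simp only [flux, Pi.smul_apply, smul_eq_mul]
  rw [mul_sub, Finset.mul_sum, Finset.mul_sum]
  congr 1 <;> refine Finset.sum_congr rfl fun e _ => ?_ <;> split_ifs <;>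
    simp [twDeriv] <;> ring

lemma sum_boundary_eq_sum_flux [Fintype V] {G : WeightedGraph V E} (hG : G.IsAdmissible) (τ : ℝ)
    {U W W' : E → ℝ → ℂ} {c : V → ℂ}
    (hc : ∀ e, G.wSrc e * U e 0 = c (G.src e) ∧ G.wTgt e * U e (G.len e) = c (G.tgt e)) :
    ∑ e, (G.coef e : ℂ) * (starRingEnd ℂ (U e 0) * twDeriv τ (W e) (W' e) 0
      - starRingEnd ℂ (U e (G.len e)) * twDeriv τ (W e) (W' e) (G.len e)) =
      ∑ v, starRingEnd ℂ (c v) * G.flux τ W W' v := by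
  simp only [flux, mul_sub, Finset.mul_sum, mul_ite, mul_zero, Finset.sum_sub_distrib]
  congr 1
  · rw [Finset.sum_comm]
    refine Finset.sum_congr rfl fun e _ => ?_
    rw [Finset.sum_ite_eq]
    have h1 : starRingEnd ℂ (G.wSrc e) * G.wSrc e = 1 := by
      rw [Complex.conj_mul', hG.norm_wSrc e]; simp
    simp only [Finset.mem_univ, if_true, ← (hc e).1, map_mul]
    linear_combination (-G.coef e * starRingEnd ℂ (U e 0) * twDeriv τ (W e) (W' e) 0) * h1
  · rw [Finset.sum_comm]
    refine Finset.sum_congr rfl fun e _ => ?_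
    rw [Finset.sum_ite_eq]
    have h1 : starRingEnd ℂ (G.wTgt e) * G.wTgt e = 1 := by
      rw [Complex.conj_mul', hG.norm_wTgt e]; simp
    simp only [Finset.mem_univ, if_true, ← (hc e).2, map_mul]
    linear_combination (-G.coef e * starRingEnd ℂ (U e (G.len e))
      * twDeriv τ (W e) (W' e) (G.len e)) * h1

theorem inner_opGraph [Fintype V] {G : WeightedGraph V E} (hG : G.IsAdmissible) (τ : ℝ) :
    ∀ x ∈ G.opGraph τ, ∀ y ∈ G.opGraph τ, inner ℂ x.2 y.1 = inner ℂ x.1 y.2 := by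
  rintro ⟨u, f⟩ ⟨U, U', u'', c, h1, h2, h3, h4⟩ ⟨w, g⟩ ⟨W, W', w'', d, k1, k2, k3, k4⟩
  have hs : ∑ e, (inner ℂ (u e) (g e) - inner ℂ (f e) (w e)) =
      (∑ e, (G.coef e : ℂ) * (starRingEnd ℂ (U e 0) * twDeriv τ (W e) (W' e) 0
        - starRingEnd ℂ (U e (G.len e)) * twDeriv τ (W e) (W' e) (G.len e)))
      - starRingEnd ℂ (∑ e, (G.coef e : ℂ) * (starRingEnd ℂ (W e 0) * twDeriv τ (U e) (U' e) 0
        - starRingEnd ℂ (W e (G.len e)) * twDeriv τ (U e) (U' e) (G.len e))) := by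
    rw [map_sum, ← Finset.sum_sub_distrib]
    refine Finset.sum_congr rfl fun e _ => ?_
    rw [(h1 e).green (k1 e) (hG.len_pos e).le τ (G.coef e) (h4 e) (k4 e)]
    simp only [map_mul, map_sub, Complex.conj_conj, Complex.conj_ofReal]
    ring
  rw [sum_boundary_eq_sum_flux hG τ h2, sum_boundary_eq_sum_flux hG τ k2] at hs
  simp only [h3, k3, mul_zero, Finset.sum_const_zero, map_zero, sub_zero,
    Finset.sum_sub_distrib] at hs
  rw [PiLp.inner_apply, PiLp.inner_apply]
  exact (sub_eq_zero.1 hs).symm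

/-- `A - z` is onto for non-real `z`: a particular solution on each edge is corrected by
homogeneous solutions, and the square linear system for the boundary conditions is injective by
symmetry of the operator. -/
theorem exists_mem_opGraph_sub_smul_eq [Fintype V] {G : WeightedGraph V E} (hG : G.IsAdmissible)
    (τ : ℝ) {z : ℂ} (hz : z.im ≠ 0) (f : GraphL2 G.len) :
    ∃ x ∈ G.opGraph τ, x.2 - z • x.1 = f := by
  have hc0 (e : E) : (G.coef e : ℂ) ≠ 0 := by exact_mod_cast (hG.coef_pos e).ne'
  choose u1 U1 U1' u1'' h1 h1a h1b h1c using fun e => IsW22.exists_initial_value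
    (hG.len_pos e).le τ (-(z / G.coef e)) 0 1 0
  choose u2 U2 U2' u2'' h2 h2a h2b h2c using fun e => IsW22.exists_initial_value
    (hG.len_pos e).le τ (-(z / G.coef e)) 0 0 1
  choose u3 U3 U3' u3'' h3 h3a h3b h3c using fun e => IsW22.exists_initial_value
    (hG.len_pos e).le τ (-(z / G.coef e)) (-(1 / G.coef e : ℂ) • f e) 0 0
  let S (x : E → ℂ × ℂ) : E → ℝ → ℂ := fun e => (x e).1 • U1 e + (x e).2 • U2 e
  let S' (x : E → ℂ × ℂ) : E → ℝ → ℂ := fun e => (x e).1 • U1' e + (x e).2 • U2' e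
  let D (U U' : E → ℝ → ℂ) (c : V → ℂ) : (E → ℂ × ℂ) × (V → ℂ) :=
    (fun e => (G.wSrc e * U e 0 - c (G.src e), G.wTgt e * U e (G.len e) - c (G.tgt e)),
      G.flux τ U U')
  let T : ((E → ℂ × ℂ) × (V → ℂ)) →ₗ[ℂ] ((E → ℂ × ℂ) × (V → ℂ)) :=
    { toFun := fun x => D (S x.1) (S' x.1) x.2
      map_add' := fun x y => by
        have e1 : S (x + y).1 = S x.1 + S y.1 := by ext e t; simp [S]; ring
        have e2 : S' (x + y).1 = S' x.1 + S' y.1 := by ext e t; simp [S']; ring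
        simp only [e1, e2, D, flux_add]
        refine Prod.ext (funext fun e => Prod.ext ?_ ?_) rfl <;> simp <;> ring
      map_smul' := fun k x => by
        have e1 : S (k • x).1 = k • S x.1 := by ext e t; simp [S]; ring
        have e2 : S' (k • x).1 = k • S' x.1 := by ext e t; simp [S']; ring
        simp only [e1, e2, D, flux_smul]
        refine Prod.ext (funext fun e => Prod.ext ?_ ?_) rfl <;> simp <;> ring }
  have hW (x : E → ℂ × ℂ) (e : E) : IsW22 (G.len e) ((x e).1 • u1 e + (x e).2 • u2 e)
      (S x e) (S' x e) ((x e).1 • u1'' e + (x e).2 • u2'' e) :=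
    ((h1 e).smul _).add ((h2 e).smul _)
  have hinj : Function.Injective T := by
    rw [injective_iff_map_eq_zero]
    rintro ⟨x, c⟩ hx
    have hx1 (e : E) : G.wSrc e * S x e 0 - c (G.src e) = 0 ∧
        G.wTgt e * S x e (G.len e) - c (G.tgt e) = 0 :=
      Prod.ext_iff.1 (congrFun (congrArg Prod.fst hx) e)
    have hx2 : G.flux τ (S x) (S' x) = 0 := congrArg Prod.snd hx
    let u : GraphL2 G.len := WithLp.toLp 2 fun e => (x e).1 • u1 e + (x e).2 • u2 e
    have hu : (u, z • u) ∈ G.opGraph τ := by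
      refine ⟨S x, S' x, fun e => (x e).1 • u1'' e + (x e).2 • u2'' e, c, hW x,
        fun e => ⟨sub_eq_zero.1 (hx1 e).1, sub_eq_zero.1 (hx1 e).2⟩, congrFun hx2, fun e => ?_⟩
      have hrep : u e =ᵐ[_] S x e := (hW x e).rep
      filter_upwards [h1c e, h2c e, hrep, Lp.coeFn_smul z (u e),
        Lp.coeFn_zero ℂ 2 (volume.restrict (Ioo (0 : ℝ) (G.len e))),
        Lp.coeFn_add ((x e).1 • u1'' e) ((x e).2 • u2'' e), Lp.coeFn_smul (x e).1 (u1'' e),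
        Lp.coeFn_smul (x e).2 (u2'' e)] with t a1 a2 a3 a4 a5 a6 a7 a8
      have a4' : ((z • u : GraphL2 G.len) e : ℝ → ℂ) t = z * u e t := a4
      have e1 : twDeriv2 τ (S x e) (S' x e) ((x e).1 • u1'' e + (x e).2 • u2'' e : L2 (G.len e)) t =
          (x e).1 * twDeriv2 τ (U1 e) (U1' e) (u1'' e) t
          + (x e).2 * twDeriv2 τ (U2 e) (U2' e) (u2'' e) t := by
        simp only [twDeriv2, S, S', a6, Pi.add_apply, a7, a8, Pi.smul_apply, smul_eq_mul]
        ring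
      rw [a4', a3, e1, a1, a2, a5]
      simp only [S, Pi.add_apply, Pi.smul_apply, smul_eq_mul, Pi.zero_apply]
      field_simp [hc0 e]
      ring
    have hu0 : u = 0 := by
      have := abs_im_mul_norm_le_of_inner_eq (inner_opGraph hG τ _ hu _ hu) z
      simp only [sub_self, norm_zero] at this
      by_contra hne
      have := mul_pos (abs_pos.2 hz) (norm_pos_iff.2 hne)
      linarith
    have hS (e : E) : EqOn (S x e) 0 (Icc 0 (G.len e)) ∧ EqOn (S' x e) 0 (Icc 0 (G.len e)) := by
      have h0 : (x e).1 • u1 e + (x e).2 • u2 e = 0 := congrArg (fun w : GraphL2 G.len => w e) hu0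
      have := hW x e
      rw [h0] at this
      exact this.eq_zero (hG.len_pos e)
    have m0 (e : E) : (0 : ℝ) ∈ Icc (0 : ℝ) (G.len e) := left_mem_Icc.2 (hG.len_pos e).le
    have ml (e : E) : G.len e ∈ Icc (0 : ℝ) (G.len e) := right_mem_Icc.2 (hG.len_pos e).le
    refine Prod.ext (funext fun e => ?_) (funext fun v => ?_)
    · have a1 := (hS e).1 (m0 e)
      have a2 := (hS e).2 (m0 e)
      have b1 := h1b e
      have b2 := h2b e
      simp only [S, S', Pi.add_apply, Pi.smul_apply, smul_eq_mul, Pi.zero_apply, h1a, h2a,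
        mul_one, mul_zero, add_zero, twDeriv] at a1 a2 b1 b2
      have : (x e).2 = 0 := by
        linear_combination a2 - (x e).1 * b1 - (x e).2 * b2 + Complex.I * τ * a1
      exact Prod.ext a1 this
    · obtain ⟨e, rfl | rfl⟩ := hG.exists_edge v
      · have := (hx1 e).1
        rw [(hS e).1 (m0 e)] at this
        simpa using this
      · have := (hx1 e).2
        rw [(hS e).1 (ml e)] at this
        simpa using this
  obtain ⟨⟨x, c⟩, hx⟩ := LinearMap.injective_iff_surjective.1 hinj (-(D U3 U3' 0))
  have hx1 (e : E) : G.wSrc e * S x e 0 - c (G.src e) = -(G.wSrc e * U3 e 0 - 0) ∧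
      G.wTgt e * S x e (G.len e) - c (G.tgt e) = -(G.wTgt e * U3 e (G.len e) - 0) :=
    Prod.ext_iff.1 (congrFun (congrArg Prod.fst hx) e)
  have hx2 : G.flux τ (S x) (S' x) = -G.flux τ U3 U3' := congrArg Prod.snd hx
  let u : GraphL2 G.len := WithLp.toLp 2 fun e => (x e).1 • u1 e + (x e).2 • u2 e + u3 e
  refine ⟨(u, f + z • u), ⟨S x + U3, S' x + U3',
    fun e => (x e).1 • u1'' e + (x e).2 • u2'' e + u3'' e, c, fun e => (hW x e).add (h3 e),
    fun e => ⟨?_, ?_⟩, fun v => ?_, fun e => ?_⟩, by simp⟩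
  · simp only [Pi.add_apply]
    linear_combination (hx1 e).1
  · simp only [Pi.add_apply]
    linear_combination (hx1 e).2
  · rw [flux_add, hx2]; simp
  · have hrep : u e =ᵐ[_] S x e + U3 e := ((hW x e).add (h3 e)).rep
    filter_upwards [h1c e, h2c e, h3c e, hrep, Lp.coeFn_add (f e) ((z • u) e),
      Lp.coeFn_smul z (u e), Lp.coeFn_smul (-(1 / G.coef e : ℂ)) (f e),
      Lp.coeFn_zero ℂ 2 (volume.restrict (Ioo (0 : ℝ) (G.len e))),
      Lp.coeFn_add ((x e).1 • u1'' e) ((x e).2 • u2'' e), Lp.coeFn_smul (x e).1 (u1'' e),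
      Lp.coeFn_smul (x e).2 (u2'' e), Lp.coeFn_add ((x e).1 • u1'' e + (x e).2 • u2'' e) (u3'' e)]
      with t a1 a2 a0 a3 a4 a4b a4c a5 a6 a7 a8 a9
    have a4' : ((f + z • u : GraphL2 G.len) e : ℝ → ℂ) t = f e t + z * u e t := by
      have e1 : ((z • u : GraphL2 G.len) e : ℝ → ℂ) t = z * u e t := a4b
      rw [← e1]
      exact a4
    have e1 : twDeriv2 τ ((S x + U3) e) ((S' x + U3') e)
        ((x e).1 • u1'' e + (x e).2 • u2'' e + u3'' e : L2 (G.len e)) t =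
        (x e).1 * twDeriv2 τ (U1 e) (U1' e) (u1'' e) t
        + (x e).2 * twDeriv2 τ (U2 e) (U2' e) (u2'' e) t
        + twDeriv2 τ (U3 e) (U3' e) (u3'' e) t := by
      simp only [twDeriv2, S, S', a9, a6, Pi.add_apply, a7, a8, Pi.smul_apply, smul_eq_mul]
      ring
    rw [a4', a3, e1, a1, a2, a0, a4c, a5]
    simp only [S, Pi.add_apply, Pi.smul_apply, smul_eq_mul, Pi.zero_apply]
    field_simp [hc0 e]
    ring

end WeightedGraph

/-! ### The homogenised operator -/

lemma norm_phase (l a : Edge → ℝ) (τ : ℝ) : ‖phase l a τ‖ = 1 := by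
  unfold phase
  split_ifs with h
  · have := norm_exp_I_mul_mul τ ((l .e1 + l .e3 - l .e2) / 2)
    push_cast at this
    exact this
  · rw [norm_div, norm_neg, Complex.norm_real, norm_norm, div_self (norm_ne_zero_iff.2 h)]

lemma conj_phase_mul_phase (l a : Edge → ℝ) (τ : ℝ) :
    starRingEnd ℂ (phase l a τ) * phase l a τ = 1 := by
  rw [Complex.conj_mul', norm_phase]; simp

lemma norm_xi_mul_phase (l a : Edge → ℝ) (τ : ℝ) : ‖xi l a τ‖ * phase l a τ = -xi l a τ := by
  unfold phase
  split_ifs with h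
  · simp [h]
  · rw [mul_div_cancel₀]
    exact_mod_cast norm_ne_zero_iff.2 h

theorem inner_homGraph {l : Edge → ℝ} (a : Edge → ℝ) (hl : ∀ e, 0 < l e) (ε τ : ℝ) :
    ∀ x ∈ homGraph l a ε τ, ∀ y ∈ homGraph l a ε τ, inner ℂ x.2 y.1 = inner ℂ x.1 y.2 := by
  rintro ⟨p, q⟩ ⟨U, U', u'', h1, h2, h3, h4, h5⟩ ⟨r, s⟩ ⟨W, W', w'', k1, k2, k3, k4, k5⟩
  have hs : ((√(l .e1 + l .e3) : ℝ) : ℂ) ≠ 0 := by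
    exact_mod_cast (Real.sqrt_pos.2 (add_pos (hl .e1) (hl .e3))).ne'
  have hg := h1.green k1 (hl .e2).le τ 1 (f := q.fst) (g := s.fst)
    (by simpa using h4) (by simpa using k4)
  have hw := conj_phase_mul_phase l a τ
  simp only at h2 h3 h5 k2 k3 k5
  set w := phase l a τ
  set S : ℂ := ((√(l .e1 + l .e3) : ℝ) : ℂ)
  have hSc : starRingEnd ℂ S = S := Complex.conj_ofReal _
  have eU : U (l .e2) = w * (p.snd / S) := by
    rw [← h3]; linear_combination (-U (l .e2)) * hw
  have eW : W (l .e2) = w * (r.snd / S) := by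
    rw [← k3]; linear_combination (-W (l .e2)) * hw
  rw [h2, k2, eU, eW] at hg
  simp only [map_mul, map_div₀, hSc, Complex.ofReal_one] at hg
  rw [WithLp.prod_inner_apply, WithLp.prod_inner_apply]
  simp only [RCLike.inner_apply]
  change inner ℂ q.fst r.fst + r.snd * starRingEnd ℂ q.snd =
    inner ℂ p.fst s.fst + s.snd * starRingEnd ℂ p.snd
  rw [h5, k5]
  simp only [map_add, map_mul, map_neg, map_div₀, map_sub, map_one, hSc, Complex.conj_ofReal,
    Complex.conj_conj]
  linear_combination -hg

/-- `𝒜 - z` is onto for non-real `z`, by the same count of boundary conditions as for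
the fibre operators of graphs. -/
theorem exists_mem_homGraph_sub_smul_eq {l : Edge → ℝ} (a : Edge → ℝ) (hl : ∀ e, 0 < l e)
    (ε τ : ℝ) {z : ℂ} (hz : z.im ≠ 0) (f : HomL2 l) :
    ∃ x ∈ homGraph l a ε τ, x.2 - z • x.1 = f := by
  obtain ⟨u1, U1, U1', u1'', h1, h1a, h1b, h1c⟩ := IsW22.exists_initial_value
    (hl .e2).le τ (-z) 0 1 0
  obtain ⟨u2, U2, U2', u2'', h2, h2a, h2b, h2c⟩ := IsW22.exists_initial_value
    (hl .e2).le τ (-z) 0 0 1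
  obtain ⟨u3, U3, U3', u3'', h3, h3a, h3b, h3c⟩ := IsW22.exists_initial_value
    (hl .e2).le τ (-z) (-f.fst) 0 0
  set w := starRingEnd ℂ (phase l a τ) with hw
  set s : ℂ := ((√(l .e1 + l .e3) : ℝ) : ℂ) with hs
  have hs0 : s ≠ 0 := by
    rw [hs]
    exact_mod_cast (Real.sqrt_pos.2 (add_pos (hl .e1) (hl .e3))).ne'
  set g : ℂ := ((germ l a * (τ / ε) ^ 2 : ℝ) : ℂ) with hg
  let D (U U' : ℝ → ℂ) (β : ℂ) : ℂ × ℂ × ℂ :=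
    (U 0 - β / s, w * U (l .e2) - β / s,
      -(1 / s) * (twDeriv τ U U' 0 - w * twDeriv τ U U' (l .e2)) + g * β - z * β)
  let T : (ℂ × ℂ × ℂ) →ₗ[ℂ] (ℂ × ℂ × ℂ) :=
    { toFun := fun x => D (x.1 • U1 + x.2.1 • U2) (x.1 • U1' + x.2.1 • U2') x.2.2
      map_add' := fun x y => by
        simp only [D, twDeriv, Pi.add_apply, Pi.smul_apply, smul_eq_mul, Prod.fst_add, Prod.snd_add]
        refine Prod.ext ?_ (Prod.ext ?_ ?_) <;> simp <;> ring
      map_smul' := fun k x => by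
        simp only [D, twDeriv, Pi.add_apply, Pi.smul_apply, smul_eq_mul, Prod.smul_fst,
          Prod.smul_snd, RingHom.id_apply]
        refine Prod.ext ?_ (Prod.ext ?_ ?_) <;> simp <;> ring }
  have hW (x : ℂ × ℂ × ℂ) : IsW22 (l .e2) (x.1 • u1 + x.2.1 • u2) (x.1 • U1 + x.2.1 • U2)
      (x.1 • U1' + x.2.1 • U2') (x.1 • u1'' + x.2.1 • u2'') := (h1.smul _).add (h2.smul _)
  have hae (x : ℂ × ℂ × ℂ) : ∀ᵐ t ∂volume.restrict (Ioo (0 : ℝ) (l .e2)),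
      twDeriv2 τ (x.1 • U1 + x.2.1 • U2) (x.1 • U1' + x.2.1 • U2')
        (x.1 • u1'' + x.2.1 • u2'' : L2 (l .e2)) t = -z * (x.1 • U1 + x.2.1 • U2) t := by
    filter_upwards [h1c, h2c, Lp.coeFn_zero ℂ 2 (volume.restrict (Ioo (0 : ℝ) (l .e2))),
        Lp.coeFn_add (x.1 • u1'') (x.2.1 • u2''), Lp.coeFn_smul x.1 u1'',
        Lp.coeFn_smul x.2.1 u2''] with t a1 a2 a5 a6 a7 a8
    have e1 : twDeriv2 τ (x.1 • U1 + x.2.1 • U2) (x.1 • U1' + x.2.1 • U2')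
        (x.1 • u1'' + x.2.1 • u2'' : L2 (l .e2)) t =
        x.1 * twDeriv2 τ U1 U1' u1'' t + x.2.1 * twDeriv2 τ U2 U2' u2'' t := by
      simp only [twDeriv2, a6, Pi.add_apply, a7, a8, Pi.smul_apply, smul_eq_mul]
      ring
    rw [e1, a1, a2, a5]
    simp only [Pi.add_apply, Pi.smul_apply, smul_eq_mul, Pi.zero_apply]
    ring
  have hinj : Function.Injective T := by
    rw [injective_iff_map_eq_zero]
    intro x hx
    have hx1 : (x.1 • U1 + x.2.1 • U2) 0 - x.2.2 / s = 0 := congrArg Prod.fst hx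
    have hx2 : w * (x.1 • U1 + x.2.1 • U2) (l .e2) - x.2.2 / s = 0 :=
      congrArg (fun y => y.2.1) hx
    have hx3 : -(1 / s) * (twDeriv τ (x.1 • U1 + x.2.1 • U2) (x.1 • U1' + x.2.1 • U2') 0
        - w * twDeriv τ (x.1 • U1 + x.2.1 • U2) (x.1 • U1' + x.2.1 • U2') (l .e2))
        + g * x.2.2 - z * x.2.2 = 0 := congrArg (fun y => y.2.2) hx
    let p : HomL2 l := WithLp.toLp 2 (x.1 • u1 + x.2.1 • u2, x.2.2)
    have hp : (p, z • p) ∈ homGraph l a ε τ := by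
      refine ⟨_, _, _, hW x, sub_eq_zero.1 hx1, sub_eq_zero.1 hx2, ?_, ?_⟩
      · have hrep : p.fst =ᵐ[_] (x.1 • U1 + x.2.1 • U2) := (hW x).rep
        filter_upwards [hae x, hrep, Lp.coeFn_smul z p.fst] with t a1 a2 a3
        have a3' : ((z • p).fst : ℝ → ℂ) t = z * p.fst t := a3
        rw [a3', a1, a2]
        ring
      · change z * x.2.2 = _ + g * x.2.2
        linear_combination -hx3
    have hp0 : p = 0 := by
      have := abs_im_mul_norm_le_of_inner_eq (inner_homGraph a hl ε τ _ hp _ hp) z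
      simp only [sub_self, norm_zero] at this
      by_contra hne
      have := mul_pos (abs_pos.2 hz) (norm_pos_iff.2 hne)
      linarith
    have hS := hW x
    rw [show x.1 • u1 + x.2.1 • u2 = 0 from congrArg (fun p : HomL2 l => p.fst) hp0] at hS
    have hβ : x.2.2 = 0 := congrArg (fun p : HomL2 l => p.snd) hp0
    obtain ⟨e1, e2⟩ := hS.eq_zero (hl .e2)
    have a1 := e1 (left_mem_Icc.2 (hl .e2).le)
    have a2 := e2 (left_mem_Icc.2 (hl .e2).le)
    simp only [Pi.add_apply, Pi.smul_apply, smul_eq_mul, Pi.zero_apply, h1a, h2a,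
      mul_one, mul_zero, add_zero] at a1 a2
    simp only [twDeriv, h1a, h2a, mul_one, mul_zero, add_zero] at h1b h2b
    have : x.2.1 = 0 := by
      linear_combination a2 - x.1 * h1b - x.2.1 * h2b + Complex.I * τ * a1
    exact Prod.ext a1 (Prod.ext this hβ)
  obtain ⟨x, hx⟩ := LinearMap.injective_iff_surjective.1 hinj
    (-(D U3 U3' 0) + ((0, 0, f.snd) : ℂ × ℂ × ℂ))
  have hx1 : (x.1 • U1 + x.2.1 • U2) 0 - x.2.2 / s = -(U3 0 - 0 / s) + 0 := congrArg Prod.fst hx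
  have hx2 : w * (x.1 • U1 + x.2.1 • U2) (l .e2) - x.2.2 / s = -(w * U3 (l .e2) - 0 / s) + 0 :=
    congrArg (fun y => y.2.1) hx
  have hx3 : -(1 / s) * (twDeriv τ (x.1 • U1 + x.2.1 • U2) (x.1 • U1' + x.2.1 • U2') 0
      - w * twDeriv τ (x.1 • U1 + x.2.1 • U2) (x.1 • U1' + x.2.1 • U2') (l .e2))
      + g * x.2.2 - z * x.2.2 =
      -(-(1 / s) * (twDeriv τ U3 U3' 0 - w * twDeriv τ U3 U3' (l .e2)) + g * 0 - z * 0) + f.snd :=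
    congrArg (fun y => y.2.2) hx
  let p : HomL2 l := WithLp.toLp 2 (x.1 • u1 + x.2.1 • u2 + u3, x.2.2)
  refine ⟨(p, f + z • p), ⟨_, _, _, (hW x).add h3, ?_, ?_, ?_, ?_⟩, by simp⟩
  · change (x.1 • U1 + x.2.1 • U2) 0 + U3 0 = x.2.2 / s
    linear_combination hx1
  · change w * ((x.1 • U1 + x.2.1 • U2) (l .e2) + U3 (l .e2)) = x.2.2 / s
    linear_combination hx2
  · have hrep : p.fst =ᵐ[_] (x.1 • U1 + x.2.1 • U2) + U3 := ((hW x).add h3).rep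
    filter_upwards [hae x, h3c, hrep, Lp.coeFn_smul z p.fst, Lp.coeFn_add f.fst (z • p.fst),
      Lp.coeFn_neg f.fst, Lp.coeFn_add (x.1 • u1'' + x.2.1 • u2'') u3''] with t a1 a0 a2 a3 a4 a5 a6
    have a4' : ((f + z • p).fst : ℝ → ℂ) t = f.fst t + z * p.fst t := by
      refine a4.trans ?_
      rw [Pi.add_apply, a3]
      rfl
    have e1 : twDeriv2 τ (x.1 • U1 + x.2.1 • U2 + U3) (x.1 • U1' + x.2.1 • U2' + U3')
        (x.1 • u1'' + x.2.1 • u2'' + u3'' : L2 (l .e2)) t =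
        twDeriv2 τ (x.1 • U1 + x.2.1 • U2) (x.1 • U1' + x.2.1 • U2')
          (x.1 • u1'' + x.2.1 • u2'' : L2 (l .e2)) t + twDeriv2 τ U3 U3' u3'' t := by
      simp only [twDeriv2, a6, Pi.add_apply]
      ring
    rw [e1, a1, a0, a5, a4', a2]
    simp only [Pi.add_apply, Pi.neg_apply]
    ring
  · have e2 (t : ℝ) : twDeriv τ (x.1 • U1 + x.2.1 • U2 + U3) (x.1 • U1' + x.2.1 • U2' + U3') t =
        twDeriv τ (x.1 • U1 + x.2.1 • U2) (x.1 • U1' + x.2.1 • U2') t + twDeriv τ U3 U3' t := by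
      simp only [twDeriv, Pi.add_apply]
      ring
    change f.snd + z * x.2.2 = -(1 / s) * (twDeriv τ (x.1 • U1 + x.2.1 • U2 + U3)
      (x.1 • U1' + x.2.1 • U2' + U3') 0 - w * twDeriv τ (x.1 • U1 + x.2.1 • U2 + U3)
      (x.1 • U1' + x.2.1 • U2' + U3') (l .e2)) + g * x.2.2
    rw [e2, e2]
    linear_combination -hx3

/-! ### The lowest eigenvalue of the stiff boundary form -/

/-- The stiffness `a_e² / l_e` of an edge. -/
noncomputable def stiffness (l a : Edge → ℝ) (e : Edge) : ℝ := a e ^ 2 / l e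

/-- The lower eigenvalue of the matrix `![![k₁ + k₃, conj ξ], ![ξ, k₁ + k₃]]`, `k_e = a_e² / l_e`,
of the energy of the stiff edges as a quadratic form in the two vertex values.  The eigenvector is
`(1, w_τ)`. -/
noncomputable def stiffGap (l a : Edge → ℝ) (τ : ℝ) : ℝ :=
  stiffness l a .e1 + stiffness l a .e3 - ‖xi l a τ‖

section

variable {l a : Edge → ℝ}

lemma stiffness_pos (hl : ∀ e, 0 < l e) (ha : ∀ e, 0 < a e) (e : Edge) : 0 < stiffness l a e :=
  div_pos (pow_pos (ha e) 2) (hl e)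

lemma norm_xi_sq (hl1 : l .e1 + l .e2 + l .e3 = 1) (τ : ℝ) :
    ‖xi l a τ‖ ^ 2 = stiffness l a .e1 ^ 2 + stiffness l a .e3 ^ 2
      + 2 * stiffness l a .e1 * stiffness l a .e3 * Real.cos τ := by
  have h1 : xi l a τ = -(Complex.exp (Complex.I * τ * (-l .e2 : ℝ)) *
      (stiffness l a .e1 * Complex.exp (τ * Complex.I) + stiffness l a .e3)) := by
    have : Complex.exp (Complex.I * τ * (l .e1 + l .e3)) =
        Complex.exp (Complex.I * τ * (-l .e2 : ℝ)) * Complex.exp (τ * Complex.I) := by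
      rw [← Complex.exp_add]
      congr 1
      have : (l .e1 + l .e2 + l .e3 : ℂ) = 1 := by exact_mod_cast hl1
      push_cast
      linear_combination (Complex.I * τ) * this
    rw [xi, this, stiffness, stiffness,
      show -(Complex.I * (τ : ℂ) * (l .e2 : ℂ)) = Complex.I * τ * (-l .e2 : ℝ) by push_cast; ring]
    ring
  rw [h1, norm_neg, norm_mul, norm_exp_I_mul_mul, one_mul, ← Complex.normSq_eq_norm_sq,
    Complex.normSq_apply]
  simp only [Complex.add_re, Complex.add_im, Complex.mul_re, Complex.mul_im, Complex.ofReal_re,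
    Complex.ofReal_im, Complex.exp_ofReal_mul_I_re, Complex.exp_ofReal_mul_I_im]
  linear_combination (stiffness l a .e1 ^ 2) * Real.sin_sq_add_cos_sq τ

lemma stiffGap_mul (hl1 : l .e1 + l .e2 + l .e3 = 1) (τ : ℝ) :
    (stiffness l a .e1 + stiffness l a .e3 + ‖xi l a τ‖) * stiffGap l a τ =
      2 * stiffness l a .e1 * stiffness l a .e3 * (1 - Real.cos τ) := by
  have := norm_xi_sq (a := a) hl1 τ
  rw [stiffGap]
  linear_combination -this

lemma stiffGap_nonneg (hl : ∀ e, 0 < l e) (hl1 : l .e1 + l .e2 + l .e3 = 1)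
    (ha : ∀ e, 0 < a e) (τ : ℝ) : 0 ≤ stiffGap l a τ := by
  have h1 := stiffness_pos hl ha .e1
  have h3 := stiffness_pos hl ha .e3
  have h := stiffGap_mul (a := a) hl1 τ
  have : 0 ≤ 2 * stiffness l a .e1 * stiffness l a .e3 * (1 - Real.cos τ) :=
    mul_nonneg (by positivity) (by linarith [Real.cos_le_one τ])
  rw [← h] at this
  exact nonneg_of_mul_nonneg_right this (by positivity)

lemma stiffGap_le (hl : ∀ e, 0 < l e) (hl1 : l .e1 + l .e2 + l .e3 = 1)
    (ha : ∀ e, 0 < a e) (τ : ℝ) : stiffGap l a τ ≤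
    stiffness l a .e1 * stiffness l a .e3 / (stiffness l a .e1 + stiffness l a .e3) * τ ^ 2 := by
  have h1 := stiffness_pos hl ha .e1
  have h3 := stiffness_pos hl ha .e3
  have h := stiffGap_mul (a := a) hl1 τ
  have h0 := stiffGap_nonneg hl hl1 ha τ
  have hc := Real.one_sub_sq_div_two_le_cos (x := τ)
  rw [div_mul_eq_mul_div, le_div_iff₀ (by positivity)]
  have := mul_nonneg (norm_nonneg (xi l a τ)) h0
  have : 2 * (stiffness l a .e1 * stiffness l a .e3) * (1 - Real.cos τ) ≤
      2 * (stiffness l a .e1 * stiffness l a .e3) * (τ ^ 2 / 2) :=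
    mul_le_mul_of_nonneg_left (by linarith) (by positivity)
  nlinarith

lemma le_stiffGap (hl : ∀ e, 0 < l e) (hl1 : l .e1 + l .e2 + l .e3 = 1)
    (ha : ∀ e, 0 < a e) {τ : ℝ} (hτ : |τ| ≤ Real.pi) :
    stiffness l a .e1 * stiffness l a .e3 / (stiffness l a .e1 + stiffness l a .e3)
      * (2 / Real.pi ^ 2) * τ ^ 2 ≤ stiffGap l a τ := by
  have h1 := stiffness_pos hl ha .e1
  have h3 := stiffness_pos hl ha .e3
  have h := stiffGap_mul (a := a) hl1 τ
  have h0 := stiffGap_nonneg hl hl1 ha τ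
  have hc := Real.cos_le_one_sub_mul_cos_sq hτ
  have hξ : ‖xi l a τ‖ ≤ stiffness l a .e1 + stiffness l a .e3 := by
    rw [stiffGap] at h0; linarith
  have h5 : 2 * (stiffness l a .e1 * stiffness l a .e3) * (2 / Real.pi ^ 2 * τ ^ 2) ≤
      2 * (stiffness l a .e1 * stiffness l a .e3) * (1 - Real.cos τ) :=
    mul_le_mul_of_nonneg_left (by linarith) (by positivity)
  have h6 := mul_le_mul_of_nonneg_right hξ h0
  rw [div_mul_eq_mul_div, div_mul_eq_mul_div, div_le_iff₀ (by positivity)]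
  nlinarith

lemma abs_sub_two_mul_stiffGap_le (hl : ∀ e, 0 < l e) (hl1 : l .e1 + l .e2 + l .e3 = 1)
    (ha : ∀ e, 0 < a e) (τ : ℝ) :
    |stiffness l a .e1 * stiffness l a .e3 / (stiffness l a .e1 + stiffness l a .e3) * τ ^ 2
      - 2 * stiffGap l a τ| ≤
    (2 * (stiffness l a .e1 * stiffness l a .e3 / (stiffness l a .e1 + stiffness l a .e3))
      + (stiffness l a .e1 * stiffness l a .e3 / (stiffness l a .e1 + stiffness l a .e3)) ^ 2
        / (stiffness l a .e1 + stiffness l a .e3)) * τ ^ 4 := by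
  have h1 := stiffness_pos hl ha .e1
  have h3 := stiffness_pos hl ha .e3
  have h := stiffGap_mul (a := a) hl1 τ
  have h0 := stiffGap_nonneg hl hl1 ha τ
  have hle := stiffGap_le hl hl1 ha τ
  have hξ : ‖xi l a τ‖ = stiffness l a .e1 + stiffness l a .e3 - stiffGap l a τ := by
    rw [stiffGap]; ring
  rw [hξ] at h
  set k := stiffness l a .e1 * stiffness l a .e3 / (stiffness l a .e1 + stiffness l a .e3) with hk
  set S := stiffness l a .e1 + stiffness l a .e3
  set μ := stiffGap l a τ
  have hS : 0 < S := by positivity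
  have hk0 : 0 < k := by positivity
  have hkS : stiffness l a .e1 * stiffness l a .e3 = k * S := by rw [hk]; field_simp
  have e : k * τ ^ 2 - 2 * μ = 2 * k * (Real.cos τ - (1 - τ ^ 2 / 2)) - μ ^ 2 / S := by
    have : 2 * μ * S = 2 * (k * S) * (1 - Real.cos τ) + μ ^ 2 := by rw [← hkS]; linarith
    field_simp
    linarith
  have hcos : |Real.cos τ - (1 - τ ^ 2 / 2)| ≤ τ ^ 4 := by
    rcases le_total |τ| 1 with h1 | h1
    · have := Real.cos_bound h1
      have h4 : |τ| ^ 4 = τ ^ 4 := by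
        rw [show |τ| ^ 4 = (|τ| ^ 2) ^ 2 by ring, sq_abs]; ring
      rw [h4] at this
      nlinarith [sq_nonneg (τ ^ 2)]
    · have a1 := Real.one_sub_sq_div_two_le_cos (x := τ)
      have a2 := Real.cos_le_one τ
      have a3 : 1 ≤ τ ^ 2 := by rw [← sq_abs]; nlinarith
      rw [abs_of_nonneg (by linarith)]
      nlinarith
  have hμ : μ ^ 2 / S ≤ k ^ 2 / S * τ ^ 4 := by
    rw [div_mul_eq_mul_div]
    gcongr
    calc μ ^ 2 ≤ (k * τ ^ 2) ^ 2 := by gcongr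
      _ = k ^ 2 * τ ^ 4 := by ring
  rw [e]
  refine (abs_sub _ _).trans ?_
  rw [abs_mul, abs_of_pos (by positivity : 0 < 2 * k),
    abs_of_nonneg (by positivity : 0 ≤ μ ^ 2 / S)]
  nlinarith [mul_le_mul_of_nonneg_left hcos (by positivity : 0 ≤ 2 * k)]

lemma add_mul_germ (hl : ∀ e, 0 < l e) (ha : ∀ e, 0 < a e) :
    (l .e1 + l .e3) * germ l a =
    stiffness l a .e1 * stiffness l a .e3 / (stiffness l a .e1 + stiffness l a .e3) := by
  have h1 := hl .e1
  have h3 := hl .e3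
  have h4 := ha .e1
  have h5 := ha .e3
  rw [germ, stiffness, stiffness]
  field_simp
  ring

end

/-! ### The lift of the eigenvector to the stiff edges -/

/-- The phase `e^{iτ l_e}` collected along the edge `e`. -/
noncomputable def edgePhase (l : Edge → ℝ) (τ : ℝ) (e : Edge) : ℂ :=
  Complex.exp (Complex.I * τ * l e)

section

variable (l a : Edge → ℝ) (τ : ℝ)

lemma norm_edgePhase (e : Edge) : ‖edgePhase l τ e‖ = 1 := norm_exp_I_mul_mul _ _

lemma conj_edgePhase_mul (e : Edge) :
    starRingEnd ℂ (edgePhase l τ e) * edgePhase l τ e = 1 := by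
  rw [Complex.conj_mul', norm_edgePhase]; simp

lemma xi_eq : xi l a τ = -(stiffness l a .e1 : ℂ) * (edgePhase l τ .e1 * edgePhase l τ .e3)
    - (stiffness l a .e3 : ℂ) * starRingEnd ℂ (edgePhase l τ .e2) := by
  rw [xi, edgePhase, edgePhase, edgePhase, ← Complex.exp_add, ← Complex.exp_conj]
  simp only [map_mul, Complex.conj_I, Complex.conj_ofReal, stiffness, mul_add, neg_mul]

lemma exp_eq_edgePhase_mul :
    Complex.exp (Complex.I * τ * (l .e2 + l .e3)) = edgePhase l τ .e2 * edgePhase l τ .e3 := by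
  rw [edgePhase, edgePhase, ← Complex.exp_add, mul_add]

/-- The relation `|ξ| w = -ξ` in terms of the phases of the edges. -/
lemma norm_xi_mul_phase_eq : ‖xi l a τ‖ * phase l a τ =
    stiffness l a .e1 * (edgePhase l τ .e1 * edgePhase l τ .e3)
    + stiffness l a .e3 * starRingEnd ℂ (edgePhase l τ .e2) := by
  rw [norm_xi_mul_phase, xi_eq]; ring

lemma norm_xi_mul_conj_phase_eq : ‖xi l a τ‖ * starRingEnd ℂ (phase l a τ) =
    stiffness l a .e1 * (starRingEnd ℂ (edgePhase l τ .e1) * starRingEnd ℂ (edgePhase l τ .e3))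
    + stiffness l a .e3 * edgePhase l τ .e2 := by
  have := congrArg (starRingEnd ℂ) (norm_xi_mul_phase_eq l a τ)
  simpa using this

end

lemma sum_edge {M : Type*} [AddCommMonoid M] (f : Edge → M) :
    ∑ e, f e = f .e1 + f .e2 + f .e3 := by
  rw [show (Finset.univ : Finset Edge) = {.e1, .e2, .e3} from rfl]
  rw [Finset.sum_insert (by decide), Finset.sum_insert (by decide), Finset.sum_singleton, add_assoc]

/-- `h` vanishes on the soft edge and is on the stiff edges the solution of `(d/dx + iτ)² h = 0`
satisfying the weighted continuity conditions with vertex values `1` at `V1` and `w_τ` at `V2`. -/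
structure IsStiffLift (l a : Edge → ℝ) (τ : ℝ) (h : GraphL2 l) : Prop where
  soft : h .e2 = 0
  edge1 : ∃ (H H' : ℝ → ℂ) (h'' : L2 (l .e1)), IsHarmonicLift (l .e1) τ
    (starRingEnd ℂ (edgePhase l τ .e3) * phase l a τ) 1 (h .e1) H H' h''
  edge3 : ∃ (H H' : ℝ → ℂ) (h'' : L2 (l .e3)), IsHarmonicLift (l .e3) τ
    (phase l a τ) (starRingEnd ℂ (edgePhase l τ .e2 * edgePhase l τ .e3)) (h .e3) H H' h''

lemma exists_isStiffLift {l : Edge → ℝ} (hl : ∀ e, 0 < l e) (a : Edge → ℝ) (τ : ℝ) :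
    ∃ h : GraphL2 l, IsStiffLift l a τ h := by
  obtain ⟨u1, h1⟩ := exists_isHarmonicLift (hl .e1) τ
    (starRingEnd ℂ (edgePhase l τ .e3) * phase l a τ) 1
  obtain ⟨u3, h3⟩ := exists_isHarmonicLift (hl .e3) τ
    (phase l a τ) (starRingEnd ℂ (edgePhase l τ .e2 * edgePhase l τ .e3))
  exact ⟨WithLp.toLp 2 fun e => match e with
    | .e1 => u1
    | .e2 => 0
    | .e3 => u3, rfl, h1, h3⟩

lemma IsHarmonicLift.norm_sq {l τ : ℝ} (hl : 0 < l) {p q : ℂ} {u u'' : L2 l} {U U' : ℝ → ℂ}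
    (h : IsHarmonicLift l τ p q u U U' u'') (hp : ‖p‖ = 1) (hq : ‖q‖ = 1) :
    ‖u‖ ^ 2 = l * (1 - ‖Complex.exp (Complex.I * τ * l) * q - p‖ ^ 2 / 6) := by
  set b := Complex.exp (Complex.I * τ * l) * q - p with hb
  have e1 : inner ℂ u u = ∫ x in (0 : ℝ)..l, (starRingEnd ℂ p + starRingEnd ℂ b * (x / l)) *
      (p + b * (x / l)) := by
    rw [L2.inner_eq_intervalIntegral hl.le]
    refine intervalIntegral.integral_congr_ae ?_
    have := IsW22.ae_Ioc_of_ae_Ioo h.isW22.rep (x := l) ⟨hl.le, le_rfl⟩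
    filter_upwards [this] with x hx hx'
    rw [hx hx']
    rw [uIoc_of_le hl.le] at hx'
    have hg := h.gauge x ⟨hx'.1.le, hx'.2⟩
    have hg' := congrArg (starRingEnd ℂ) hg
    simp only [map_add, map_mul, map_div₀, Complex.conj_ofReal] at hg'
    rw [← hg, ← hg']
    have hn : starRingEnd ℂ (Complex.exp (Complex.I * τ * x)) * Complex.exp (Complex.I * τ * x)
        = 1 := by
      rw [Complex.conj_mul', norm_exp_I_mul_mul]; simp
    linear_combination (-(starRingEnd ℂ (U x) * U x)) * hn
  rw [intervalIntegral_affine_mul_affine hl] at e1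
  have hp' : starRingEnd ℂ p * p = 1 := by rw [Complex.conj_mul', hp]; simp
  have hq' : starRingEnd ℂ (p + b) * (p + b) = 1 := by
    rw [Complex.conj_mul', hb, add_sub_cancel, norm_mul, norm_exp_I_mul_mul, hq]; simp
  have hb' : starRingEnd ℂ b * b = (‖b‖ : ℂ) ^ 2 := Complex.conj_mul' b
  rw [map_add] at hq'
  rw [inner_self_eq_norm_sq_to_K] at e1
  have : ((‖u‖ ^ 2 : ℝ) : ℂ) = ((l * (1 - ‖b‖ ^ 2 / 6) : ℝ) : ℂ) := by
    push_cast
    refine Eq.trans e1 ?_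
    linear_combination (l : ℂ) * (hp' / 2 + hq' / 2 - hb' / 6)
  exact_mod_cast this

section

variable {l a : Edge → ℝ} {τ : ℝ}

lemma GraphL2.norm_sq_eq (h : GraphL2 l) :
    ‖h‖ ^ 2 = ‖h .e1‖ ^ 2 + ‖h .e2‖ ^ 2 + ‖h .e3‖ ^ 2 := by
  rw [PiLp.norm_sq_eq_of_L2, sum_edge]

/-- The energy of the eigenvector `(1, w_τ)`, whose squared norm is `2`, is `2 * stiffGap`. -/
lemma stiffness_mul_norm_sq (l a : Edge → ℝ) (τ : ℝ) :
    stiffness l a .e1 *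
      ‖edgePhase l τ .e1 - starRingEnd ℂ (edgePhase l τ .e3) * phase l a τ‖ ^ 2
    + stiffness l a .e3 * ‖starRingEnd ℂ (edgePhase l τ .e2) - phase l a τ‖ ^ 2 =
    2 * stiffGap l a τ := by
  have e1 := conj_edgePhase_mul l τ .e1
  have e2 := conj_edgePhase_mul l τ .e2
  have e3 := conj_edgePhase_mul l τ .e3
  have ew := conj_phase_mul_phase l a τ
  have x1 := norm_xi_mul_phase_eq l a τ
  have x2 := norm_xi_mul_conj_phase_eq l a τ
  have h1 := Complex.conj_mul' (edgePhase l τ .e1 - starRingEnd ℂ (edgePhase l τ .e3) * phase l a τ)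
  have h2 := Complex.conj_mul' (starRingEnd ℂ (edgePhase l τ .e2) - phase l a τ)
  simp only [map_sub, map_mul, Complex.conj_conj] at h1 h2
  rw [stiffGap]
  have : ((stiffness l a .e1 *
      ‖edgePhase l τ .e1 - starRingEnd ℂ (edgePhase l τ .e3) * phase l a τ‖ ^ 2
    + stiffness l a .e3 * ‖starRingEnd ℂ (edgePhase l τ .e2) - phase l a τ‖ ^ 2 : ℝ) : ℂ) =
    ((2 * (stiffness l a .e1 + stiffness l a .e3 - ‖xi l a τ‖) : ℝ) : ℂ) := by
    push_cast
    rw [← h1, ← h2]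
    linear_combination (stiffness l a .e1 : ℂ) * (e1 + ew
      + starRingEnd ℂ (phase l a τ) * phase l a τ * e3) + (stiffness l a .e3 : ℂ) * (e2 + ew)
      + starRingEnd ℂ (phase l a τ) * x1 + phase l a τ * x2 - 2 * ‖xi l a τ‖ * ew
  exact_mod_cast this

namespace IsStiffLift

variable {h : GraphL2 l}

lemma norm_sq_eq (hl : ∀ e, 0 < l e) (hh : IsStiffLift l a τ h) : ‖h‖ ^ 2 = l .e1 + l .e3 -
    (l .e1 * ‖edgePhase l τ .e1 - starRingEnd ℂ (edgePhase l τ .e3) * phase l a τ‖ ^ 2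
    + l .e3 * ‖starRingEnd ℂ (edgePhase l τ .e2) - phase l a τ‖ ^ 2) / 6 := by
  obtain ⟨H1, H1', h1'', h1⟩ := hh.edge1
  obtain ⟨H3, H3', h3'', h3⟩ := hh.edge3
  rw [GraphL2.norm_sq_eq, hh.soft, h1.norm_sq (hl .e1) (by simp [norm_edgePhase, norm_phase])
    (by simp), h3.norm_sq (hl .e3) (norm_phase _ _ _) (by simp [norm_edgePhase])]
  have e3 := conj_edgePhase_mul l τ .e3
  have : Complex.exp (Complex.I * τ * l .e3) *
      starRingEnd ℂ (edgePhase l τ .e2 * edgePhase l τ .e3) =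
      starRingEnd ℂ (edgePhase l τ .e2) := by
    rw [map_mul]
    change edgePhase l τ .e3 * _ = _
    linear_combination (starRingEnd ℂ (edgePhase l τ .e2)) * e3
  rw [this, mul_one]
  change l .e1 * (1 - ‖edgePhase l τ .e1 - _‖ ^ 2 / 6) + _ + _ = _
  simp only [norm_zero]
  ring

lemma norm_pos (hl : ∀ e, 0 < l e) (hh : IsStiffLift l a τ h) : 0 < ‖h‖ := by
  have h1 : ‖edgePhase l τ .e1 - starRingEnd ℂ (edgePhase l τ .e3) * phase l a τ‖ ≤ 2 := by
    refine (norm_sub_le _ _).trans (le_of_eq ?_)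
    simp [norm_edgePhase, norm_phase]; norm_num
  have h2 : ‖starRingEnd ℂ (edgePhase l τ .e2) - phase l a τ‖ ≤ 2 := by
    refine (norm_sub_le _ _).trans (le_of_eq ?_)
    simp [norm_edgePhase, norm_phase]; norm_num
  have h1' := mul_le_mul_of_nonneg_left (pow_le_pow_left₀ (norm_nonneg _) h1 2) (hl .e1).le
  have h2' := mul_le_mul_of_nonneg_left (pow_le_pow_left₀ (norm_nonneg _) h2 2) (hl .e3).le
  have := hh.norm_sq_eq hl
  have l1 := hl .e1
  have l3 := hl .e3
  have h3 : 0 < ‖h‖ ^ 2 := by rw [this]; nlinarith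
  refine lt_of_le_of_ne (norm_nonneg _) fun h0 => ?_
  rw [← h0] at h3
  simp at h3

/-- The lift is normalised up to an error of order `τ²`. -/
lemma abs_norm_sq_sub_le (hl : ∀ e, 0 < l e) (hl1 : l .e1 + l .e2 + l .e3 = 1)
    (ha : ∀ e, 0 < a e) (hh : IsStiffLift l a τ h) :
    |‖h‖ ^ 2 - (l .e1 + l .e3)| ≤ (l .e1 / stiffness l a .e1 + l .e3 / stiffness l a .e3) *
      (stiffness l a .e1 * stiffness l a .e3 / (stiffness l a .e1 + stiffness l a .e3)) * τ ^ 2 := by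
  have hA := stiffness_pos hl ha .e1
  have hB := stiffness_pos hl ha .e3
  have l1 := hl .e1
  have l3 := hl .e3
  have hs := stiffness_mul_norm_sq l a τ
  have hg := stiffGap_le hl hl1 ha τ
  rw [hh.norm_sq_eq hl]
  set D1 := ‖edgePhase l τ .e1 - starRingEnd ℂ (edgePhase l τ .e3) * phase l a τ‖ ^ 2
  set D3 := ‖starRingEnd ℂ (edgePhase l τ .e2) - phase l a τ‖ ^ 2
  have d1 : 0 ≤ D1 := sq_nonneg _
  have d3 : 0 ≤ D3 := sq_nonneg _
  set A := stiffness l a .e1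
  set B := stiffness l a .e3
  have a1 : D1 ≤ 2 * stiffGap l a τ / A := by
    rw [le_div_iff₀ hA]; nlinarith [mul_nonneg hB.le d3]
  have a3 : D3 ≤ 2 * stiffGap l a τ / B := by
    rw [le_div_iff₀ hB]; nlinarith [mul_nonneg hA.le d1]
  rw [abs_le]
  have b1 := mul_le_mul_of_nonneg_left a1 l1.le
  have b3 := mul_le_mul_of_nonneg_left a3 l3.le
  have c1 : l .e1 * (2 * stiffGap l a τ / A) + l .e3 * (2 * stiffGap l a τ / B) =
      2 * ((l .e1 / A + l .e3 / B) * stiffGap l a τ) := by ring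
  have c2 : (l .e1 / A + l .e3 / B) * stiffGap l a τ ≤ (l .e1 / A + l .e3 / B) *
      (A * B / (A + B)) * τ ^ 2 := by
    rw [mul_assoc]; gcongr
  have c3 : 0 ≤ (l .e1 / A + l .e3 / B) * (A * B / (A + B)) * τ ^ 2 := by positivity
  constructor
  · nlinarith
  · nlinarith [mul_nonneg l1.le d1, mul_nonneg l3.le d3]

end IsStiffLift

end

/-! ### Solutions on the graph: estimates uniform in `ε` and `τ` -/

namespace IsW22

variable {l : ℝ} {u u'' g : L2 l} {U U' : ℝ → ℂ}

lemma ae_eq_of_coef {κ : ℝ} (hκ : 0 < κ) {τ : ℝ}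
    (hg : ∀ᵐ x ∂volume.restrict (Ioo (0 : ℝ) l), g x = -(κ : ℂ) * twDeriv2 τ U U' u'' x) :
    (∀ᵐ x ∂volume.restrict (Ioo (0 : ℝ) l), ((-(κ : ℂ)⁻¹ • g : L2 l) : ℝ → ℂ) x =
      twDeriv2 τ U U' u'' x) ∧ ‖(-(κ : ℂ)⁻¹ • g : L2 l)‖ = ‖g‖ / κ := by
  have hκ' : (κ : ℂ) ≠ 0 := by exact_mod_cast hκ.ne'
  constructor
  · filter_upwards [hg, Lp.coeFn_smul (-(κ : ℂ)⁻¹) g] with x h1 h2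
    rw [h2, Pi.smul_apply, h1, smul_eq_mul]
    field_simp
  · rw [norm_smul, norm_neg, norm_inv, Complex.norm_real, Real.norm_of_nonneg hκ.le]
    ring

lemma norm_coef_twDeriv_zero_sub_le (h : IsW22 l u U U' u'') (hl : 0 < l) {κ : ℝ} (hκ : 0 < κ)
    (τ : ℝ)
    (hg : ∀ᵐ x ∂volume.restrict (Ioo (0 : ℝ) l), g x = -(κ : ℂ) * twDeriv2 τ U U' u'' x) :
    ‖κ * twDeriv τ U U' 0 - κ / l * (Complex.exp (Complex.I * τ * l) * U l - U 0)‖ ≤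
      √l * ‖g‖ := by
  obtain ⟨h1, h2⟩ := ae_eq_of_coef hκ hg
  have := mul_le_mul_of_nonneg_left (h.norm_twDeriv_zero_sub_le hl τ h1) hκ.le
  rw [h2, show κ * (√l * (‖g‖ / κ)) = √l * ‖g‖ by field_simp] at this
  have e (y : ℂ) : κ * ‖y‖ = ‖(κ : ℂ) * y‖ := by
    rw [norm_mul, Complex.norm_real, Real.norm_of_nonneg hκ.le]
  rw [e] at this
  refine le_trans (le_of_eq ?_) this
  congr 1
  ring

lemma norm_coef_twDeriv_end_sub_le (h : IsW22 l u U U' u'') (hl : 0 < l) {κ : ℝ} (hκ : 0 < κ)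
    (τ : ℝ)
    (hg : ∀ᵐ x ∂volume.restrict (Ioo (0 : ℝ) l), g x = -(κ : ℂ) * twDeriv2 τ U U' u'' x) :
    ‖κ * (Complex.exp (Complex.I * τ * l) * twDeriv τ U U' l)
      - κ / l * (Complex.exp (Complex.I * τ * l) * U l - U 0)‖ ≤ 2 * (√l * ‖g‖) := by
  obtain ⟨h1, h2⟩ := ae_eq_of_coef hκ hg
  have := mul_le_mul_of_nonneg_left (h.norm_twDeriv_end_sub_le hl τ h1) hκ.le
  rw [h2, show κ * (2 * (√l * (‖g‖ / κ))) = 2 * (√l * ‖g‖) by field_simp] at this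
  have e (y : ℂ) : κ * ‖y‖ = ‖(κ : ℂ) * y‖ := by
    rw [norm_mul, Complex.norm_real, Real.norm_of_nonneg hκ.le]
  rw [e] at this
  refine le_trans (le_of_eq ?_) this
  congr 1
  ring

/-- Distance to a multiple of a harmonic lift, in terms of the mismatch of boundary values. -/
lemma norm_sub_smul_le (h : IsW22 l u U U' u'') (hl : 0 < l) {κ : ℝ} (hκ : 0 < κ) (τ : ℝ)
    (hg : ∀ᵐ x ∂volume.restrict (Ioo (0 : ℝ) l), g x = -(κ : ℂ) * twDeriv2 τ U U' u'' x)
    {p q d : ℂ} {v v'' : L2 l} {W W' : ℝ → ℂ} (hv : IsHarmonicLift l τ p q v W W' v'') :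
    ‖u - d • v‖ ≤ √l * (2 * l * (√l * (‖g‖ / κ)) + (‖U 0 - d * p‖ + ‖U l - d * q‖)) := by
  obtain ⟨h1, h2⟩ := ae_eq_of_coef hκ hg
  refine L2.norm_le_of_ae_bound hl.le _ (by positivity) ?_
  filter_upwards [h.rep, hv.isW22.rep, Lp.coeFn_sub u (d • v), Lp.coeFn_smul d v,
    ae_restrict_mem measurableSet_Ioo] with x e1 e2 e3 e4 hx
  have hx' := Ioo_subset_Icc_self hx
  rw [e3, Pi.sub_apply, e4, Pi.smul_apply, e1, e2, smul_eq_mul]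
  have b1 := h.norm_gauge_sub_affine_le hl τ h1 hx'
  have b2 := hv.gauge x hx'
  rw [h2] at b1
  set E := Complex.exp (Complex.I * τ * l)
  have hE : ‖E‖ = 1 := norm_exp_I_mul_mul _ _
  set t : ℝ := x / l with ht
  have ht0 : 0 ≤ t := div_nonneg hx'.1 hl.le
  have ht1 : t ≤ 1 := (div_le_one hl).2 hx'.2
  have htc : (x / l : ℂ) = (t : ℂ) := by rw [ht]; push_cast; rfl
  rw [htc] at b1 b2
  have e5 : Complex.exp (Complex.I * τ * x) * (U x - d * W x) =
      (Complex.exp (Complex.I * τ * x) * U x - (U 0 + (E * U l - U 0) * t))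
      + (((1 - t : ℝ) : ℂ) * (U 0 - d * p) + (t : ℂ) * (E * (U l - d * q))) := by
    push_cast
    linear_combination (-d) * b2
  have e6 : ‖U x - d * W x‖ = ‖Complex.exp (Complex.I * τ * x) * (U x - d * W x)‖ := by
    rw [norm_mul, norm_exp_I_mul_mul, one_mul]
  rw [e6, e5]
  refine (norm_add_le _ _).trans (add_le_add b1 ((norm_add_le _ _).trans (add_le_add ?_ ?_)))
  · rw [norm_mul, Complex.norm_real, Real.norm_of_nonneg (by linarith)]
    exact mul_le_of_le_one_left (norm_nonneg _) (by linarith)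
  · rw [norm_mul, norm_mul, hE, one_mul, Complex.norm_real, Real.norm_of_nonneg ht0]
    exact mul_le_of_le_one_left (norm_nonneg _) ht1

end IsW22

/-- `u` is in the domain of the fibre operator with image `g`; `U`, `U'`, `u''` are the
representatives of `u` and its derivatives, and `d₁`, `d₂` are the vertex values at `V1`, `V2`. -/
structure IsFibreSolution (l a : Edge → ℝ) (ε τ : ℝ) (u g : GraphL2 l) (U U' : Edge → ℝ → ℂ)
    (u'' : ∀ e, L2 (l e)) (d₁ d₂ : ℂ) : Prop where
  isW22 : ∀ e, IsW22 (l e) (u e) (U e) (U' e) (u'' e)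
  eq1 : ∀ᵐ x ∂volume.restrict (Ioo (0 : ℝ) (l .e1)), g .e1 x =
    -((a .e1 ^ 2 / ε ^ 2 : ℝ) : ℂ) * twDeriv2 τ (U .e1) (U' .e1) (u'' .e1) x
  eq2 : ∀ᵐ x ∂volume.restrict (Ioo (0 : ℝ) (l .e2)), g .e2 x =
    -((1 : ℝ) : ℂ) * twDeriv2 τ (U .e2) (U' .e2) (u'' .e2) x
  eq3 : ∀ᵐ x ∂volume.restrict (Ioo (0 : ℝ) (l .e3)), g .e3 x =
    -((a .e3 ^ 2 / ε ^ 2 : ℝ) : ℂ) * twDeriv2 τ (U .e3) (U' .e3) (u'' .e3) x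
  left1 : U .e1 0 = starRingEnd ℂ (edgePhase l τ .e3) * d₂
  right1 : U .e1 (l .e1) = d₁
  left2 : U .e2 0 = d₁
  right2 : U .e2 (l .e2) = d₂
  left3 : U .e3 0 = d₂
  right3 : U .e3 (l .e3) = starRingEnd ℂ (edgePhase l τ .e2 * edgePhase l τ .e3) * d₁
  kirchhoff1 : twDeriv τ (U .e2) (U' .e2) 0 =
    (a .e1 ^ 2 / ε ^ 2 : ℝ) * twDeriv τ (U .e1) (U' .e1) (l .e1)
    + edgePhase l τ .e2 * edgePhase l τ .e3 *
      ((a .e3 ^ 2 / ε ^ 2 : ℝ) * twDeriv τ (U .e3) (U' .e3) (l .e3))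
  kirchhoff2 : twDeriv τ (U .e2) (U' .e2) (l .e2) =
    edgePhase l τ .e3 * ((a .e1 ^ 2 / ε ^ 2 : ℝ) * twDeriv τ (U .e1) (U' .e1) 0)
    + (a .e3 ^ 2 / ε ^ 2 : ℝ) * twDeriv τ (U .e3) (U' .e3) 0

lemma exists_isFibreSolution {l a : Edge → ℝ} (ha2 : a .e2 = 1) {ε : ℝ} (hε : 0 < ε) {τ : ℝ}
    {u g : GraphL2 l} (h : (u, g) ∈ (exGraph l a ε τ).opGraph τ) :
    ∃ U U' u'' d₁ d₂, IsFibreSolution l a ε τ u g U U' u'' d₁ d₂ := by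
  obtain ⟨U, U', u'', c, h1, h2, h3, h4⟩ := h
  have hε0 : ε ≠ 0 := hε.ne'
  have c2 : ((edgeWeight a ε .e2 ^ 2 / ε ^ 2 : ℝ)) = 1 := by
    simp only [edgeWeight, ha2, one_mul]
    exact div_self (pow_ne_zero 2 hε0)
  have m1 := h2 .e1
  have m2 := h2 .e2
  have m3 := h2 .e3
  have f1 := h3 .V1
  have f2 := h3 .V2
  simp only [WeightedGraph.flux, sum_edge] at f1 f2
  simp only [exGraph, c2] at m1 m2 m3 f1 f2
  have p3 : Complex.exp (Complex.I * τ * l .e3) = edgePhase l τ .e3 := rfl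
  rw [p3] at m1 f2
  rw [exp_eq_edgePhase_mul] at m3 f1
  simp [edgeWeight] at f1 f2
  refine ⟨U, U', u'', c .V1, c .V2, h1, h4 .e1, ?_, h4 .e3, ?_, by simpa using m1.2,
    by simpa using m2.1, by simpa using m2.2, by simpa using m3.1, ?_, ?_, ?_⟩
  · have := h4 .e2
    simp only [exGraph, c2] at this
    exact this
  · have := conj_edgePhase_mul l τ .e3
    rw [← m1.1]; linear_combination (-U .e1 0) * this
  · have e2 := conj_edgePhase_mul l τ .e2
    have e3 := conj_edgePhase_mul l τ .e3
    rw [← m3.2, map_mul]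
    linear_combination (-U .e3 (l .e3)) *
      (e2 * (starRingEnd ℂ (edgePhase l τ .e3) * edgePhase l τ .e3) + e3)
  · push_cast
    linear_combination f1
  · push_cast
    linear_combination -f2

namespace IsFibreSolution

variable {l a : Edge → ℝ} {ε τ : ℝ} {u g h : GraphL2 l} {U U' : Edge → ℝ → ℂ}
  {u'' : ∀ e, L2 (l e)} {d₁ d₂ : ℂ}

/-- The vertex values and the fluxes of the soft edge are bounded uniformly in `ε` and `τ`. -/
lemma exists_bound_vertex {l : Edge → ℝ} (hl : ∀ e, 0 < l e) : ∃ C : ℝ, 0 ≤ C ∧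
    ∀ {a : Edge → ℝ} {ε τ : ℝ} {u g : GraphL2 l} {U U' : Edge → ℝ → ℂ}
      {u'' : ∀ e, L2 (l e)} {d₁ d₂ : ℂ}, IsFibreSolution l a ε τ u g U U' u'' d₁ d₂ →
      ‖d₁‖ ≤ C * (‖u‖ + ‖g‖) ∧ ‖d₂‖ ≤ C * (‖u‖ + ‖g‖) ∧
      ‖twDeriv τ (U .e2) (U' .e2) 0‖ ≤ C * (‖u‖ + ‖g‖) ∧
      ‖twDeriv τ (U .e2) (U' .e2) (l .e2)‖ ≤ C * (‖u‖ + ‖g‖) := by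
  have hl2 := hl .e2
  set c : ℝ := 4 / √(l .e2) + 8 * l .e2 * √(l .e2) with hc
  have hc0 : 0 ≤ c := by positivity
  set k : ℝ := 2 * c / l .e2 + 2 * √(l .e2) with hk
  have hk0 : 0 ≤ k := by positivity
  refine ⟨c + k, by positivity, ?_⟩
  intro a ε τ u g U U' u'' d₁ d₂ hs
  have hu : ‖u .e2‖ ≤ ‖u‖ := PiLp.norm_apply_le u _
  have hg : ‖g .e2‖ ≤ ‖g‖ := PiLp.norm_apply_le g _
  have nu := norm_nonneg u
  have ng := norm_nonneg g
  obtain ⟨f1, f2⟩ := IsW22.ae_eq_of_coef one_pos hs.eq2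
  rw [div_one] at f2
  obtain ⟨b1, b2⟩ := (hs.isW22 .e2).norm_boundary_le hl2 τ f1
  have b3 := (hs.isW22 .e2).norm_twDeriv_zero_sub_le hl2 τ f1
  have b4 := (hs.isW22 .e2).norm_twDeriv_end_sub_le hl2 τ f1
  rw [f2] at b1 b2 b3 b4
  rw [hs.left2] at b1 b3 b4
  rw [hs.right2] at b2 b3 b4
  have hK : 4 / √(l .e2) * ‖u .e2‖ + 8 * l .e2 * (√(l .e2) * ‖g .e2‖) ≤ c * (‖u‖ + ‖g‖) := by
    have e1 : 4 / √(l .e2) * ‖u .e2‖ ≤ 4 / √(l .e2) * (‖u‖ + ‖g‖) := by gcongr; linarith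
    have e2 : 8 * l .e2 * (√(l .e2) * ‖g .e2‖) ≤ 8 * l .e2 * (√(l .e2) * (‖u‖ + ‖g‖)) := by
      gcongr; linarith
    rw [hc]; linarith
  have hd1 := b1.trans hK
  have hd2 := b2.trans hK
  have hq : ‖(Complex.exp (Complex.I * τ * l .e2) * d₂ - d₁) / l .e2‖ ≤
      2 * c / l .e2 * (‖u‖ + ‖g‖) := by
    rw [norm_div, Complex.norm_real, Real.norm_of_nonneg hl2.le, div_mul_eq_mul_div]
    gcongr
    refine (norm_sub_le _ _).trans ?_
    rw [norm_mul, norm_exp_I_mul_mul]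
    linarith
  have hgK : √(l .e2) * ‖g .e2‖ ≤ √(l .e2) * (‖u‖ + ‖g‖) := by gcongr; linarith
  have hgK0 : 0 ≤ √(l .e2) * (‖u‖ + ‖g‖) := by positivity
  have b5 : ‖twDeriv τ (U .e2) (U' .e2) 0‖ ≤ k * (‖u‖ + ‖g‖) := by
    have := norm_le_norm_add_norm_sub' (twDeriv τ (U .e2) (U' .e2) 0)
      ((Complex.exp (Complex.I * τ * l .e2) * d₂ - d₁) / l .e2)
    rw [hk]; nlinarith
  have b6 : ‖twDeriv τ (U .e2) (U' .e2) (l .e2)‖ ≤ k * (‖u‖ + ‖g‖) := by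
    have := norm_le_norm_add_norm_sub'
      (Complex.exp (Complex.I * τ * l .e2) * twDeriv τ (U .e2) (U' .e2) (l .e2))
      ((Complex.exp (Complex.I * τ * l .e2) * d₂ - d₁) / l .e2)
    rw [norm_mul, norm_exp_I_mul_mul, one_mul] at this
    rw [hk]; nlinarith
  have e1 : 0 ≤ c * (‖u‖ + ‖g‖) := by positivity
  have e2 : 0 ≤ k * (‖u‖ + ‖g‖) := by positivity
  rw [add_mul]
  exact ⟨by linarith, by linarith, by linarith, by linarith⟩

/-- By the Kirchhoff conditions the stiff boundary form maps the vertex values to `O(ε²)`. -/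
lemma exists_bound_kirchhoff {l a : Edge → ℝ} (hl : ∀ e, 0 < l e) (ha : ∀ e, 0 < a e) :
    ∃ C : ℝ, 0 ≤ C ∧
    ∀ {ε τ : ℝ} {u g : GraphL2 l} {U U' : Edge → ℝ → ℂ}
      {u'' : ∀ e, L2 (l e)} {d₁ d₂ : ℂ}, 0 < ε → IsFibreSolution l a ε τ u g U U' u'' d₁ d₂ →
      ‖((stiffness l a .e1 + stiffness l a .e3 : ℝ) : ℂ) * d₁
        - ‖xi l a τ‖ * starRingEnd ℂ (phase l a τ) * d₂‖ ≤ C * ε ^ 2 * (‖u‖ + ‖g‖) ∧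
      ‖((stiffness l a .e1 + stiffness l a .e3 : ℝ) : ℂ) * d₂
        - ‖xi l a τ‖ * phase l a τ * d₁‖ ≤ C * ε ^ 2 * (‖u‖ + ‖g‖) := by
  obtain ⟨c, hc0, hc⟩ := exists_bound_vertex hl
  set S := stiffness l a .e1 + stiffness l a .e3 with hS
  set k : ℝ := c + 2 * √(l .e1) + 2 * √(l .e3) with hk
  have hk0 : 0 ≤ k := by positivity
  refine ⟨k, by positivity, ?_⟩
  intro ε τ u g U U' u'' d₁ d₂ hε hs
  obtain ⟨-, -, t1, t2⟩ := hc hs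
  have nu := norm_nonneg u
  have ng := norm_nonneg g
  have hg1 : ‖g .e1‖ ≤ ‖u‖ + ‖g‖ := (PiLp.norm_apply_le g _).trans (by linarith)
  have hg3 : ‖g .e3‖ ≤ ‖u‖ + ‖g‖ := (PiLp.norm_apply_le g _).trans (by linarith)
  have hk1 : 0 < a .e1 ^ 2 / ε ^ 2 := div_pos (pow_pos (ha _) 2) (pow_pos hε 2)
  have hk3 : 0 < a .e3 ^ 2 / ε ^ 2 := div_pos (pow_pos (ha _) 2) (pow_pos hε 2)
  have r1 := (hs.isW22 .e1).norm_coef_twDeriv_zero_sub_le (hl .e1) hk1 τ hs.eq1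
  have r2 := (hs.isW22 .e1).norm_coef_twDeriv_end_sub_le (hl .e1) hk1 τ hs.eq1
  have r3 := (hs.isW22 .e3).norm_coef_twDeriv_zero_sub_le (hl .e3) hk3 τ hs.eq3
  have r4 := (hs.isW22 .e3).norm_coef_twDeriv_end_sub_le (hl .e3) hk3 τ hs.eq3
  rw [hs.left1, hs.right1] at r1 r2
  rw [hs.left3, hs.right3] at r3 r4
  have hεc : (ε : ℂ) ≠ 0 := by exact_mod_cast hε.ne'
  have q1 : ((a .e1 ^ 2 / ε ^ 2 : ℝ) : ℂ) / l .e1 = stiffness l a .e1 / ε ^ 2 := by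
    rw [stiffness]; push_cast; ring
  have q3 : ((a .e3 ^ 2 / ε ^ 2 : ℝ) : ℂ) / l .e3 = stiffness l a .e3 / ε ^ 2 := by
    rw [stiffness]; push_cast; ring
  rw [q1] at r1 r2
  rw [q3] at r3 r4
  have p1 := conj_edgePhase_mul l τ .e1
  have p2 := conj_edgePhase_mul l τ .e2
  have p3 := conj_edgePhase_mul l τ .e3
  have n1 := norm_edgePhase l τ .e1
  have n2 := norm_edgePhase l τ .e2
  have n3 := norm_edgePhase l τ .e3
  have K1 := hs.kirchhoff1
  have K2 := hs.kirchhoff2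
  have x1 := norm_xi_mul_phase_eq l a τ
  have x2 := norm_xi_mul_conj_phase_eq l a τ
  change ‖((a .e1 ^ 2 / ε ^ 2 : ℝ) : ℂ) * _ - _ * (edgePhase l τ .e1 * _ - _)‖ ≤ _ at r1
  change ‖((a .e1 ^ 2 / ε ^ 2 : ℝ) : ℂ) * (edgePhase l τ .e1 * _) - _ * (edgePhase l τ .e1 * _ - _)‖
    ≤ _ at r2
  change ‖((a .e3 ^ 2 / ε ^ 2 : ℝ) : ℂ) * _ - _ * (edgePhase l τ .e3 * _ - _)‖ ≤ _ at r3
  change ‖((a .e3 ^ 2 / ε ^ 2 : ℝ) : ℂ) * (edgePhase l τ .e3 * _) - _ * (edgePhase l τ .e3 * _ - _)‖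
    ≤ _ at r4
  set E1 := edgePhase l τ .e1
  set E2 := edgePhase l τ .e2
  set E3 := edgePhase l τ .e3
  set w := phase l a τ
  set κ1 : ℂ := ((a .e1 ^ 2 / ε ^ 2 : ℝ) : ℂ)
  set κ3 : ℂ := ((a .e3 ^ 2 / ε ^ 2 : ℝ) : ℂ)
  set T1 := twDeriv τ (U .e1) (U' .e1) (l .e1)
  set T3 := twDeriv τ (U .e3) (U' .e3) (l .e3)
  set Q1 := twDeriv τ (U .e1) (U' .e1) 0
  set Q3 := twDeriv τ (U .e3) (U' .e3) 0
  set A : ℂ := (stiffness l a .e1 : ℂ)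
  set B : ℂ := (stiffness l a .e3 : ℂ)
  set X : ℂ := (‖xi l a τ‖ : ℂ)
  set K := ‖u‖ + ‖g‖ with hK
  have hKn : 0 ≤ K := by positivity
  have hSc : (S : ℂ) = A + B := by rw [hS]; push_cast; rfl
  -- the Kirchhoff condition at `V1`
  have v1 : ‖((S : ℂ) * d₁ - X * starRingEnd ℂ w * d₂) / ε ^ 2‖ ≤ k * K := by
    have e : ((S : ℂ) * d₁ - X * starRingEnd ℂ w * d₂) / ε ^ 2 =
        twDeriv τ (U .e2) (U' .e2) 0
        - starRingEnd ℂ E1 * (κ1 * (E1 * T1) - A / ε ^ 2 * (E1 * d₁ - starRingEnd ℂ E3 * d₂))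
        - E2 * (κ3 * (E3 * T3) - B / ε ^ 2 * (E3 * (starRingEnd ℂ (E2 * E3) * d₁) - d₂)) := by
      rw [K1, map_mul, hSc, x2]
      field_simp
      linear_combination (κ1 * T1 * ε ^ 2 - A * d₁) * p1 - B * d₁ * p2
        - B * d₁ * (starRingEnd ℂ E2 * E2) * p3
    rw [e]
    refine (norm_sub_le _ _).trans ?_
    refine (add_le_add_left (norm_sub_le _ _) _).trans ?_
    rw [norm_mul, norm_mul E2, RCLike.norm_conj, n1, n2, one_mul, one_mul]
    have s1 := mul_le_mul_of_nonneg_left hg1 (Real.sqrt_nonneg (l .e1))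
    have s3 := mul_le_mul_of_nonneg_left hg3 (Real.sqrt_nonneg (l .e3))
    rw [hk]
    linarith
  -- the Kirchhoff condition at `V2`
  have v2 : ‖((S : ℂ) * d₂ - X * w * d₁) / ε ^ 2‖ ≤ k * K := by
    have e : ((S : ℂ) * d₂ - X * w * d₁) / ε ^ 2 =
        -(twDeriv τ (U .e2) (U' .e2) (l .e2)
        - E3 * (κ1 * Q1 - A / ε ^ 2 * (E1 * d₁ - starRingEnd ℂ E3 * d₂))
        - (κ3 * Q3 - B / ε ^ 2 * (E3 * (starRingEnd ℂ (E2 * E3) * d₁) - d₂))) := by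
      rw [K2, map_mul, hSc, x1]
      field_simp
      linear_combination (-A * d₂) * p3 + B * d₁ * starRingEnd ℂ E2 * p3
    rw [e, norm_neg]
    refine (norm_sub_le _ _).trans ?_
    refine (add_le_add_left (norm_sub_le _ _) _).trans ?_
    rw [norm_mul, n3, one_mul]
    have s1 := mul_le_mul_of_nonneg_left hg1 (Real.sqrt_nonneg (l .e1))
    have s3 := mul_le_mul_of_nonneg_left hg3 (Real.sqrt_nonneg (l .e3))
    have s5 : 0 ≤ √(l .e1) * K := by positivity
    have s6 : 0 ≤ √(l .e3) * K := by positivity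
    rw [hk]
    linarith
  have hε2 : (0 : ℝ) < ε ^ 2 := pow_pos hε 2
  have hnε : ‖(ε : ℂ) ^ 2‖ = ε ^ 2 := by
    rw [norm_pow, Complex.norm_real, Real.norm_of_nonneg hε.le]
  rw [norm_div, hnε, div_le_iff₀ hε2, mul_right_comm k K] at v1 v2
  exact ⟨v1, v2⟩

/-- Projection of an almost-kernel vector of `![![S, -X conj w], ![-X w, S]]` to the eigenvectors
`(1, w)` and `(1, -w)`. -/
lemma _root_.norm_le_of_eigenvector {S X M : ℝ} (hX : 0 ≤ X) (hXS : X ≤ S) {w d₁ d₂ : ℂ}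
    (nw : ‖w‖ = 1) (v1 : ‖(S : ℂ) * d₁ - X * starRingEnd ℂ w * d₂‖ ≤ M)
    (v2 : ‖(S : ℂ) * d₂ - X * w * d₁‖ ≤ M) :
    S * ‖d₂ - w * d₁‖ ≤ 2 * M ∧ (S - X) * ‖d₁‖ ≤ 2 * M := by
  have ew : starRingEnd ℂ w * w = 1 := by rw [Complex.conj_mul', nw]; simp
  have hS : 0 ≤ S := hX.trans hXS
  have g1 : ‖((S : ℂ) + X) * (d₂ - w * d₁)‖ ≤ 2 * M := by
    have e : ((S : ℂ) + X) * (d₂ - w * d₁) =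
        ((S : ℂ) * d₂ - X * w * d₁) - w * ((S : ℂ) * d₁ - X * starRingEnd ℂ w * d₂) := by
      linear_combination (-X * d₂) * ew
    rw [e]
    refine (norm_sub_le _ _).trans ?_
    rw [norm_mul, nw, one_mul]
    linarith
  have g2 : ‖((S : ℂ) - X) * (d₁ + starRingEnd ℂ w * d₂)‖ ≤ 2 * M := by
    have e : ((S : ℂ) - X) * (d₁ + starRingEnd ℂ w * d₂) =
        ((S : ℂ) * d₁ - X * starRingEnd ℂ w * d₂)
        + starRingEnd ℂ w * ((S : ℂ) * d₂ - X * w * d₁) := by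
      linear_combination (X * d₁) * ew
    rw [e]
    refine (norm_add_le _ _).trans ?_
    rw [norm_mul, RCLike.norm_conj, nw, one_mul]
    linarith
  have g1' : S * ‖d₂ - w * d₁‖ ≤ 2 * M := by
    rw [norm_mul, ← Complex.ofReal_add, Complex.norm_real,
      Real.norm_of_nonneg (by positivity)] at g1
    nlinarith [mul_nonneg hX (norm_nonneg (d₂ - w * d₁))]
  have g2' : (S - X) * ‖d₁ + starRingEnd ℂ w * d₂‖ ≤ 2 * M := by
    rwa [norm_mul, ← Complex.ofReal_sub, Complex.norm_real,
      Real.norm_of_nonneg (by linarith)] at g2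
  have hsum : 2 * ‖d₁‖ ≤ ‖d₁ + starRingEnd ℂ w * d₂‖ + ‖d₂ - w * d₁‖ := by
    have e : 2 * d₁ = (d₁ + starRingEnd ℂ w * d₂) - starRingEnd ℂ w * (d₂ - w * d₁) := by
      linear_combination (-d₁) * ew
    calc 2 * ‖d₁‖ = ‖2 * d₁‖ := by rw [norm_mul]; simp
      _ ≤ _ := by
        rw [e]
        refine (norm_sub_le _ _).trans ?_
        rw [norm_mul, RCLike.norm_conj, nw, one_mul]
  refine ⟨g1', ?_⟩
  have e1 := mul_le_mul_of_nonneg_left hsum (sub_nonneg.2 hXS)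
  have e2 := mul_nonneg hX (norm_nonneg (d₂ - w * d₁))
  nlinarith

/-- The components of the vertex values along the eigenvectors `(1, w_τ)` and `(1, -w_τ)` of the
stiff boundary form. -/
lemma exists_bound_gap {l a : Edge → ℝ} (hl : ∀ e, 0 < l e) (hl1 : l .e1 + l .e2 + l .e3 = 1)
    (ha : ∀ e, 0 < a e) : ∃ C : ℝ, 0 ≤ C ∧
    ∀ {ε τ : ℝ} {u g : GraphL2 l} {U U' : Edge → ℝ → ℂ}
      {u'' : ∀ e, L2 (l e)} {d₁ d₂ : ℂ}, 0 < ε → IsFibreSolution l a ε τ u g U U' u'' d₁ d₂ →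
      ‖d₂ - phase l a τ * d₁‖ ≤ C * ε ^ 2 * (‖u‖ + ‖g‖) ∧
      stiffGap l a τ * ‖d₁‖ ≤ C * ε ^ 2 * (‖u‖ + ‖g‖) := by
  obtain ⟨k, hk0, hk⟩ := exists_bound_kirchhoff hl ha
  have hA := stiffness_pos hl ha .e1
  have hB := stiffness_pos hl ha .e3
  have hS0 : 0 < stiffness l a .e1 + stiffness l a .e3 := by positivity
  refine ⟨2 * k / (stiffness l a .e1 + stiffness l a .e3) + 2 * k, by positivity, ?_⟩
  intro ε τ u g U U' u'' d₁ d₂ hε hs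
  obtain ⟨v1, v2⟩ := hk hε hs
  have gap0 := stiffGap_nonneg hl hl1 ha τ
  rw [stiffGap] at gap0 ⊢
  obtain ⟨g1, g2⟩ := norm_le_of_eigenvector (norm_nonneg (xi l a τ)) (sub_nonneg.1 gap0)
    (norm_phase l a τ) v1 v2
  have hkK : 0 ≤ k * ε ^ 2 * (‖u‖ + ‖g‖) := by positivity
  have h1 : 0 ≤ 2 * (k * ε ^ 2 * (‖u‖ + ‖g‖)) / (stiffness l a .e1 + stiffness l a .e3) := by
    positivity
  have e : (2 * k / (stiffness l a .e1 + stiffness l a .e3) + 2 * k) * ε ^ 2 * (‖u‖ + ‖g‖) =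
      2 * (k * ε ^ 2 * (‖u‖ + ‖g‖)) / (stiffness l a .e1 + stiffness l a .e3)
      + 2 * (k * ε ^ 2 * (‖u‖ + ‖g‖)) := by ring
  rw [e]
  constructor
  · have : ‖d₂ - phase l a τ * d₁‖ ≤
        2 * (k * ε ^ 2 * (‖u‖ + ‖g‖)) / (stiffness l a .e1 + stiffness l a .e3) := by
      rw [le_div_iff₀ hS0]; linarith
    linarith
  · linarith

/-- On the stiff edges the solution is a multiple of the lift of the eigenvector up to `O(ε²)`. -/
lemma exists_bound_bulk {l a : Edge → ℝ} (hl : ∀ e, 0 < l e) (hl1 : l .e1 + l .e2 + l .e3 = 1)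
    (ha : ∀ e, 0 < a e) : ∃ C : ℝ, 0 ≤ C ∧
    ∀ {ε τ : ℝ} {u g h : GraphL2 l} {U U' : Edge → ℝ → ℂ}
      {u'' : ∀ e, L2 (l e)} {d₁ d₂ : ℂ}, 0 < ε → IsFibreSolution l a ε τ u g U U' u'' d₁ d₂ →
      IsStiffLift l a τ h →
      ‖u .e1 - d₁ • h .e1‖ ≤ C * ε ^ 2 * (‖u‖ + ‖g‖) ∧
      ‖u .e3 - d₁ • h .e3‖ ≤ C * ε ^ 2 * (‖u‖ + ‖g‖) := by
  obtain ⟨c, hc0, hc⟩ := exists_bound_gap hl hl1 ha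
  set k : Edge → ℝ := fun e => √(l e) * (2 * l e * (√(l e) / a e ^ 2) + c) with hk
  have hk0 (e : Edge) : 0 ≤ k e := by
    have := hl e
    have := ha e
    positivity
  refine ⟨k .e1 + k .e3, add_nonneg (hk0 _) (hk0 _), ?_⟩
  intro ε τ u g h U U' u'' d₁ d₂ hε hs hh
  obtain ⟨hδ, -⟩ := hc hε hs
  obtain ⟨H1, H1', h1'', h1⟩ := hh.edge1
  obtain ⟨H3, H3', h3'', h3⟩ := hh.edge3
  have nu := norm_nonneg u
  have ng := norm_nonneg g
  have hg (e : Edge) : ‖g e‖ ≤ ‖u‖ + ‖g‖ := (PiLp.norm_apply_le g _).trans (by linarith)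
  have hκ (e : Edge) : 0 < a e ^ 2 / ε ^ 2 := div_pos (pow_pos (ha _) 2) (pow_pos hε 2)
  have r1 := (hs.isW22 .e1).norm_sub_smul_le (hl .e1) (hκ .e1) τ hs.eq1 (d := d₁) h1
  have r3 := (hs.isW22 .e3).norm_sub_smul_le (hl .e3) (hκ .e3) τ hs.eq3 (d := d₁) h3
  rw [hs.left1, hs.right1, mul_one, sub_self, norm_zero, add_zero,
    show starRingEnd ℂ (edgePhase l τ .e3) * d₂ -
      d₁ * (starRingEnd ℂ (edgePhase l τ .e3) * phase l a τ) =
      starRingEnd ℂ (edgePhase l τ .e3) * (d₂ - phase l a τ * d₁) by ring,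
    norm_mul, RCLike.norm_conj, norm_edgePhase, one_mul] at r1
  rw [hs.left3, hs.right3, mul_comm (starRingEnd ℂ _) d₁, sub_self, norm_zero, add_zero,
    mul_comm d₁] at r3
  have key (e : Edge) : √(l e) * (2 * l e * (√(l e) * (‖g e‖ / (a e ^ 2 / ε ^ 2)))
      + ‖d₂ - phase l a τ * d₁‖) ≤ k e * ε ^ 2 * (‖u‖ + ‖g‖) := by
    have hle := hl e
    have hae := ha e
    calc _ ≤ √(l e) * (2 * l e * (√(l e) * ((‖u‖ + ‖g‖) / (a e ^ 2 / ε ^ 2)))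
          + c * ε ^ 2 * (‖u‖ + ‖g‖)) := by
          gcongr
          exact hg e
      _ = _ := by
          rw [hk]
          field_simp
  have z1 : 0 ≤ k .e1 * ε ^ 2 * (‖u‖ + ‖g‖) :=
    mul_nonneg (mul_nonneg (hk0 _) (sq_nonneg _)) (by positivity)
  have z3 : 0 ≤ k .e3 * ε ^ 2 * (‖u‖ + ‖g‖) :=
    mul_nonneg (mul_nonneg (hk0 _) (sq_nonneg _)) (by positivity)
  rw [add_mul, add_mul]
  exact ⟨by linarith [r1.trans (key .e1)], by linarith [r3.trans (key .e3)]⟩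

/-- Green's formula with the lift of the eigenvector, for the flux out of the soft edge. -/
lemma flux_eq {l a : Edge → ℝ} (hl : ∀ e, 0 < l e) {ε τ : ℝ}
    {u g h : GraphL2 l} {U U' : Edge → ℝ → ℂ} {u'' : ∀ e, L2 (l e)} {d₁ d₂ : ℂ}
    (hs : IsFibreSolution l a ε τ u g U U' u'' d₁ d₂) (hh : IsStiffLift l a τ h) :
    twDeriv τ (U .e2) (U' .e2) 0
      - starRingEnd ℂ (phase l a τ) * twDeriv τ (U .e2) (U' .e2) (l .e2) =
    (stiffGap l a τ / ε ^ 2) * (d₁ + starRingEnd ℂ (phase l a τ) * d₂) - inner ℂ h g := by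
  obtain ⟨H1, H1', h1'', h1⟩ := hh.edge1
  obtain ⟨H3, H3', h3'', h3⟩ := hh.edge3
  have z (e : Edge) {κ : ℝ} {W W' : ℝ → ℂ} {w'' : L2 (l e)}
      (h0 : ∀ᵐ x ∂volume.restrict (Ioo (0 : ℝ) (l e)), twDeriv2 τ W W' w'' x = 0) :
      ∀ᵐ x ∂volume.restrict (Ioo (0 : ℝ) (l e)), ((0 : L2 (l e)) : ℝ → ℂ) x =
        -(κ : ℂ) * twDeriv2 τ W W' w'' x := by
    filter_upwards [h0, Lp.coeFn_zero ℂ 2 (volume.restrict (Ioo (0 : ℝ) (l e)))] with x a b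
    rw [a, b]; simp
  have g1 := h1.isW22.green (hs.isW22 .e1) (hl .e1).le τ _ (z .e1 h1.twDeriv2_eq_zero) hs.eq1
  have g3 := h3.isW22.green (hs.isW22 .e3) (hl .e3).le τ _ (z .e3 h3.twDeriv2_eq_zero) hs.eq3
  have hin : inner ℂ h g = inner ℂ (h .e1) (g .e1) + inner ℂ (h .e3) (g .e3) := by
    rw [PiLp.inner_apply, sum_edge, hh.soft, inner_zero_left, add_zero]
  have m0 (e : Edge) : (0 : ℝ) ∈ Icc (0 : ℝ) (l e) := left_mem_Icc.2 (hl e).le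
  have ml (e : Edge) : l e ∈ Icc (0 : ℝ) (l e) := right_mem_Icc.2 (hl e).le
  have t10 := h1.gauge_twDeriv 0 (m0 _)
  have t11 := h1.gauge_twDeriv _ (ml _)
  have t30 := h3.gauge_twDeriv 0 (m0 _)
  have t31 := h3.gauge_twDeriv _ (ml _)
  rw [inner_zero_left, sub_zero, hs.left1, hs.right1, h1.left, h1.right] at g1
  rw [inner_zero_left, sub_zero, hs.left3, hs.right3, h3.left, h3.right] at g3
  simp only [Complex.ofReal_zero, mul_zero, Complex.exp_zero, one_mul] at t10 t30
  change _ = (edgePhase l τ .e1 * _ - _) / _ at t10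
  change edgePhase l τ .e1 * _ = (edgePhase l τ .e1 * _ - _) / _ at t11
  change _ = (edgePhase l τ .e3 * _ - _) / _ at t30
  change edgePhase l τ .e3 * _ = (edgePhase l τ .e3 * _ - _) / _ at t31
  have p1 := conj_edgePhase_mul l τ .e1
  have p2 := conj_edgePhase_mul l τ .e2
  have p3 := conj_edgePhase_mul l τ .e3
  have ew := conj_phase_mul_phase l a τ
  have x1 := norm_xi_mul_phase_eq l a τ
  have x2 := norm_xi_mul_conj_phase_eq l a τ
  rw [hin, g1, g3, hs.kirchhoff1, hs.kirchhoff2, stiffGap]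
  have t11' : twDeriv τ H1 H1' (l .e1) = starRingEnd ℂ (edgePhase l τ .e1) *
      ((edgePhase l τ .e1 * 1 - starRingEnd ℂ (edgePhase l τ .e3) * phase l a τ) / l .e1) := by
    rw [← t11]; linear_combination (-twDeriv τ H1 H1' (l .e1)) * p1
  have t31' : twDeriv τ H3 H3' (l .e3) = starRingEnd ℂ (edgePhase l τ .e3) *
      ((edgePhase l τ .e3 * starRingEnd ℂ (edgePhase l τ .e2 * edgePhase l τ .e3) - phase l a τ)
        / l .e3) := by
    rw [← t31]; linear_combination (-twDeriv τ H3 H3' (l .e3)) * p3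
  have hl1' : (l .e1 : ℂ) ≠ 0 := by exact_mod_cast (hl .e1).ne'
  have hl3' : (l .e3 : ℂ) ≠ 0 := by exact_mod_cast (hl .e3).ne'
  have q1 : ((a .e1 ^ 2 / ε ^ 2 : ℝ) : ℂ) = stiffness l a .e1 * l .e1 / ε ^ 2 := by
    rw [stiffness]; push_cast; field_simp
  have q3 : ((a .e3 ^ 2 / ε ^ 2 : ℝ) : ℂ) = stiffness l a .e3 * l .e3 / ε ^ 2 := by
    rw [stiffness]; push_cast; field_simp
  have c10 := congrArg (fun y => ((a .e1 ^ 2 / ε ^ 2 : ℝ) : ℂ) * starRingEnd ℂ y) t10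
  have c11 := congrArg (fun y => ((a .e1 ^ 2 / ε ^ 2 : ℝ) : ℂ) * starRingEnd ℂ y) t11'
  have c30 := congrArg (fun y => ((a .e3 ^ 2 / ε ^ 2 : ℝ) : ℂ) * starRingEnd ℂ y) t30
  have c31 := congrArg (fun y => ((a .e3 ^ 2 / ε ^ 2 : ℝ) : ℂ) * starRingEnd ℂ y) t31'
  simp only [map_mul, map_sub, map_div₀, Complex.conj_conj, Complex.conj_ofReal, map_one,
    mul_one] at c10 c11 c30 c31 ⊢
  set E1 := edgePhase l τ .e1
  set E2 := edgePhase l τ .e2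
  set E3 := edgePhase l τ .e3
  set w := phase l a τ
  set A : ℂ := (stiffness l a .e1 : ℂ)
  set B : ℂ := (stiffness l a .e3 : ℂ)
  set X : ℂ := (‖xi l a τ‖ : ℂ)
  set r : ℂ := ((ε : ℂ) ^ 2)⁻¹ with hr
  have k1 (y : ℂ) : ((a .e1 ^ 2 / ε ^ 2 : ℝ) : ℂ) * (y / l .e1) = A * r * y := by
    rw [q1, hr]; field_simp
  have k3 (y : ℂ) : ((a .e3 ^ 2 / ε ^ 2 : ℝ) : ℂ) * (y / l .e3) = B * r * y := by
    rw [q3, hr]; field_simp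
  rw [k1] at c10
  rw [mul_left_comm, k1] at c11
  rw [k3] at c30
  rw [mul_left_comm, k3] at c31
  have hdiv (y : ℂ) : y / (ε : ℂ) ^ 2 = y * r := div_eq_mul_inv _ _
  rw [hdiv, Complex.ofReal_sub, Complex.ofReal_add]
  linear_combination d₁ * c11 - starRingEnd ℂ E3 * d₂ * c10
    + starRingEnd ℂ E2 * starRingEnd ℂ E3 * d₁ * c31 - d₂ * c30
    + A * r * (d₁ * p1 + starRingEnd ℂ w * d₂ * p3)
    + B * r * (d₁ * (starRingEnd ℂ E2 * E2 * (starRingEnd ℂ E3 * E3 + 1) * p3 + p2)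
      - d₂ * E2 * p3 - starRingEnd ℂ w * starRingEnd ℂ E2 * d₁ * p3)
    + r * d₂ * x2 + r * starRingEnd ℂ w * d₁ * x1 - r * X * d₁ * ew

end IsFibreSolution

/-! ### The partial isometries -/

section HomMap

variable {l : Edge → ℝ}

/-- The map `u ↦ (u₂, ⟪φ, u⟫)` from `H` to `H_hom`. -/
noncomputable def homMap (φ : GraphL2 l) : GraphL2 l →L[ℂ] HomL2 l :=
  (WithLp.prodContinuousLinearEquiv 2 ℂ (L2 (l .e2)) ℂ).symm.toContinuousLinearMap ∘L
    ((PiLp.proj 2 (𝕜 := ℂ) (fun e => L2 (l e)) Edge.e2).prod (innerSL ℂ φ))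

@[simp] lemma homMap_fst (φ u : GraphL2 l) : (homMap φ u).fst = u .e2 := rfl

@[simp] lemma homMap_snd (φ u : GraphL2 l) : (homMap φ u).snd = inner ℂ φ u := rfl

lemma adjoint_homMap_apply (φ : GraphL2 l) (p : HomL2 l) :
    ContinuousLinearMap.adjoint (homMap φ) p =
      WithLp.toLp 2 (Pi.single Edge.e2 p.fst) + p.snd • φ := by
  refine ext_inner_right ℂ fun u => ?_
  rw [ContinuousLinearMap.adjoint_inner_left, WithLp.prod_inner_apply, inner_add_left,
    inner_smul_left, PiLp.inner_apply, sum_edge]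
  have h1 : (WithLp.toLp 2 (Pi.single Edge.e2 p.fst) : GraphL2 l) .e1 = 0 := by simp
  have h2 : (WithLp.toLp 2 (Pi.single Edge.e2 p.fst) : GraphL2 l) .e2 = p.fst := by simp
  have h3 : (WithLp.toLp 2 (Pi.single Edge.e2 p.fst) : GraphL2 l) .e3 = 0 := by simp
  rw [h1, h2, h3, inner_zero_left, inner_zero_left, zero_add, add_zero]
  change inner ℂ p.fst (u .e2) + inner ℂ p.snd (inner ℂ φ u) = _
  rw [RCLike.inner_apply, mul_comm]

/-- `homMap φ` is isometric on the span of the soft component and the unit vector `φ`. -/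
lemma isPartialIsometry_homMap {φ : GraphL2 l} (h2 : φ .e2 = 0) (hφ : ‖φ‖ = 1) :
    IsPartialIsometry (homMap φ) := by
  refine ContinuousLinearMap.ext fun u => ?_
  rw [ContinuousLinearMap.comp_apply, ContinuousLinearMap.comp_apply, adjoint_homMap_apply]
  refine (WithLp.ofLp_injective 2) (Prod.ext ?_ ?_)
  · change (homMap φ _).fst = (homMap φ u).fst
    rw [homMap_fst]
    simp [h2]
  · change (homMap φ _).snd = (homMap φ u).snd
    have h0 : inner ℂ φ (WithLp.toLp 2 (Pi.single Edge.e2 (u .e2)) : GraphL2 l) = 0 := by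
      rw [PiLp.inner_apply, sum_edge, h2]
      simp
    rw [homMap_snd, inner_add_right, inner_smul_right, homMap_fst, h0,
      inner_self_eq_norm_sq_to_K, hφ]
    simp

end HomMap

/-! ### Estimates for the homogenised operator -/

lemma HomL2.norm_fst_le {l : Edge → ℝ} (p : HomL2 l) : ‖p.fst‖ ≤ ‖p‖ := by
  have := WithLp.prod_norm_sq_eq_of_L2 p
  exact (sq_le_sq₀ (norm_nonneg _) (norm_nonneg _)).1 (by
    rw [this]; exact le_add_of_nonneg_right (sq_nonneg _))

lemma HomL2.norm_snd_le {l : Edge → ℝ} (p : HomL2 l) : ‖p.snd‖ ≤ ‖p‖ := by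
  have := WithLp.prod_norm_sq_eq_of_L2 p
  exact (sq_le_sq₀ (norm_nonneg _) (norm_nonneg _)).1 (by
    rw [this]; exact le_add_of_nonneg_left (sq_nonneg _))

lemma germ_pos {l a : Edge → ℝ} (hl : ∀ e, 0 < l e) (ha : ∀ e, 0 < a e) : 0 < germ l a := by
  have h1 := hl .e1
  have h3 := hl .e3
  have h4 := ha .e1
  have h5 := ha .e3
  unfold germ
  positivity

/-- The component of `(𝒜 - z)⁻¹` in `ℂ` is of order `min 1 (ε² / τ²)`. -/
lemma exists_bound_hom_snd {l a : Edge → ℝ} (hl : ∀ e, 0 < l e) (ha : ∀ e, 0 < a e) :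
    ∃ C : ℝ, 0 ≤ C ∧ ∀ {ε τ : ℝ} {p q : HomL2 l}, 0 < ε → (p, q) ∈ homGraph l a ε τ →
      τ ^ 2 * ‖p.snd‖ ≤ C * ε ^ 2 * (‖p‖ + ‖q‖) := by
  have hl2 := hl .e2
  have hg := germ_pos hl ha
  set s : ℝ := √(l .e1 + l .e3) with hs
  have hs0 : 0 < s := Real.sqrt_pos.2 (add_pos (hl _) (hl _))
  set k : ℝ := 1 + (1 / s) * (4 / (s * l .e2) + 3 * √(l .e2)) with hk
  have hk0 : 0 ≤ k := by positivity
  refine ⟨k / germ l a, by positivity, ?_⟩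
  rintro ε τ p q hε ⟨U, U', u'', h1, h2, h3, h4, h5⟩
  simp only at h1 h2 h3 h4 h5
  have hsc : ‖((s : ℝ) : ℂ)‖ = s := by rw [Complex.norm_real, Real.norm_of_nonneg hs0.le]
  have nw := norm_phase l a τ
  have np := norm_nonneg p
  have nq := norm_nonneg q
  have hp := HomL2.norm_snd_le p
  have hq1 := HomL2.norm_fst_le q
  have hq2 := HomL2.norm_snd_le q
  obtain ⟨f1, f2⟩ := IsW22.ae_eq_of_coef (g := q.fst) one_pos (τ := τ) (by simpa using h4)
  rw [div_one] at f2
  have b3 := h1.norm_twDeriv_zero_sub_le hl2 τ f1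
  have b4 := h1.norm_twDeriv_end_sub_le hl2 τ f1
  rw [f2] at b3 b4
  have n0 : ‖U 0‖ = ‖p.snd‖ / s := by rw [h2, norm_div, hsc]
  have n1 : ‖U (l .e2)‖ = ‖p.snd‖ / s := by
    rw [← hsc, ← norm_div, ← h3, norm_mul, RCLike.norm_conj, nw, one_mul]
  have hquot : ‖(Complex.exp (Complex.I * τ * l .e2) * U (l .e2) - U 0) / l .e2‖ ≤
      2 / (s * l .e2) * ‖p.snd‖ := by
    rw [norm_div, Complex.norm_real, Real.norm_of_nonneg hl2.le, div_le_iff₀ hl2]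
    refine (norm_sub_le _ _).trans (le_of_eq ?_)
    rw [norm_mul, norm_exp_I_mul_mul, n0, n1]
    field_simp
    ring
  have t0 : ‖twDeriv τ U U' 0‖ ≤ 2 / (s * l .e2) * ‖p.snd‖ + √(l .e2) * ‖q.fst‖ :=
    (norm_le_norm_add_norm_sub' _ _).trans (add_le_add hquot b3)
  have t1 : ‖twDeriv τ U U' (l .e2)‖ ≤ 2 / (s * l .e2) * ‖p.snd‖ + 2 * (√(l .e2) * ‖q.fst‖) := by
    have := (norm_le_norm_add_norm_sub' _ _).trans (add_le_add hquot b4)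
    rwa [norm_mul, norm_exp_I_mul_mul, one_mul] at this
  have e : ((germ l a * (τ / ε) ^ 2 : ℝ) : ℂ) * p.snd = q.snd + (1 / (s : ℂ)) *
      (twDeriv τ U U' 0 - starRingEnd ℂ (phase l a τ) * twDeriv τ U U' (l .e2)) := by
    rw [h5]; ring
  have hn : germ l a * (τ / ε) ^ 2 * ‖p.snd‖ ≤ k * (‖p‖ + ‖q‖) := by
    have e1 : germ l a * (τ / ε) ^ 2 * ‖p.snd‖ = ‖((germ l a * (τ / ε) ^ 2 : ℝ) : ℂ) * p.snd‖ := by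
      rw [norm_mul, Complex.norm_real, Real.norm_of_nonneg (by positivity)]
    rw [e1, e]
    refine (norm_add_le _ _).trans ?_
    have e2 : ‖(1 / (s : ℂ)) * (twDeriv τ U U' 0
        - starRingEnd ℂ (phase l a τ) * twDeriv τ U U' (l .e2))‖ ≤
        (1 / s) * ((4 / (s * l .e2) + 3 * √(l .e2)) * (‖p‖ + ‖q‖)) := by
      rw [norm_mul, norm_div, hsc, norm_one]
      refine mul_le_mul_of_nonneg_left ((norm_sub_le _ _).trans ?_) (by positivity)
      rw [norm_mul, RCLike.norm_conj, nw, one_mul]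
      have c1 : 2 / (s * l .e2) * ‖p.snd‖ ≤ 2 / (s * l .e2) * (‖p‖ + ‖q‖) := by gcongr; linarith
      have c2 : √(l .e2) * ‖q.fst‖ ≤ √(l .e2) * (‖p‖ + ‖q‖) := by gcongr; linarith
      have c3 : 4 / (s * l .e2) * (‖p‖ + ‖q‖) = 2 * (2 / (s * l .e2) * (‖p‖ + ‖q‖)) := by ring
      rw [add_mul, c3]
      linarith
    rw [hk, add_mul, one_mul, mul_assoc]
    linarith
  have e3 : germ l a * (τ / ε) ^ 2 * ‖p.snd‖ = germ l a * (τ ^ 2 * ‖p.snd‖) / ε ^ 2 := by ring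
  rw [e3, div_le_iff₀ (pow_pos hε 2)] at hn
  rw [show k / germ l a * ε ^ 2 * (‖p‖ + ‖q‖) = k * (‖p‖ + ‖q‖) * ε ^ 2 / germ l a by ring,
    le_div_iff₀ hg]
  linarith

/-- The bound for the component in `ℂ`, transposed by the symmetry of the operator: data
in `ℂ` give solutions of order `min 1 (ε² / τ²)`. -/
lemma exists_bound_hom_of_fst_eq_zero {l a : Edge → ℝ} (hl : ∀ e, 0 < l e) (ha : ∀ e, 0 < a e)
    {M σ : ℝ} (hM : 0 ≤ M) (hσ : 0 < σ) :
    ∃ C : ℝ, 0 ≤ C ∧ ∀ {ε τ : ℝ} {z : ℂ} {p r : HomL2 l}, 0 < ε → ‖z‖ ≤ M → σ ≤ |z.im| →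
      r.fst = 0 → (p, r + z • p) ∈ homGraph l a ε τ → τ ^ 2 * ‖p‖ ≤ C * ε ^ 2 * ‖r.snd‖ := by
  obtain ⟨c, hc0, hc⟩ := exists_bound_hom_snd hl ha
  refine ⟨c * ((1 + M) / σ + 1), by positivity, ?_⟩
  intro ε τ z p r hε hz hzσ hr hp
  have hzim : z.im ≠ 0 := abs_pos.1 (hσ.trans_le hzσ)
  obtain ⟨⟨y, g⟩, hy, hyp⟩ := exists_mem_homGraph_sub_smul_eq a hl ε τ
    (z := starRingEnd ℂ z) (by simpa using hzim) p
  have hg : g = p + starRingEnd ℂ z • y := by rw [← hyp]; simp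
  have hyn : ‖y‖ ≤ ‖p‖ / σ := by
    have := abs_im_mul_norm_le_of_inner_eq (inner_homGraph a hl ε τ _ hy _ hy) (starRingEnd ℂ z)
    rw [hyp, Complex.conj_im, abs_neg] at this
    rw [le_div_iff₀ hσ]
    nlinarith [mul_le_mul_of_nonneg_right hzσ (norm_nonneg y)]
  have hsym := inner_homGraph a hl ε τ _ hy _ hp
  simp only [hg, inner_add_left, inner_add_right, inner_smul_left, inner_smul_right,
    Complex.conj_conj, add_left_inj] at hsym
  rw [WithLp.prod_inner_apply y r] at hsym
  change _ = inner ℂ y.fst r.fst + inner ℂ y.snd r.snd at hsym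
  rw [hr, inner_zero_right, zero_add, inner_self_eq_norm_sq_to_K] at hsym
  have h1 : ‖p‖ ^ 2 ≤ ‖y.snd‖ * ‖r.snd‖ := by
    have := norm_inner_le_norm (𝕜 := ℂ) y.snd r.snd
    rw [← hsym] at this
    simpa using this
  have h2 := hc hε hy
  have h3 : ‖y‖ + ‖g‖ ≤ ((1 + M) / σ + 1) * ‖p‖ := by
    have : ‖g‖ ≤ ‖p‖ + M * ‖y‖ := by
      rw [hg]
      refine (norm_add_le _ _).trans (add_le_add_right ?_ _)
      rw [norm_smul, RCLike.norm_conj]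
      gcongr
    have h4 : M * ‖y‖ ≤ M * (‖p‖ / σ) := by gcongr
    calc ‖y‖ + ‖g‖ ≤ ‖p‖ / σ + (‖p‖ + M * (‖p‖ / σ)) := by linarith
      _ = _ := by ring
  have h5 : τ ^ 2 * ‖y.snd‖ ≤ c * ε ^ 2 * (((1 + M) / σ + 1) * ‖p‖) :=
    h2.trans (by gcongr)
  rcases (norm_nonneg p).eq_or_lt with h0 | h0
  · rw [← h0, mul_zero]
    positivity
  · refine le_of_mul_le_mul_right ?_ h0
    calc τ ^ 2 * ‖p‖ * ‖p‖ = τ ^ 2 * ‖p‖ ^ 2 := by ring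
      _ ≤ τ ^ 2 * (‖y.snd‖ * ‖r.snd‖) := by gcongr
      _ = (τ ^ 2 * ‖y.snd‖) * ‖r.snd‖ := by ring
      _ ≤ (c * ε ^ 2 * (((1 + M) / σ + 1) * ‖p‖)) * ‖r.snd‖ := by gcongr
      _ = _ := by ring

/-- Data which are `O(ε²)` in the soft component and `O(τ² + ε²)` in `ℂ` give solutions of order
`ε²`: the `ℂ`-component of the data is damped by the germ `(τ/ε)²`. -/
lemma exists_bound_hom_residual {l a : Edge → ℝ} (hl : ∀ e, 0 < l e) (ha : ∀ e, 0 < a e)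
    {M σ : ℝ} (hM : 0 ≤ M) (hσ : 0 < σ) :
    ∃ C : ℝ, 0 ≤ C ∧ ∀ {ε τ B : ℝ} {z : ℂ} {y ρ : HomL2 l}, 0 < ε → ‖z‖ ≤ M → σ ≤ |z.im| →
      0 ≤ B → (y, ρ + z • y) ∈ homGraph l a ε τ → ‖ρ.fst‖ ≤ ε ^ 2 * B →
      ‖ρ.snd‖ ≤ (τ ^ 2 + ε ^ 2) * B → ‖y‖ ≤ C * ε ^ 2 * B := by
  obtain ⟨c, hc0, hc⟩ := exists_bound_hom_of_fst_eq_zero hl ha hM hσ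
  refine ⟨1 / σ + (2 / σ + 2 * c), by positivity, ?_⟩
  intro ε τ B z y ρ hε hz hzσ hB hy h1 h2
  have hzim : z.im ≠ 0 := abs_pos.1 (hσ.trans_le hzσ)
  have hε2 : 0 < ε ^ 2 := pow_pos hε 2
  have hres {p r : HomL2 l} (hp : (p, r + z • p) ∈ homGraph l a ε τ) : ‖p‖ ≤ ‖r‖ / σ := by
    have := abs_im_mul_norm_le_of_inner_eq (inner_homGraph a hl ε τ _ hp _ hp) z
    simp only [add_sub_cancel_right] at this
    rw [le_div_iff₀ hσ]
    nlinarith [mul_le_mul_of_nonneg_right hzσ (norm_nonneg p)]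
  let r : HomL2 l := WithLp.toLp 2 (0, ρ.snd)
  obtain ⟨⟨p, q⟩, hp, hpq⟩ := exists_mem_homGraph_sub_smul_eq a hl ε τ hzim r
  have hq : q = r + z • p := by rw [← hpq]; simp
  rw [hq] at hp
  have hrn : ‖r‖ = ‖ρ.snd‖ := by
    rw [← sq_eq_sq₀ (norm_nonneg _) (norm_nonneg _), WithLp.prod_norm_sq_eq_of_L2]
    simp [r]
  have hdn : ‖ρ - r‖ = ‖ρ.fst‖ := by
    rw [← sq_eq_sq₀ (norm_nonneg _) (norm_nonneg _), WithLp.prod_norm_sq_eq_of_L2]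
    simp [r]
  have hd : (y - p, (ρ - r) + z • (y - p)) ∈ homGraph l a ε τ := by
    have := (homGraph l a ε τ).sub_mem hy hp
    rw [Prod.mk_sub_mk] at this
    convert this using 2
    rw [smul_sub]; abel
  have b1 : ‖y - p‖ ≤ 1 / σ * ε ^ 2 * B := by
    refine (hres hd).trans ?_
    rw [hdn, div_le_iff₀ hσ]
    refine h1.trans (le_of_eq ?_)
    field_simp
  have b2 : ‖p‖ ≤ (2 / σ + 2 * c) * ε ^ 2 * B := by
    -- For `τ² ≤ ε²` the data are themselves `O(ε²)`; otherwise the germ dominates.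
    rcases le_total (τ ^ 2) (ε ^ 2) with h | h
    · have : ‖p‖ ≤ 2 / σ * ε ^ 2 * B := by
        refine (hres hp).trans ?_
        rw [hrn, div_le_iff₀ hσ]
        refine h2.trans ?_
        calc (τ ^ 2 + ε ^ 2) * B ≤ (ε ^ 2 + ε ^ 2) * B := by gcongr
          _ = _ := by field_simp; ring
      refine this.trans ?_
      gcongr
      linarith
    · have hτ2 : 0 < τ ^ 2 := hε2.trans_le h
      have h3 := hc hε hz hzσ (r := r) rfl hp
      have : ‖p‖ ≤ 2 * c * ε ^ 2 * B := by
        refine le_of_mul_le_mul_left (h3.trans ?_) hτ2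
        calc c * ε ^ 2 * ‖r.snd‖ ≤ c * ε ^ 2 * ((τ ^ 2 + τ ^ 2) * B) := by
              gcongr
              refine h2.trans ?_
              gcongr
          _ = _ := by ring
      refine this.trans ?_
      gcongr
      have : 0 < 2 / σ := by positivity
      linarith
  calc ‖y‖ = ‖(y - p) + p‖ := by rw [sub_add_cancel]
    _ ≤ _ := norm_add_le _ _
    _ ≤ _ := by rw [add_mul, add_mul]; exact add_le_add b1 b2

/-! ### The corrector and the norm-resolvent estimate -/

namespace IsFibreSolution

variable {l a : Edge → ℝ} {ε τ : ℝ} {u g h : GraphL2 l} {U U' : Edge → ℝ → ℂ}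
  {u'' : ∀ e, L2 (l e)} {d₁ d₂ : ℂ}

/-- Subtracting a multiple of a harmonic lift on the soft edge corrects the mismatch of the vertex
values, and gives an element of the domain of the homogenised operator. -/
lemma corrector_mem_homGraph (hl : ∀ e, 0 < l e)
    (hs : IsFibreSolution l a ε τ u g U U' u'' d₁ d₂) (hh : IsStiffLift l a τ h)
    {v v'' : L2 (l .e2)} {W W' : ℝ → ℂ} (hv : IsHarmonicLift (l .e2) τ 0 1 v W W' v'') :
    ((WithLp.toLp 2 (u .e2 - (d₂ - phase l a τ * d₁) • v, (√(l .e1 + l .e3) : ℝ) * d₁),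
      WithLp.toLp 2 (g .e2, -(1 / (√(l .e1 + l .e3) : ℝ)) *
        ((stiffGap l a τ / ε ^ 2) * (d₁ + starRingEnd ℂ (phase l a τ) * d₂) - inner ℂ h g
          - (d₂ - phase l a τ * d₁) * (twDeriv τ W W' 0
            - starRingEnd ℂ (phase l a τ) * twDeriv τ W W' (l .e2)))
        + (germ l a * (τ / ε) ^ 2 : ℝ) * ((√(l .e1 + l .e3) : ℝ) * d₁))) :
        HomL2 l × HomL2 l) ∈ homGraph l a ε τ := by
  have hs0 : ((√(l .e1 + l .e3) : ℝ) : ℂ) ≠ 0 := by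
    exact_mod_cast (Real.sqrt_pos.2 (add_pos (hl .e1) (hl .e3))).ne'
  set δ := d₂ - phase l a τ * d₁ with hδ
  have hW := (hs.isW22 .e2).add (hv.isW22.smul (-δ))
  have he : u .e2 + (-δ) • v = u .e2 - δ • v := by rw [neg_smul, sub_eq_add_neg]
  rw [he] at hW
  refine ⟨_, _, _, hW, ?_, ?_, ?_, ?_⟩
  · simp only [Pi.add_apply, Pi.smul_apply, smul_eq_mul, hs.left2, hv.left]
    rw [mul_zero, add_zero]
    exact (mul_div_cancel_left₀ _ hs0).symm
  · have := conj_phase_mul_phase l a τ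
    change _ = ((√(l .e1 + l .e3) : ℝ) : ℂ) * d₁ / _
    simp only [Pi.add_apply, Pi.smul_apply, smul_eq_mul, hs.right2, hv.right]
    rw [mul_div_cancel_left₀ _ hs0, hδ]
    linear_combination d₁ * this
  · filter_upwards [hs.eq2, hv.twDeriv2_eq_zero, Lp.coeFn_add (u'' .e2) ((-δ) • v''),
      Lp.coeFn_smul (-δ) v''] with x e1 e2 e3 e4
    change g .e2 x = _
    rw [e1]
    simp only [twDeriv2] at e2 ⊢
    rw [e3, Pi.add_apply, e4]
    simp only [Pi.add_apply, Pi.smul_apply, smul_eq_mul, Complex.ofReal_one]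
    linear_combination (-δ) * e2
  · have := hs.flux_eq hl hh
    change _ = _ + _ * (((√(l .e1 + l .e3) : ℝ) : ℂ) * d₁)
    change -(1 / _) * _ + _ = _
    simp only [twDeriv, Pi.add_apply, Pi.smul_apply, smul_eq_mul] at this ⊢
    rw [← this]
    ring

end IsFibreSolution

namespace IsHarmonicLift

variable {l τ : ℝ} {v v'' : L2 l} {W W' : ℝ → ℂ}

lemma norm_le_of_zero_one (hl : 0 < l) (hv : IsHarmonicLift l τ 0 1 v W W' v'') : ‖v‖ ≤ √l := by
  rw [← mul_one √l]
  refine L2.norm_le_of_ae_bound hl.le _ zero_le_one ?_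
  filter_upwards [hv.isW22.rep, ae_restrict_mem measurableSet_Ioo] with x e1 hx
  have h := congrArg norm (hv.gauge x (Ioo_subset_Icc_self hx))
  rw [mul_one, sub_zero, zero_add, norm_mul, norm_mul, norm_exp_I_mul_mul, norm_exp_I_mul_mul,
    one_mul, one_mul, ← Complex.ofReal_div, Complex.norm_real,
    Real.norm_of_nonneg (div_nonneg hx.1.le hl.le)] at h
  rw [e1, h]
  exact (div_le_one hl).2 hx.2.le

lemma norm_twDeriv_of_zero_one (hl : 0 < l) (hv : IsHarmonicLift l τ 0 1 v W W' v'') {x : ℝ}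
    (hx : x ∈ Icc (0 : ℝ) l) : ‖twDeriv τ W W' x‖ = 1 / l := by
  have h := congrArg norm (hv.gauge_twDeriv x hx)
  rwa [mul_one, sub_zero, norm_mul, norm_div, norm_exp_I_mul_mul, norm_exp_I_mul_mul, one_mul,
    Complex.norm_real, Real.norm_of_nonneg hl.le] at h

end IsHarmonicLift

namespace IsStiffLift

variable {l a : Edge → ℝ} {τ : ℝ} {h : GraphL2 l}

lemma norm_le (hl : ∀ e, 0 < l e) (hh : IsStiffLift l a τ h) : ‖h‖ ≤ √(l .e1 + l .e3) := by
  have l1 := hl .e1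
  have l3 := hl .e3
  refine Real.le_sqrt_of_sq_le ?_
  rw [hh.norm_sq_eq hl]
  have : 0 ≤ l .e1 * ‖edgePhase l τ .e1 - starRingEnd ℂ (edgePhase l τ .e3) * phase l a τ‖ ^ 2
    + l .e3 * ‖starRingEnd ℂ (edgePhase l τ .e2) - phase l a τ‖ ^ 2 := by positivity
  linarith

lemma exists_bound_norm_sub {l a : Edge → ℝ} (hl : ∀ e, 0 < l e)
    (hl1 : l .e1 + l .e2 + l .e3 = 1) (ha : ∀ e, 0 < a e) : ∃ C : ℝ, 0 ≤ C ∧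
    ∀ {τ : ℝ} {h : GraphL2 l}, IsStiffLift l a τ h → |‖h‖ - √(l .e1 + l .e3)| ≤ C * τ ^ 2 := by
  have hA := stiffness_pos hl ha .e1
  have hB := stiffness_pos hl ha .e3
  have l1 := hl .e1
  have l3 := hl .e3
  have hs0 : 0 < √(l .e1 + l .e3) := Real.sqrt_pos.2 (by positivity)
  refine ⟨(l .e1 / stiffness l a .e1 + l .e3 / stiffness l a .e3) *
      (stiffness l a .e1 * stiffness l a .e3 / (stiffness l a .e1 + stiffness l a .e3))
      / √(l .e1 + l .e3), by positivity, fun {τ h} hh => ?_⟩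
  have h1 := hh.abs_norm_sq_sub_le hl hl1 ha
  rw [div_mul_eq_mul_div, le_div_iff₀ hs0]
  refine le_trans ?_ h1
  have e : ‖h‖ ^ 2 - (l .e1 + l .e3) = (‖h‖ + √(l .e1 + l .e3)) * (‖h‖ - √(l .e1 + l .e3)) := by
    rw [← sq_sub_sq, Real.sq_sqrt (by positivity)]
  rw [e, abs_mul, mul_comm, abs_of_pos (a := ‖h‖ + _) (by positivity)]
  gcongr
  linarith [norm_nonneg h]

end IsStiffLift

namespace IsFibreSolution

variable {l a : Edge → ℝ} {ε τ : ℝ} {u g h : GraphL2 l} {U U' : Edge → ℝ → ℂ}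
  {u'' : ∀ e, L2 (l e)} {d₁ d₂ : ℂ}

/-- The multiplicity of the eigenvector is `O(ε² / τ²)`, since the gap is of order `τ²`. -/
lemma exists_bound_sq_mul_vertex (hl : ∀ e, 0 < l e) (hl1 : l .e1 + l .e2 + l .e3 = 1)
    (ha : ∀ e, 0 < a e) : ∃ C : ℝ, 0 ≤ C ∧
    ∀ {ε τ : ℝ} {u g : GraphL2 l} {U U' : Edge → ℝ → ℂ}
      {u'' : ∀ e, L2 (l e)} {d₁ d₂ : ℂ}, 0 < ε → |τ| ≤ Real.pi →
      IsFibreSolution l a ε τ u g U U' u'' d₁ d₂ →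
      τ ^ 2 * ‖d₁‖ ≤ C * ε ^ 2 * (‖u‖ + ‖g‖) := by
  obtain ⟨cg, hcg0, hcg⟩ := exists_bound_gap hl hl1 ha
  have hA := stiffness_pos hl ha .e1
  have hB := stiffness_pos hl ha .e3
  obtain ⟨k, hk⟩ : ∃ k, k = stiffness l a .e1 * stiffness l a .e3 /
    (stiffness l a .e1 + stiffness l a .e3) := ⟨_, rfl⟩
  have hk0 : 0 < k := by rw [hk]; positivity
  have hpi := Real.pi_pos
  refine ⟨cg / (k * (2 / Real.pi ^ 2)), by positivity, ?_⟩
  intro ε τ u g U U' u'' d₁ d₂ hε hτ hs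
  have hgap := le_stiffGap hl hl1 ha hτ
  rw [← hk] at hgap
  have h1 := (mul_le_mul_of_nonneg_right hgap (norm_nonneg d₁)).trans (hcg hε hs).2
  rw [show cg / (k * (2 / Real.pi ^ 2)) * ε ^ 2 * (‖u‖ + ‖g‖) =
    cg * ε ^ 2 * (‖u‖ + ‖g‖) / (k * (2 / Real.pi ^ 2)) by ring, le_div_iff₀ (by positivity)]
  linarith

set_option maxHeartbeats 1000000 in
/-- The residual of the corrector in `ℂ`.  The terms of order `ε⁻²` cancel up to
`O(τ⁴ / ε²)`, because `(l₁ + l₃) * germ l a * τ²` is the quadratic part of `2 * stiffGap` at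
`τ = 0`. -/
lemma exists_bound_residual (hl : ∀ e, 0 < l e) (hl1 : l .e1 + l .e2 + l .e3 = 1)
    (ha : ∀ e, 0 < a e) {M : ℝ} (hM : 0 ≤ M) : ∃ C : ℝ, 0 ≤ C ∧
    ∀ {ε τ : ℝ} {z : ℂ} {u f h : GraphL2 l} {U U' : Edge → ℝ → ℂ}
      {u'' : ∀ e, L2 (l e)} {d₁ d₂ t : ℂ}, 0 < ε → |τ| ≤ Real.pi → ‖z‖ ≤ M →
      IsFibreSolution l a ε τ u (f + z • u) U U' u'' d₁ d₂ → IsStiffLift l a τ h →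
      ‖t‖ ≤ 2 / l .e2 →
      ‖-(1 / (√(l .e1 + l .e3) : ℝ)) *
        ((stiffGap l a τ / ε ^ 2) * (d₁ + starRingEnd ℂ (phase l a τ) * d₂)
          - inner ℂ h (f + z • u) - (d₂ - phase l a τ * d₁) * t)
        + (germ l a * (τ / ε) ^ 2 : ℝ) * ((√(l .e1 + l .e3) : ℝ) * d₁)
        - z * ((√(l .e1 + l .e3) : ℝ) * d₁) - inner ℂ h f / ‖h‖‖ ≤
      C * (τ ^ 2 + ε ^ 2) * (‖u‖ + ‖f + z • u‖ + ‖f‖) := by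
  obtain ⟨cv, hcv0, hcv⟩ := exists_bound_vertex hl
  obtain ⟨cg, hcg0, hcg⟩ := exists_bound_gap hl hl1 ha
  obtain ⟨cb, hcb0, hcb⟩ := exists_bound_bulk hl hl1 ha
  obtain ⟨ct, hct0, hct⟩ := exists_bound_sq_mul_vertex hl hl1 ha
  obtain ⟨kd, hkd0, hkd⟩ := IsStiffLift.exists_bound_norm_sub hl hl1 ha
  have hA := stiffness_pos hl ha .e1
  have hB := stiffness_pos hl ha .e3
  have l1 := hl .e1
  have l2 := hl .e2
  have l3 := hl .e3
  obtain ⟨k, hk⟩ : ∃ k, k = stiffness l a .e1 * stiffness l a .e3 /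
    (stiffness l a .e1 + stiffness l a .e3) := ⟨_, rfl⟩
  have hk0 : 0 < k := by rw [hk]; positivity
  obtain ⟨c4, hc4⟩ : ∃ c, c = 2 * k + k ^ 2 / (stiffness l a .e1 + stiffness l a .e3) := ⟨_, rfl⟩
  have hc40 : 0 ≤ c4 := by rw [hc4]; positivity
  obtain ⟨kn, hkn⟩ : ∃ c, c = (l .e1 / stiffness l a .e1 + l .e3 / stiffness l a .e3) * k :=
    ⟨_, rfl⟩
  have hkn0 : 0 ≤ kn := by rw [hkn]; positivity
  obtain ⟨s, hs⟩ : ∃ s, s = √(l .e1 + l .e3) := ⟨_, rfl⟩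
  have hs0 : 0 < s := by rw [hs]; exact Real.sqrt_pos.2 (by positivity)
  have hs2 : s ^ 2 = l .e1 + l .e3 := by rw [hs]; exact Real.sq_sqrt (by positivity)
  rw [← hs] at hkd ⊢
  refine ⟨c4 * ct / s + k * cg / s + cg * (2 / l .e2) / s + kd / s
    + M * (cv * kn / s + 2 * cb), by positivity, ?_⟩
  intro ε τ z u f h U U' u'' d₁ d₂ t hε hτ hz hsol hh ht
  obtain ⟨v1, -⟩ := hcv hsol
  obtain ⟨g1, -⟩ := hcg hε hsol
  obtain ⟨b1, b2⟩ := hcb hε hsol hh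
  have hN0 := hh.norm_pos hl
  have hNs := hh.abs_norm_sq_sub_le hl hl1 ha
  rw [← hk, ← hkn, ← hs2] at hNs
  have hNle := hh.norm_le hl
  rw [← hs] at hNle
  have hNd := hkd hh
  have hτd := hct hε hτ hsol
  have hgerm : s ^ 2 * germ l a = k := by rw [hs2, add_mul_germ hl ha, hk]
  have hgap := abs_sub_two_mul_stiffGap_le hl hl1 ha τ
  rw [← hk, ← hc4] at hgap
  have hgap2 := stiffGap_le hl hl1 ha τ
  have hgap0 := stiffGap_nonneg hl hl1 ha τ
  rw [← hk] at hgap2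
  have ew := conj_phase_mul_phase l a τ
  have nw := norm_phase l a τ
  obtain ⟨N, hN⟩ : ∃ N, N = ‖h‖ := ⟨_, rfl⟩
  obtain ⟨μ, hμ⟩ : ∃ x, x = stiffGap l a τ := ⟨_, rfl⟩
  obtain ⟨G, hG⟩ : ∃ x, x = ‖u‖ + ‖f + z • u‖ := ⟨_, rfl⟩
  obtain ⟨γ, hγ⟩ : ∃ x, x = germ l a := ⟨_, rfl⟩
  obtain ⟨w, hw⟩ : ∃ x, x = phase l a τ := ⟨_, rfl⟩
  obtain ⟨r, hr⟩ : ∃ x, x = inner ℂ (h .e1) (u .e1 - d₁ • h .e1)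
    + inner ℂ (h .e3) (u .e3 - d₁ • h .e3) := ⟨_, rfl⟩
  obtain ⟨δ, hδ⟩ : ∃ x, x = d₂ - w * d₁ := ⟨_, rfl⟩
  rw [← hN] at hN0 hNs hNle hNd
  rw [← hμ] at hgap hgap0 hgap2
  rw [← hG] at v1 g1 b1 b2 hτd
  rw [← hγ] at hgerm
  rw [← hw] at g1 ew nw
  rw [← hδ] at g1
  rw [← hG, ← hγ, ← hw, ← hN, ← hμ, ← hδ]
  have hG0 : 0 ≤ G := by rw [hG]; positivity
  have hε2 : 0 < ε ^ 2 := pow_pos hε 2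
  have hhu : inner ℂ h u = d₁ * N ^ 2 + r := by
    have e1 : inner ℂ h u = inner ℂ (h .e1) (u .e1) + inner ℂ (h .e3) (u .e3) := by
      rw [PiLp.inner_apply, sum_edge, hh.soft, inner_zero_left, add_zero]
    have e2 : ((N : ℂ)) ^ 2 = inner ℂ (h .e1) (h .e1) + inner ℂ (h .e3) (h .e3) := by
      have := inner_self_eq_norm_sq_to_K (𝕜 := ℂ) h
      rw [PiLp.inner_apply, sum_edge, hh.soft, inner_zero_left, add_zero] at this
      rw [this, hN]; rfl
    rw [e1, e2, hr]
    simp only [inner_sub_right, inner_smul_right]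
    ring
  have hrn : ‖r‖ ≤ 2 * (N * (cb * ε ^ 2 * G)) := by
    have n1 : ‖h .e1‖ ≤ N := hN ▸ PiLp.norm_apply_le h _
    have n3 : ‖h .e3‖ ≤ N := hN ▸ PiLp.norm_apply_le h _
    have i1 := (norm_inner_le_norm (𝕜 := ℂ) (h .e1) (u .e1 - d₁ • h .e1)).trans
      (mul_le_mul n1 b1 (norm_nonneg _) hN0.le)
    have i3 := (norm_inner_le_norm (𝕜 := ℂ) (h .e3) (u .e3 - d₁ • h .e3)).trans
      (mul_le_mul n3 b2 (norm_nonneg _) hN0.le)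
    rw [hr]
    exact (norm_add_le _ _).trans (by linarith)
  have hsc : ((s : ℝ) : ℂ) ≠ 0 := by exact_mod_cast hs0.ne'
  have hNc : ((N : ℝ) : ℂ) ≠ 0 := by exact_mod_cast hN0.ne'
  have hεc : ((ε : ℝ) : ℂ) ≠ 0 := by exact_mod_cast hε.ne'
  -- The Kirchhoff terms are grouped against the germ, and `⟪h, u⟫` against `d₁ ‖h‖²`; each summand
  -- on the right is then small by itself.
  have key : -(1 / (s : ℂ)) * ((μ / ε ^ 2) * (d₁ + starRingEnd ℂ w * d₂)
          - inner ℂ h (f + z • u) - δ * t) + (γ * (τ / ε) ^ 2 : ℝ) * (s * d₁)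
        - z * (s * d₁) - inner ℂ h f / N =
      ((s ^ 2 * γ * τ ^ 2 - 2 * μ : ℝ) : ℂ) * d₁ / (s * ε ^ 2)
      - μ * (starRingEnd ℂ w * δ) / (s * ε ^ 2) + δ * t / s
      + (((N - s) / (s * N) : ℝ) : ℂ) * inner ℂ h f
      + z * ((((N ^ 2 - s ^ 2) / s : ℝ) : ℂ) * d₁ + r / s) := by
    have hd : starRingEnd ℂ w * d₂ = d₁ + starRingEnd ℂ w * δ := by
      rw [hδ]; linear_combination d₁ * ew
    rw [hd, inner_add_right, inner_smul_right, hhu]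
    push_cast
    field_simp
    ring
  rw [key]
  have nsc : ‖(s : ℂ)‖ = s := by rw [Complex.norm_real, Real.norm_of_nonneg hs0.le]
  have nse : ‖(s : ℂ) * (ε : ℂ) ^ 2‖ = s * ε ^ 2 := by
    rw [norm_mul, nsc, norm_pow, Complex.norm_real, Real.norm_of_nonneg hε.le]
  have t1 : ‖((s ^ 2 * γ * τ ^ 2 - 2 * μ : ℝ) : ℂ) * d₁ / (s * ε ^ 2)‖ ≤
      c4 * ct / s * (τ ^ 2 * G) := by
    rw [norm_div, nse, norm_mul, Complex.norm_real, Real.norm_eq_abs, hgerm,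
      div_le_iff₀ (by positivity)]
    calc _ ≤ c4 * τ ^ 4 * ‖d₁‖ := by gcongr
      _ = c4 * τ ^ 2 * (τ ^ 2 * ‖d₁‖) := by ring
      _ ≤ c4 * τ ^ 2 * (ct * ε ^ 2 * G) := by gcongr
      _ = _ := by field_simp
  have t2 : ‖(μ : ℂ) * (starRingEnd ℂ w * δ) / (s * ε ^ 2)‖ ≤ k * cg / s * (τ ^ 2 * G) := by
    rw [norm_div, nse, norm_mul, norm_mul, RCLike.norm_conj, nw, one_mul, Complex.norm_real,
      Real.norm_of_nonneg hgap0, div_le_iff₀ (by positivity)]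
    calc _ ≤ (k * τ ^ 2) * (cg * ε ^ 2 * G) := by gcongr
      _ = _ := by field_simp
  have t3 : ‖δ * t / s‖ ≤ cg * (2 / l .e2) / s * (ε ^ 2 * G) := by
    rw [norm_div, nsc, norm_mul, div_le_iff₀ hs0]
    calc _ ≤ (cg * ε ^ 2 * G) * (2 / l .e2) := by gcongr
      _ = _ := by field_simp
  have t4 : ‖(((N - s) / (s * N) : ℝ) : ℂ) * inner ℂ h f‖ ≤ kd / s * (τ ^ 2 * ‖f‖) := by
    have h2 := norm_inner_le_norm (𝕜 := ℂ) h f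
    rw [← hN] at h2
    rw [norm_mul, Complex.norm_real, Real.norm_eq_abs, abs_div,
      abs_of_pos (a := s * N) (by positivity)]
    calc _ ≤ (kd * τ ^ 2) / (s * N) * (N * ‖f‖) := by gcongr
      _ = _ := by field_simp
  have t5 : ‖z * ((((N ^ 2 - s ^ 2) / s : ℝ) : ℂ) * d₁ + r / s)‖ ≤
      M * (cv * kn / s * (τ ^ 2 * G) + 2 * cb * (ε ^ 2 * G)) := by
    rw [norm_mul]
    refine mul_le_mul hz ((norm_add_le _ _).trans (add_le_add ?_ ?_)) (norm_nonneg _) hM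
    · rw [norm_mul, Complex.norm_real, Real.norm_eq_abs, abs_div, abs_of_pos (a := s) hs0]
      calc _ ≤ (kn * τ ^ 2) / s * (cv * G) := by gcongr
        _ = _ := by ring
    · rw [norm_div, nsc, div_le_iff₀ hs0]
      calc _ ≤ 2 * (N * (cb * ε ^ 2 * G)) := hrn
        _ ≤ 2 * (s * (cb * ε ^ 2 * G)) := by gcongr
        _ = _ := by ring
  have hP : τ ^ 2 * G ≤ (τ ^ 2 + ε ^ 2) * (G + ‖f‖) :=
    mul_le_mul (by linarith) (by linarith [norm_nonneg f]) hG0 (by positivity)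
  have hQ : ε ^ 2 * G ≤ (τ ^ 2 + ε ^ 2) * (G + ‖f‖) :=
    mul_le_mul (by linarith [sq_nonneg τ]) (by linarith [norm_nonneg f]) hG0 (by positivity)
  have hR : τ ^ 2 * ‖f‖ ≤ (τ ^ 2 + ε ^ 2) * (G + ‖f‖) :=
    mul_le_mul (by linarith) (by linarith) (norm_nonneg f) (by positivity)
  refine (norm_add_le _ _).trans ((add_le_add ((norm_add_le _ _).trans (add_le_add
    ((norm_add_le _ _).trans (add_le_add ((norm_sub_le _ _).trans (add_le_add t1 t2)) t3)) t4))
    t5).trans ?_)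
  rw [mul_assoc _ (τ ^ 2 + ε ^ 2) (G + ‖f‖)]
  generalize (τ ^ 2 + ε ^ 2) * (G + ‖f‖) = Q at hP hQ hR ⊢
  calc _ ≤ c4 * ct / s * Q + k * cg / s * Q + cg * (2 / l .e2) / s * Q + kd / s * Q
        + M * (cv * kn / s * Q + 2 * cb * Q) := by gcongr
    _ = _ := by ring

end IsFibreSolution

lemma GraphL2.norm_le_add {l : Edge → ℝ} (h : GraphL2 l) :
    ‖h‖ ≤ ‖h .e1‖ + ‖h .e2‖ + ‖h .e3‖ := by
  refine (sq_le_sq₀ (norm_nonneg _) (by positivity)).1 ?_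
  rw [GraphL2.norm_sq_eq]
  nlinarith [mul_nonneg (norm_nonneg (h .e1)) (norm_nonneg (h .e2)),
    mul_nonneg (norm_nonneg (h .e1)) (norm_nonneg (h .e3)),
    mul_nonneg (norm_nonneg (h .e2)) (norm_nonneg (h .e3))]

lemma norm_adjoint_homMap_le {l : Edge → ℝ} {φ : GraphL2 l} (hφ : ‖φ‖ = 1) (p : HomL2 l) :
    ‖ContinuousLinearMap.adjoint (homMap φ) p‖ ≤ 2 * ‖p‖ := by
  rw [adjoint_homMap_apply]
  refine (norm_add_le _ _).trans ?_
  have h1 : ‖(WithLp.toLp 2 (Pi.single Edge.e2 p.fst) : GraphL2 l)‖ = ‖p.fst‖ :=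
    congrArg NNReal.toReal (PiLp.nnnorm_single 2 (fun e => L2 (l e)) Edge.e2 p.fst)
  rw [h1, norm_smul, hφ, mul_one]
  linarith [HomL2.norm_fst_le p, HomL2.norm_snd_le p]

lemma sub_adjoint_homMap_apply_of_ne {l : Edge → ℝ} (φ u : GraphL2 l) (p : HomL2 l) {e : Edge}
    (he : e ≠ .e2) :
    (u - ContinuousLinearMap.adjoint (homMap φ) p) e = u e - p.snd • φ e := by
  rw [adjoint_homMap_apply]
  simp [he]

lemma sub_adjoint_homMap_apply_soft {l : Edge → ℝ} {φ : GraphL2 l} (h2 : φ .e2 = 0)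
    (u : GraphL2 l) (p : HomL2 l) :
    (u - ContinuousLinearMap.adjoint (homMap φ) p) .e2 = u .e2 - p.fst := by
  rw [adjoint_homMap_apply]
  simp [h2]

lemma homMap_normalize_snd {l : Edge → ℝ} (h f : GraphL2 l) :
    (homMap ((‖h‖ : ℂ)⁻¹ • h) f).snd = inner ℂ h f / ‖h‖ := by
  rw [homMap_snd, inner_smul_left, map_inv₀, Complex.conj_ofReal, inv_mul_eq_div]

set_option maxHeartbeats 1000000 in
/-- The solutions `u` and `p` of the two resolvent equations are compared through the corrector `P`:
`Ψ* P` is close to `u` by the estimates on the edges, and `P - p` solves the homogenised equation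
with the residual as data. -/
lemma exists_bound_resolvent_sub {l a : Edge → ℝ} (hl : ∀ e, 0 < l e)
    (hl1 : l .e1 + l .e2 + l .e3 = 1) (ha : ∀ e, 0 < a e) (ha2 : a .e2 = 1) {M σ : ℝ}
    (hM : 0 ≤ M) (hσ : 0 < σ) : ∃ C : ℝ, 0 ≤ C ∧
    ∀ {ε τ : ℝ} {z : ℂ} {u f h : GraphL2 l} {p : HomL2 l}, 0 < ε → |τ| ≤ Real.pi → ‖z‖ ≤ M →
      σ ≤ |z.im| → ‖u‖ ≤ ‖f‖ / σ → (u, f + z • u) ∈ (exGraph l a ε τ).opGraph τ →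
      IsStiffLift l a τ h →
      (p, homMap ((‖h‖ : ℂ)⁻¹ • h) f + z • p) ∈ homGraph l a ε τ →
      ‖u - ContinuousLinearMap.adjoint (homMap ((‖h‖ : ℂ)⁻¹ • h)) p‖ ≤ C * ε ^ 2 * ‖f‖ := by
  obtain ⟨cg, hcg0, hcg⟩ := IsFibreSolution.exists_bound_gap hl hl1 ha
  obtain ⟨cb, hcb0, hcb⟩ := IsFibreSolution.exists_bound_bulk hl hl1 ha
  obtain ⟨ct, hct0, hct⟩ := IsFibreSolution.exists_bound_sq_mul_vertex hl hl1 ha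
  obtain ⟨cr, hcr0, hcr⟩ := IsFibreSolution.exists_bound_residual hl hl1 ha hM
  obtain ⟨kd, hkd0, hkd⟩ := IsStiffLift.exists_bound_norm_sub hl hl1 ha
  obtain ⟨cy, hcy0, hcy⟩ := exists_bound_hom_residual hl ha hM hσ
  have hl2 := hl .e2
  obtain ⟨cK, hcK⟩ : ∃ c, c = (1 + M) / σ + 2 := ⟨_, rfl⟩
  have hcK0 : 0 ≤ cK := by rw [hcK]; positivity
  obtain ⟨cB, hcB⟩ : ∃ c, c = M * (cg * √(l .e2)) + cr := ⟨_, rfl⟩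
  have hcB0 : 0 ≤ cB := by rw [hcB]; positivity
  refine ⟨(2 * (cb + kd * ct) + cg * √(l .e2) + 2 * (cy * cB)) * cK, by positivity, ?_⟩
  intro ε τ z u f h p hε hτ hz hzσ hu hmem hh hp
  obtain ⟨U, U', u'', d₁, d₂, hsol⟩ := exists_isFibreSolution ha2 hε hmem
  obtain ⟨v, W, W', v'', hv⟩ := exists_isHarmonicLift hl2 τ 0 1
  have hcor := hsol.corrector_mem_homGraph hl hh hv
  have hN0 := hh.norm_pos hl
  have hNc : ((‖h‖ : ℝ) : ℂ) ≠ 0 := by exact_mod_cast hN0.ne'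
  have hφ : ‖(‖h‖ : ℂ)⁻¹ • h‖ = 1 := by
    rw [norm_smul, norm_inv, Complex.norm_real, norm_norm, inv_mul_cancel₀ hN0.ne']
  have nv := hv.norm_le_of_zero_one hl2
  have ht : ‖twDeriv τ W W' 0 - starRingEnd ℂ (phase l a τ) * twDeriv τ W W' (l .e2)‖ ≤
      2 / l .e2 := by
    refine (norm_sub_le _ _).trans (le_of_eq ?_)
    rw [norm_mul, RCLike.norm_conj, norm_phase, hv.norm_twDeriv_of_zero_one hl2 ⟨le_rfl, hl2.le⟩,
      hv.norm_twDeriv_of_zero_one hl2 ⟨hl2.le, le_rfl⟩]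
    ring
  have hr := hcr hε hτ hz hsol hh ht
  have hτd := hct hε hτ hsol
  obtain ⟨g1, -⟩ := hcg hε hsol
  obtain ⟨b1, b3⟩ := hcb hε hsol hh
  have hNd := hkd hh
  obtain ⟨q, hcor, hr⟩ : ∃ q : ℂ, ((WithLp.toLp 2 (u .e2 - (d₂ - phase l a τ * d₁) • v,
      (√(l .e1 + l .e3) : ℝ) * d₁), WithLp.toLp 2 ((f + z • u) .e2, q)) : HomL2 l × HomL2 l) ∈
        homGraph l a ε τ ∧
      ‖q - z * ((√(l .e1 + l .e3) : ℝ) * d₁) - inner ℂ h f / ‖h‖‖ ≤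
        cr * (τ ^ 2 + ε ^ 2) * (‖u‖ + ‖f + z • u‖ + ‖f‖) := ⟨_, hcor, hr⟩
  obtain ⟨δ, hδ⟩ : ∃ x, x = d₂ - phase l a τ * d₁ := ⟨_, rfl⟩
  obtain ⟨φ, hφdef⟩ : ∃ x : GraphL2 l, x = (‖h‖ : ℂ)⁻¹ • h := ⟨_, rfl⟩
  obtain ⟨s, hs⟩ : ∃ s, s = √(l .e1 + l .e3) := ⟨_, rfl⟩
  have hf : (homMap φ f).snd = inner ℂ h f / ‖h‖ := hφdef ▸ homMap_normalize_snd h f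
  rw [← hδ] at hcor g1
  rw [← hs] at hcor hr hNd
  rw [← hφdef] at hφ hp ⊢
  rw [← hf] at hr
  obtain ⟨P, hP⟩ : ∃ P : HomL2 l, P = WithLp.toLp 2 (u .e2 - δ • v, (s : ℂ) * d₁) := ⟨_, rfl⟩
  obtain ⟨Q, hQ⟩ : ∃ Q : HomL2 l, Q = WithLp.toLp 2 ((f + z • u) .e2, q) := ⟨_, rfl⟩
  rw [← hP, ← hQ] at hcor
  obtain ⟨K, hK⟩ : ∃ x, x = ‖u‖ + ‖f + z • u‖ := ⟨_, rfl⟩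
  rw [← hK] at hr hτd g1 b1 b3
  have hK0 : 0 ≤ K := by rw [hK]; positivity
  have hKf : K + ‖f‖ ≤ cK * ‖f‖ := by
    have h1 : ‖f + z • u‖ ≤ ‖f‖ + M * ‖u‖ := by
      refine (norm_add_le _ _).trans (add_le_add_right ?_ _)
      rw [norm_smul]
      gcongr
    have h2 : (1 + M) * ‖u‖ ≤ (1 + M) * (‖f‖ / σ) := by gcongr
    have h3 : cK * ‖f‖ = (1 + M) * (‖f‖ / σ) + 2 * ‖f‖ := by rw [hcK]; ring
    rw [h3, hK]
    linarith
  have hε2 : 0 ≤ ε ^ 2 := sq_nonneg ε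
  have nδ : ‖δ • v‖ ≤ cg * √(l .e2) * ε ^ 2 * K := by
    rw [norm_smul]
    calc _ ≤ (cg * ε ^ 2 * K) * √(l .e2) := by gcongr
      _ = _ := by ring
  -- The residual of the corrector in the equation for `p`.
  have hy : (P - p, (Q - z • P - homMap φ f) + z • (P - p)) ∈ homGraph l a ε τ := by
    have := (homGraph l a ε τ).sub_mem hcor hp
    rw [Prod.mk_sub_mk] at this
    convert this using 2
    rw [smul_sub]; abel
  have r1 : ‖(Q - z • P - homMap φ f).fst‖ ≤ ε ^ 2 * (cB * (K + ‖f‖)) := by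
    have e : (Q - z • P - homMap φ f).fst = z • δ • v := by
      have : (Q - z • P - homMap φ f).fst =
          (f .e2 + z • u .e2) - z • (u .e2 - δ • v) - f .e2 := by rw [hQ, hP]; rfl
      rw [this, smul_sub]; abel
    rw [e, norm_smul]
    calc _ ≤ M * (cg * √(l .e2) * ε ^ 2 * K) := by gcongr
      _ = ε ^ 2 * ((M * (cg * √(l .e2))) * K) := by ring
      _ ≤ _ := by
        rw [hcB]
        gcongr
        · linarith
        · linarith [norm_nonneg f]
  have r2 : ‖(Q - z • P - homMap φ f).snd‖ ≤ (τ ^ 2 + ε ^ 2) * (cB * (K + ‖f‖)) := by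
    have e : (Q - z • P - homMap φ f).snd = q - z * (s * d₁) - (homMap φ f).snd := by
      rw [hQ, hP]; rfl
    rw [e]
    refine hr.trans ?_
    rw [mul_comm cr, mul_assoc]
    gcongr
    rw [hcB]
    have : 0 ≤ M * (cg * √(l .e2)) := by positivity
    linarith
  have ny := hcy hε hz hzσ (by positivity) hy r1 r2
  -- On a stiff edge `Ψ* P` is `d₁ h` up to the error of normalisation `√(l₁ + l₃) / ‖h‖ - 1`.
  have edge {e : Edge} (he : ‖u e - d₁ • h e‖ ≤ cb * ε ^ 2 * K) :
      ‖u e - (s * d₁) • φ e‖ ≤ (cb + kd * ct) * ε ^ 2 * K := by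
    have e1 : u e - (s * d₁) • φ e =
        (u e - d₁ • h e) + (d₁ * (((‖h‖ - s) / ‖h‖ : ℝ) : ℂ)) • h e := by
      have : φ e = (‖h‖ : ℂ)⁻¹ • h e := by rw [hφdef]; rfl
      rw [this, smul_smul, sub_add, sub_right_inj, ← sub_smul]
      congr 1
      push_cast
      field_simp
      ring
    have nh : ‖h e‖ ≤ ‖h‖ := PiLp.norm_apply_le h e
    have e2 : ‖(d₁ * (((‖h‖ - s) / ‖h‖ : ℝ) : ℂ)) • h e‖ ≤ kd * ct * ε ^ 2 * K := by
      rw [norm_smul, norm_mul, Complex.norm_real, Real.norm_eq_abs, abs_div, abs_norm]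
      calc _ ≤ ‖d₁‖ * (kd * τ ^ 2 / ‖h‖) * ‖h‖ := by gcongr
        _ = kd * (τ ^ 2 * ‖d₁‖) := by field_simp
        _ ≤ kd * (ct * ε ^ 2 * K) := by gcongr
        _ = _ := by ring
    rw [e1]
    refine (norm_add_le _ _).trans ((add_le_add he e2).trans (le_of_eq ?_))
    ring
  have nP : ‖u - ContinuousLinearMap.adjoint (homMap φ) P‖ ≤
      (2 * (cb + kd * ct) + cg * √(l .e2)) * ε ^ 2 * K := by
    have h0 : φ .e2 = 0 := by rw [hφdef, PiLp.smul_apply, hh.soft, smul_zero]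
    have c2 : u .e2 - P.fst = δ • v := by
      rw [hP]
      exact sub_sub_cancel _ _
    have cs : P.snd = s * d₁ := congrArg (fun p : HomL2 l => p.snd) hP
    refine (GraphL2.norm_le_add _).trans ?_
    rw [sub_adjoint_homMap_apply_of_ne φ u P (by decide), sub_adjoint_homMap_apply_soft h0,
      sub_adjoint_homMap_apply_of_ne φ u P (by decide), c2, cs]
    calc _ ≤ (cb + kd * ct) * ε ^ 2 * K + cg * √(l .e2) * ε ^ 2 * K
          + (cb + kd * ct) * ε ^ 2 * K := by
          gcongr
          exacts [edge b1, edge b3]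
      _ = _ := by ring
  have e : u - ContinuousLinearMap.adjoint (homMap φ) p =
      (u - ContinuousLinearMap.adjoint (homMap φ) P)
      + ContinuousLinearMap.adjoint (homMap φ) (P - p) := by
    rw [map_sub]; abel
  rw [e]
  refine (norm_add_le _ _).trans ((add_le_add nP ((norm_adjoint_homMap_le hφ _).trans
    (mul_le_mul_of_nonneg_left ny zero_le_two))).trans ?_)
  calc _ ≤ (2 * (cb + kd * ct) + cg * √(l .e2)) * ε ^ 2 * (K + ‖f‖)
        + 2 * (cy * ε ^ 2 * (cB * (K + ‖f‖))) := by
        gcongr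
        linarith [norm_nonneg f]
    _ = (2 * (cb + kd * ct) + cg * √(l .e2) + 2 * (cy * cB)) * ε ^ 2 * (K + ‖f‖) := by ring
    _ ≤ (2 * (cb + kd * ct) + cg * √(l .e2) + 2 * (cy * cB)) * ε ^ 2 * (cK * ‖f‖) := by gcongr
    _ = _ := by ring

lemma isAdmissible_exGraph {l a : Edge → ℝ} (hl : ∀ e, 0 < l e) (ha : ∀ e, 0 < a e) {ε : ℝ}
    (hε : 0 < ε) (τ : ℝ) : (exGraph l a ε τ).IsAdmissible where
  len_pos := hl
  coef_pos := fun e => by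
    have hw : 0 < edgeWeight a ε e := by
      cases e
      · exact ha _
      · exact mul_pos (ha _) hε
      · exact ha _
    exact div_pos (pow_pos hw 2) (pow_pos hε 2)
  norm_wSrc := fun e => by
    cases e
    · exact norm_edgePhase l τ .e3
    · exact norm_one
    · exact norm_one
  norm_wTgt := fun e => by
    cases e
    · exact norm_one
    · exact norm_one
    · change ‖Complex.exp (Complex.I * τ * (l .e2 + l .e3))‖ = 1
      rw [exp_eq_edgePhase_mul, norm_mul, norm_edgePhase, norm_edgePhase, one_mul]
  exists_edge := fun v => by
    cases v
    · exact ⟨.e2, Or.inl rfl⟩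
    · exact ⟨.e1, Or.inl rfl⟩

theorem mainTheorem1 (l a : Edge → ℝ) (hl : ∀ e, 0 < l e)
    (hl1 : l .e1 + l .e2 + l .e3 = 1) (ha : ∀ e, 0 < a e) (ha2 : a .e2 = 1) :
    (∀ ε : ℝ, 0 < ε → ∀ τ ∈ Set.Ico (-Real.pi) Real.pi,
      IsSelfAdjoint (fibreOp l a ε τ) ∧ IsSelfAdjoint (homOp l a ε τ)) ∧
    ∃ Ψ : ℝ → (GraphL2 l →L[ℂ] HomL2 l),
      (∀ τ ∈ Set.Ico (-Real.pi) Real.pi,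
        IsPartialIsometry (Ψ τ) ∧
        (∀ u, (Ψ τ u).fst = u .e2) ∧
        (∀ u, u .e1 = 0 → u .e3 = 0 → (Ψ τ u).snd = 0)) ∧
      ∀ K : Set ℂ, IsCompact K → ∀ σ : ℝ, 0 < σ →
        ∃ C : ℝ, ∃ ε₀ : ℝ, 0 < ε₀ ∧ ∀ ε : ℝ, 0 < ε → ε ≤ ε₀ →
          ∀ τ ∈ Set.Ico (-Real.pi) Real.pi, ∀ z ∈ specSet K σ,
            ∃ (R : GraphL2 l →L[ℂ] GraphL2 l) (Rhom : HomL2 l →L[ℂ] HomL2 l),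
              IsResolventAt (fibreOp l a ε τ) z R ∧
              IsResolventAt (homOp l a ε τ) z Rhom ∧
              ‖R - ContinuousLinearMap.adjoint (Ψ τ) ∘L Rhom ∘L Ψ τ‖ ≤ C * ε ^ 2 := by
  have gA (ε τ : ℝ) : (fibreOp l a ε τ).graph = (exGraph l a ε τ).opGraph τ :=
    (exGraph l a ε τ).graph_op τ
  have gH (ε τ : ℝ) : (homOp l a ε τ).graph = homGraph l a ε τ := graph_homOp l a (hl .e2) ε τ
  have symA {ε : ℝ} (hε : 0 < ε) (τ : ℝ) : ∀ x ∈ (fibreOp l a ε τ).graph,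
      ∀ y ∈ (fibreOp l a ε τ).graph, inner ℂ x.2 y.1 = inner ℂ x.1 y.2 := by
    rw [gA]
    exact WeightedGraph.inner_opGraph (isAdmissible_exGraph hl ha hε τ) τ
  have solA {ε : ℝ} (hε : 0 < ε) (τ : ℝ) (z : ℂ) (hz : z.im ≠ 0) (f : GraphL2 l) :
      ∃ x ∈ (fibreOp l a ε τ).graph, x.2 - z • x.1 = f := by
    rw [gA]
    exact WeightedGraph.exists_mem_opGraph_sub_smul_eq (isAdmissible_exGraph hl ha hε τ) τ hz f
  have symH (ε τ : ℝ) : ∀ x ∈ (homOp l a ε τ).graph,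
      ∀ y ∈ (homOp l a ε τ).graph, inner ℂ x.2 y.1 = inner ℂ x.1 y.2 := by
    rw [gH]
    exact inner_homGraph a hl ε τ
  have solH (ε τ : ℝ) (z : ℂ) (hz : z.im ≠ 0) (f : HomL2 l) :
      ∃ x ∈ (homOp l a ε τ).graph, x.2 - z • x.1 = f := by
    rw [gH]
    exact exists_mem_homGraph_sub_smul_eq a hl ε τ hz f
  refine ⟨fun ε hε τ _ =>
    ⟨LinearPMap.isSelfAdjoint_of_symmetric_of_surjective (symA hε τ) (solA hε τ),
      LinearPMap.isSelfAdjoint_of_symmetric_of_surjective (symH ε τ) (solH ε τ)⟩, ?_⟩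
  choose h hh using fun τ => exists_isStiffLift hl a τ
  refine ⟨fun τ => homMap ((‖h τ‖ : ℂ)⁻¹ • h τ), fun τ _ => ⟨?_, fun u => rfl, ?_⟩, ?_⟩
  · refine isPartialIsometry_homMap (by simp [(hh τ).soft]) ?_
    rw [norm_smul, norm_inv, Complex.norm_real, norm_norm,
      inv_mul_cancel₀ ((hh τ).norm_pos hl).ne']
  · intro u h1 h3
    rw [homMap_normalize_snd, PiLp.inner_apply, sum_edge, h1, h3, (hh τ).soft]
    simp
  · intro K hK σ hσ
    obtain ⟨M, hM⟩ := hK.isBounded.exists_norm_le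
    obtain ⟨C, hC0, hC⟩ := exists_bound_resolvent_sub hl hl1 ha ha2 (le_max_right M 0) hσ
    refine ⟨C, 1, one_pos, ?_⟩
    rintro ε hε - τ hτ z ⟨hzK, hzσ⟩
    have hz : z.im ≠ 0 := abs_pos.1 (hσ.trans_le hzσ)
    obtain ⟨R, hR, hRg⟩ := LinearPMap.exists_isResolventAt (symA hε τ) hz (solA hε τ z hz)
    obtain ⟨S, hS, hSg⟩ := LinearPMap.exists_isResolventAt (symH ε τ) hz (solH ε τ z hz)
    refine ⟨R, S, hR, hS, ContinuousLinearMap.opNorm_le_bound _ (by positivity) fun f => ?_⟩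
    have hRf := hRg f
    have hSf := hSg (homMap ((‖h τ‖ : ℂ)⁻¹ • h τ) f)
    have hn : ‖R f‖ ≤ ‖f‖ / σ := by
      have := abs_im_mul_norm_le_of_inner_eq (symA hε τ _ hRf _ hRf) z
      simp only [add_sub_cancel_right] at this
      rw [le_div_iff₀ hσ]
      nlinarith [mul_le_mul_of_nonneg_right hzσ (norm_nonneg (R f))]
    rw [gA] at hRf
    rw [gH] at hSf
    exact hC hε (abs_le.2 ⟨hτ.1, hτ.2.le⟩) ((hM z hzK).trans (le_max_left _ _)) hzσ hn hRf (hh τ)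
      hSf
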